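/- **Setting.** Let $\mathbb X,\mathbb A$ be finite sets, $H\ge1$ a horizon, $N\ge 1$ a batch size, $\mathbb P_h(x,a)$ ($h\in[1:H-1]$) transition probabilities on $\mathbb X$, and $r_h:\mathbb X\times\mathbb A\to[0,1]$ ($h<H$), $r_H:\mathbb X\to[0,1]$ costs; write $r_H(x,a)=r_H(x)$. A functional $\rho:\mathbb R^{\mathbb X}\to\mathbb R$ is a coherent measure of risk if it is convex, monotone, satisfies $\rho(V+b)=\rho(V)+b$ for constants $b$, and is positively homogeneous. For $h<H$ let $\sigma^{\rm b}_h(x,P,\cdot)$ be, for every $x\in\mathbb X$ and every probability $P$ on $\mathbb X$, a coherent measure of risk that depends only on the values of its argument on the support of $P$, and let $$\sigma_h(x,P,V)=\mathbb E_{Y^{1:N}\sim P^N}\big[\sigma_h^{\rm b}\big(x,\tfrac1N\textstyle\sum_j\delta_{Y^j},V\big)\big]$$ be the mini-batch transition risk mapping. For a Markov policy $\pi$ put $V_H^\pi=V_H^\star=r_H$ and, for $h<H$, $V_h^\pi(x)=r_h(x,\pi_h(x))+\sigma_h(x,\mathbb P_h(x,\pi_h(x)),V^\pi_{h+1})$,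 $V_h^\star(x)=\min_a\{r_h(x,a)+\sigma_h(x,\mathbb P_h(x,a),V^\star_{h+1})\}$. The model is *multipattern* with feature map $\varphi$ from $\mathbb X\times\mathbb A$ to the unit simplex of $\mathbb R^d$: for each $h\le H$ there is $\theta_h\in\mathbb R^d$ with $\|\theta_h\|\le\sqrt d$ and $r_h(x,a)=\varphi(x,a)^\top\theta_h$ for all $(x,a)$, and for each $h<H$ there are coherent measures of risk $\rho_{h1},\dots,\rho_{hd}$ on $\mathbb R^{\mathbb X}$, with $\|\rho_h(1)\|\le\sqrt d$, such that $\sigma_h(x,\mathbb P_h(x,a),V)=\sum_j\varphi_j(x,a)\rho_{hj}(V)$ for all $x,a,V$. **Algorithm** (parameters $\lambda>0$, $\beta$). In episode $k=1,\dots,K$ an initial state $x_1^k$ is received (it may depend on the past). With $Q^k_{H+1}=0$, compute for $h=H,\dots,1$ $$\Lambda_h^k=\sum_{\tau<k}\varphi_h^\tau(\varphi_h^\tau)^\top+\lambda I,\qquad w_h^k=(\Lambda_h^k)^{-1}\sum_{\tau<k}\varphi_h^\tau\big[r_h(x_h^\tau,a_h^\tau)+\widetilde\Psi_{h+1}^\tau(Q_{h+1}^k)\big],$$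 $$Q_h^k(x,a)=\max\big\{(w_h^k)^\top\varphi(x,a)-\beta\,[\varphi(x,a)^\top(\Lambda_h^k)^{-1}\varphi(x,a)]^{1/2},\,0\big\},$$ where $\varphi_h^\tau=\varphi(x_h^\tau,a_h^\tau)$ and the $\widetilde\Psi$-term is absent for $h=H$. Let $\pi_{k,h}(x)\in\arg\min_aQ_h^k(x,a)$ (ties broken arbitrarily, using past information only). Then for $h=1,2,\dots,H$ take $a_h^k=\pi_{k,h}(x_h^k)$ and, if $h<H$, observe a batch $Y_{h+1}^k$ of $N$ states that are, given the past $\mathcal F_h^k$, independent with law $\mathbb P_h(x_h^k,a_h^k)$, and let $x_{h+1}^k$ be a uniformly chosen element of the batch. Here $\mathcal F_h^k$ is the information available when $x_h^k$ is reached; it contains all earlier states, actions and batches. The basic algorithm uses $\widetilde\Psi_{h+1}^\tau(Q)=\sigma^{\rm b}_h\big(x_h^\tau,\frac1N\sum_j\delta_{Y_{h+1}^{\tau,j}},\min_aQ(\cdot,a)\big)$. An *$L$-economical estimator* is any family of random functionals $\widetilde\Psi_{h+1}^\tau$ on $\mathbb R^{\mathbb X\times\mathbb A}$ such that $\widetilde\Psi_{h+1}^\tau(Q)$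 is $\mathcal F_{h+1}^\tau$-measurable, $\widetilde\Psi_{h+1}^\tau(0)=0$, $|\widetilde\Psi_{h+1}^\tau(Q)-\widetilde\Psi_{h+1}^\tau(Q')|\le L\max|Q-Q'|$, and, for every $Q$, $$\mathbb E\big[\widetilde\Psi_{h+1}^\tau(Q)\,\big|\,\mathcal F_h^\tau\big]=\sigma_h\big(x_h^\tau,\mathbb P_h(x_h^\tau,a_h^\tau),\min_aQ(\cdot,a)\big).$$ **Theorem.** For all $B,L\ge1$ there is a constant $c_\beta>0$, depending only on $B$ and $L$, such that the following holds for every model as above and all $K\ge1$ and $p\in(0,1)$. Let $\Gamma=\ln(2dKH/p)$, let $\lambda>0$ satisfy $\lambda\le B$ and $\ln(1/\lambda)\le B\,\Gamma$, and run the algorithm with $\beta=c_\beta dH\sqrt{\Gamma}$, either in its basic form or with $L$-economical estimators. Then with probability at least $1-p$, $$\sum_{k=1}^K\big[V_1^{\pi_k}(x_1^k)-V_1^\star(x_1^k)\big]\le c_\beta H^2N^Hd\sqrt K\sqrt{2d\,\Gamma\ln(1+K/\lambda)} .$$ (In particular $B=L=1$ gives an absolute constant for the basic algorithm and all $\lambda\in[p/(2dKH),1]$;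 for any fixed $\lambda>0$ the constant for the basic algorithm depends on $\lambda$ only.) -/

import Mathlib

noncomputable section

namespace RiskQ

open MeasureTheory

/-- Coherent measures of risk on the space of real functions on `X`
(the four axioms: convexity, monotonicity, translation, positive homogeneity). -/
structure IsCoherent {X : Type*} (ρ : (X → ℝ) → ℝ) : Prop where
  convex : ∀ (V W : X → ℝ) (t : ℝ), 0 ≤ t → t ≤ 1 →
    ρ (fun x => t * V x + (1 - t) * W x) ≤ t * ρ V + (1 - t) * ρ W
  monotone : ∀ V W : X → ℝ, (∀ x, V x ≤ W x) → ρ V ≤ ρ W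
  translation : ∀ (V : X → ℝ) (b : ℝ), ρ (fun x => V x + b) = ρ V + b
  pos_homogeneous : ∀ (V : X → ℝ) (t : ℝ), 0 ≤ t → ρ (fun x => t * V x) = t * ρ V

/-- A coherent transition risk mapping `σ(x, P, V)`: a coherent measure of risk of `V` on the
probability space `(X, P)`, so that only the values of `V` on the support of `P` matter.
(For an empirical measure this says that `σ` is a function of the batch values of `V`.) -/
structure IsTransitionRiskMapping {X : Type*} (σ : X → PMF X → (X → ℝ) → ℝ) : Prop where
  coherent : ∀ x P, IsCoherent (σ x P)
  congr_support : ∀ (x : X) (P : PMF X) (V W : X → ℝ),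
    (∀ y ∈ P.support, V y = W y) → σ x P V = σ x P W

/-- The empirical measure `(1/N) ∑ j, δ_{y j}` of a batch. -/
def empirical {X : Type*} {N : ℕ} [NeZero N] (y : Fin N → X) : PMF X :=
  (PMF.uniformOfFintype (Fin N)).map y

/-- The probability of the batch `y` under `N` independent draws from `P`. -/
def batchProb {X : Type*} {N : ℕ} (P : PMF X) (y : Fin N → X) : ℝ :=
  ∏ j, (P (y j)).toReal

/-- The mini-batch transition risk mapping
`σ^{(N)}(x, P, V) = E_{Y ∼ P^N} [σ^b(x, P^{(N)}, V)]` with base mapping `σ^b`. -/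
def miniBatch {X : Type*} [Fintype X] (N : ℕ) [NeZero N]
    (σb : X → PMF X → (X → ℝ) → ℝ) (x : X) (P : PMF X) (V : X → ℝ) : ℝ :=
  ∑ y : Fin N → X, batchProb P y * σb x (empirical y) V

/-- The data of a finite-horizon risk-averse MDP with stages `1, …, H`: controlled kernels, stage
costs, terminal cost, and the base risk mappings from which the mini-batch mappings are built. -/
structure RiskMDP (X A : Type*) (H : ℕ) where
  kernel : ℕ → X → A → PMF X
  cost : ℕ → X → A → ℝ
  termCost : X → ℝ
  baseRisk : ℕ → X → PMF X → (X → ℝ) → ℝ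
  cost_mem : ∀ h, 1 ≤ h → h < H → ∀ x a, cost h x a ∈ Set.Icc (0 : ℝ) 1
  termCost_mem : ∀ x, termCost x ∈ Set.Icc (0 : ℝ) 1
  baseRisk_coherent : ∀ h, 1 ≤ h → h < H → IsTransitionRiskMapping (baseRisk h)

namespace RiskMDP

variable {X A : Type*} {H : ℕ}

/-- `r_h(x, a)` for `h ∈ [1:H]`, with `r_H(x, a) = r_H(x)`. -/
def stageCost (M : RiskMDP X A H) (h : ℕ) (x : X) (a : A) : ℝ :=
  if h = H then M.termCost x else M.cost h x a

/-- `σ^{(N)}_h(x, P_h(x, a), V)`. -/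
def risk [Fintype X] (M : RiskMDP X A H) (N : ℕ) [NeZero N] (h : ℕ) (x : X) (a : A)
    (V : X → ℝ) : ℝ :=
  miniBatch N (M.baseRisk h) x (M.kernel h x a) V

/-- The value of a Markov policy with `n` transitions to go, i.e. at stage `H - n`. -/
def policyValueAux [Fintype X] (M : RiskMDP X A H) (N : ℕ) [NeZero N] (π : ℕ → X → A) :
    ℕ → X → ℝ
  | 0 => fun x => M.termCost x
  | n + 1 => fun x =>
      M.cost (H - (n + 1)) x (π (H - (n + 1)) x) +
        M.risk N (H - (n + 1)) x (π (H - (n + 1)) x) (policyValueAux M N π n)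

/-- `V_h^π`, `h ∈ [1:H]`. -/
def policyValue [Fintype X] (M : RiskMDP X A H) (N : ℕ) [NeZero N] (π : ℕ → X → A)
    (h : ℕ) : X → ℝ :=
  M.policyValueAux N π (H - h)

/-- The optimal value with `n` transitions to go, by risk-averse dynamic programming. -/
def optValueAux [Fintype X] (M : RiskMDP X A H) (N : ℕ) [NeZero N] : ℕ → X → ℝ
  | 0 => fun x => M.termCost x
  | n + 1 => fun x =>
      ⨅ a : A, (M.cost (H - (n + 1)) x a + M.risk N (H - (n + 1)) x a (optValueAux M N n))

/-- `V_h^⋆`, `h ∈ [1:H]`. -/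
def optValue [Fintype X] (M : RiskMDP X A H) (N : ℕ) [NeZero N] (h : ℕ) : X → ℝ :=
  M.optValueAux N (H - h)

/-- The multipattern property with respect to the feature map `φ` into the unit simplex. -/
structure IsMultipattern [Fintype X] (M : RiskMDP X A H) (N : ℕ) [NeZero N] {d : ℕ}
    (φ : X → A → Fin d → ℝ) : Prop where
  simplex : ∀ x a, φ x a ∈ stdSimplex ℝ (Fin d)
  cost_linear : ∀ h, 1 ≤ h → h ≤ H → ∃ θ : Fin d → ℝ, ‖WithLp.toLp 2 θ‖ ≤ √(d : ℝ) ∧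
    ∀ x a, M.stageCost h x a = ∑ j, φ x a j * θ j
  risk_patterns : ∀ h, 1 ≤ h → h < H → ∃ ρ : Fin d → (X → ℝ) → ℝ,
    (∀ j, IsCoherent (ρ j)) ∧
    ‖WithLp.toLp 2 (fun j => ρ j (fun _ => 1))‖ ≤ √(d : ℝ) ∧
    ∀ x a (V : X → ℝ), M.risk N h x a V = ∑ j, φ x a j * ρ j V

end RiskMDP

section Algorithm

variable {X A : Type*} {H d : ℕ}

/-- `Λ_h^k = ∑_{τ<k} φ(x^τ,a^τ) φ(x^τ,a^τ)ᵀ + λ I` for the states `xs τ` and actions `as τ` visited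
at a given stage in the episodes `τ = 1, …, k - 1`. -/
def gram (φ : X → A → Fin d → ℝ) (lam : ℝ) (xs : ℕ → X) (as : ℕ → A) (k : ℕ) :
    Matrix (Fin d) (Fin d) ℝ :=
  ∑ τ ∈ Finset.Ico 1 k, Matrix.vecMulVec (φ (xs τ) (as τ)) (φ (xs τ) (as τ)) + lam • 1

/-- The regression weights `w_h = (Λ_h^k)⁻¹ ∑_{τ<k} target_τ φ(x^τ, a^τ)`. -/
def weights (φ : X → A → Fin d → ℝ) (lam : ℝ) (xs : ℕ → X) (as : ℕ → A) (k : ℕ)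
    (target : ℕ → ℝ) : Fin d → ℝ :=
  (gram φ lam xs as k)⁻¹.mulVec (∑ τ ∈ Finset.Ico 1 k, target τ • φ (xs τ) (as τ))

/-- The backward pass of episode `k`: `qHatAux … n` is `Q_{H+1-n}^k`, starting from `Q_{H+1}^k = 0`.
Here `xs h τ`, `as h τ` are the states and actions of stage `h` in episode `τ`, and `est h τ Q` is
the estimate of the transition risk at stage `h` in episode `τ` of the function
`min_a Q(·, a)` of the next state. At the last stage there is no transition and no such term. -/
def qHatAux (M : RiskMDP X A H) (φ : X → A → Fin d → ℝ) (lam β : ℝ)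
    (xs : ℕ → ℕ → X) (as : ℕ → ℕ → A) (est : ℕ → ℕ → (X → A → ℝ) → ℝ) (k : ℕ) :
    ℕ → X → A → ℝ
  | 0 => fun _ _ => 0
  | n + 1 => fun x a =>
      max
        (dotProduct
            (weights φ lam (xs (H - n)) (as (H - n)) k (fun τ =>
              M.stageCost (H - n) (xs (H - n) τ) (as (H - n) τ) +
                if H - n < H then
                  est (H - n) τ (qHatAux M φ lam β xs as est k n)
                else 0))
            (φ x a)
          - β * √(dotProduct (φ x a)
              ((gram φ lam (xs (H - n)) (as (H - n)) k)⁻¹.mulVec (φ x a))))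
        0

/-- `Q_h^k`, `h ∈ [1:H]`. -/
def qHat (M : RiskMDP X A H) (φ : X → A → Fin d → ℝ) (lam β : ℝ)
    (xs : ℕ → ℕ → X) (as : ℕ → ℕ → A) (est : ℕ → ℕ → (X → A → ℝ) → ℝ) (k h : ℕ) :
    X → A → ℝ :=
  qHatAux M φ lam β xs as est k (H + 1 - h)

/-- A realization, on a probability space `(Ω, μ)`, of `K` episodes of feature-based risk-averse
`Q`-learning. `history k h` is the information available in episode `k` when the state `x_h^k` has
been reached; `est h τ` is the estimator of the transition risk at stage `h` of episode `τ`
(constrained by `UsesAggregator` or `UsesUnbiasedEstimator` below). The initial states may be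
chosen in any way that depends on the past, and ties in the minimization are broken in any way. -/
structure QLearningRun {X A : Type*} {H d : ℕ} (M : RiskMDP X A H) (N : ℕ) [NeZero N]
    (φ : X → A → Fin d → ℝ) (K : ℕ) (lam β : ℝ)
    {Ω : Type*} [mΩ : MeasurableSpace Ω] (μ : Measure Ω) where
  history : ℕ → ℕ → MeasurableSpace Ω
  /-- `state h k` is `x_h^k`. -/
  state : ℕ → ℕ → Ω → X
  /-- `policy k ω h` is the decision rule of stage `h` in episode `k`. -/
  policy : ℕ → Ω → ℕ → X → A
  /-- `batch h k` is the batch `Y_h^k`, observed at stage `h - 1`. -/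
  batch : ℕ → ℕ → Ω → Fin N → X
  /-- `pick h k` is the random index of the batch element that becomes `x_h^k`. -/
  pick : ℕ → ℕ → Ω → Fin N
  est : ℕ → ℕ → Ω → (X → A → ℝ) → ℝ
  history_le : ∀ k h, history k h ≤ mΩ
  history_stage : ∀ k h, 1 ≤ k → k ≤ K → 1 ≤ h → h < H → history k h ≤ history k (h + 1)
  history_episode : ∀ k, 1 ≤ k → k < K → history k H ≤ history (k + 1) 1
  state_one_measurable : ∀ k, 1 ≤ k → k ≤ K → Measurable[history k 1, ⊤] (state 1 k)
  policy_measurable : ∀ k h, 1 ≤ k → k ≤ K → 1 ≤ h → h ≤ H → ∀ x,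
    Measurable[history k 1, ⊤] (fun ω => policy k ω h x)
  batch_measurable : ∀ k h, 1 ≤ k → k ≤ K → 1 ≤ h → h < H →
    Measurable[history k (h + 1), ⊤] (batch (h + 1) k)
  pick_measurable : ∀ k h, 1 ≤ k → k ≤ K → 1 ≤ h → h < H →
    Measurable[history k (h + 1), ⊤] (pick (h + 1) k)
  /-- Given the past, the batch consists of `N` independent draws from `P_h(x_h^k, a_h^k)`, and the
  index of the next state is uniform and independent of the batch. -/
  sampling : ∀ k h, 1 ≤ k → k ≤ K → 1 ≤ h → h < H → ∀ (y : Fin N → X) (j : Fin N),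
    μ[Set.indicator {ω | batch (h + 1) k ω = y ∧ pick (h + 1) k ω = j} (fun _ => (1 : ℝ))
        | history k h]
      =ᵐ[μ] fun ω =>
        batchProb (M.kernel h (state h k ω) (policy k ω h (state h k ω))) y * (1 / (N : ℝ))
  state_next : ∀ k h, 1 ≤ k → k ≤ K → 1 ≤ h → h < H → ∀ ω,
    state (h + 1) k ω = batch (h + 1) k ω (pick (h + 1) k ω)
  /-- The policy of episode `k` minimizes `Q_h^k(x, ·)`. -/
  greedy : ∀ k h, 1 ≤ k → k ≤ K → 1 ≤ h → h ≤ H → ∀ ω x a,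
    qHat M φ lam β (fun h τ => state h τ ω) (fun h τ => policy τ ω h (state h τ ω))
        (fun h τ => est h τ ω) k h x (policy k ω h x)
      ≤ qHat M φ lam β (fun h τ => state h τ ω) (fun h τ => policy τ ω h (state h τ ω))
        (fun h τ => est h τ ω) k h x a

namespace QLearningRun

variable {X A : Type*} {H d N : ℕ} [NeZero N] {M : RiskMDP X A H}
  {φ : X → A → Fin d → ℝ} {K : ℕ} {lam β : ℝ} {Ω : Type*} [MeasurableSpace Ω] {μ : Measure Ω}

/-- `a_h^k`. -/
def action (R : QLearningRun M N φ K lam β μ) (h k : ℕ) (ω : Ω) : A :=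
  R.policy k ω h (R.state h k ω)

/-- The basic method: the transition risk is estimated by the risk aggregator
`Ψ_h({min_a Q(Y_{h+1}^{τ,j}, a)}_j) = σ^b_h(x_h^τ, P^{(N)}, min_a Q(·, a))`, with the empirical
measure `P^{(N)}` of the batch `Y_{h+1}^τ`. -/
def UsesAggregator (R : QLearningRun M N φ K lam β μ) : Prop :=
  ∀ h τ, 1 ≤ τ → τ ≤ K → 1 ≤ h → h < H → ∀ ω (Q : X → A → ℝ),
    R.est h τ ω Q =
      M.baseRisk h (R.state h τ ω) (empirical (R.batch (h + 1) τ ω)) (fun y => ⨅ a, Q y a)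

/-- Economical estimators: random functionals that are determined by the end of the transition,
Lipschitz in `Q` with constant `L` for the maximum norm, zero at `Q = 0`, and conditionally
unbiased for the mini-batch transition risk of `min_a Q(·, a)`. -/
structure UsesUnbiasedEstimator [Fintype X] [Fintype A] (R : QLearningRun M N φ K lam β μ)
    (L : ℝ) : Prop where
  measurable : ∀ h τ, 1 ≤ τ → τ ≤ K → 1 ≤ h → h < H → ∀ Q : X → A → ℝ,
    Measurable[R.history τ (h + 1)] (fun ω => R.est h τ ω Q)
  lipschitz : ∀ h τ, 1 ≤ τ → τ ≤ K → 1 ≤ h → h < H → ∀ ω (Q Q' : X → A → ℝ),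
    |R.est h τ ω Q - R.est h τ ω Q'| ≤ L * ‖Q - Q'‖
  zero : ∀ h τ, 1 ≤ τ → τ ≤ K → 1 ≤ h → h < H → ∀ ω, R.est h τ ω 0 = 0
  unbiased : ∀ h τ, 1 ≤ τ → τ ≤ K → 1 ≤ h → h < H → ∀ Q : X → A → ℝ,
    μ[fun ω => R.est h τ ω Q | R.history τ h]
      =ᵐ[μ] fun ω => M.risk N h (R.state h τ ω) (R.action h τ ω) (fun y => ⨅ a, Q y a)

/-- `∑_{k=1}^K [V_1^{π_k}(x_1^k) - V_1^⋆(x_1^k)]`. -/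
def regret [Fintype X] (R : QLearningRun M N φ K lam β μ) (ω : Ω) : ℝ :=
  ∑ k ∈ Finset.Icc 1 K,
    (M.policyValue N (R.policy k ω) 1 (R.state 1 k ω) - M.optValue N 1 (R.state 1 k ω))

end QLearningRun

end Algorithm

end RiskQ

end

/-
With high probability, ridge regression recovers the exact cost-to-go of `min_a Q_{h+1}^k` up to
the bonus `β (φᵀ Λ⁻¹ φ)^{1/2}`: for a fixed target function this is the self-normalized martingale
bound, and since `Q_{h+1}^k` depends on the data, that bound is applied to a finite net of the
functions `max {wᵀφ - (φᵀ G φ)^{1/2}, 0}`. Hence `Q_h^k` is a lower bound for the optimal cost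
(optimism), and the gap between `V_h^{π_k}` and `min_a Q_h^k` is at most twice the bonus plus the
transition risk of the gap at stage `h + 1`.

A coherent risk that only sees the batch is at most the maximum over the batch, so for `V ≥ 0` the
transition risk of `V` is at most `N` times the expectation of `V` at the next state. Unrolling this
over the stages gives the factor `N^H`. Replacing expectations by visited states costs a martingale
term of order `√K`, and the elliptical potential lemma bounds the sum of the bonuses along the
visited states.
-/

namespace RiskQ

open Matrix MeasureTheory

section QuadraticForms

variable {ι : Type*} [Fintype ι] {P : Matrix ι ι ℝ}

/-- The quadratic form `vᵀ P v`, written `‖v‖_P ^ 2` in the literature on linear bandits. -/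
def quadForm (P : Matrix ι ι ℝ) (v : ι → ℝ) : ℝ := v ⬝ᵥ P *ᵥ v

theorem quadForm_nonneg (hP : P.PosSemidef) (v : ι → ℝ) : 0 ≤ quadForm P v := by
  simpa [quadForm] using hP.dotProduct_mulVec_nonneg v

theorem dotProduct_mulVec_comm (hP : P.IsHermitian) (v w : ι → ℝ) :
    v ⬝ᵥ P *ᵥ w = w ⬝ᵥ P *ᵥ v := by
  have hT : Pᵀ = P := by simpa using hP.eq
  rw [dotProduct_mulVec, ← mulVec_transpose, hT, dotProduct_comm]

theorem quadForm_add (hP : P.IsHermitian) (v w : ι → ℝ) :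
    quadForm P (v + w) = quadForm P v + 2 * (v ⬝ᵥ P *ᵥ w) + quadForm P w := by
  simp only [quadForm, mulVec_add, dotProduct_add, add_dotProduct]
  rw [dotProduct_mulVec_comm hP w v]
  ring

theorem quadForm_smul (P : Matrix ι ι ℝ) (t : ℝ) (v : ι → ℝ) :
    quadForm P (t • v) = t ^ 2 * quadForm P v := by
  simp only [quadForm, mulVec_smul, dotProduct_smul, smul_dotProduct, smul_eq_mul]
  ring

theorem dotProduct_mulVec_sq_le (hP : P.PosSemidef) (v w : ι → ℝ) :
    (v ⬝ᵥ P *ᵥ w) ^ 2 ≤ quadForm P v * quadForm P w := by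
  have hnonneg (t : ℝ) :
      0 ≤ quadForm P w * (t * t) + 2 * (v ⬝ᵥ P *ᵥ w) * t + quadForm P v := by
    have h := quadForm_nonneg hP (v + t • w)
    rw [quadForm_add hP.isHermitian, quadForm_smul, mulVec_smul, dotProduct_smul,
      smul_eq_mul] at h
    linarith
  have hdiscrim := discrim_le_zero hnonneg
  rw [discrim] at hdiscrim
  linarith

theorem abs_dotProduct_mulVec_le (hP : P.PosSemidef) (v w : ι → ℝ) :
    |v ⬝ᵥ P *ᵥ w| ≤ √(quadForm P v) * √(quadForm P w) := by
  rw [← Real.sqrt_mul (quadForm_nonneg hP v)]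
  exact Real.abs_le_sqrt (dotProduct_mulVec_sq_le hP v w)

theorem sqrt_quadForm_add_le (hP : P.PosSemidef) (v w : ι → ℝ) :
    √(quadForm P (v + w)) ≤ √(quadForm P v) + √(quadForm P w) := by
  refine Real.sqrt_le_iff.mpr ⟨by positivity, ?_⟩
  have hcross := (le_abs_self _).trans (abs_dotProduct_mulVec_le hP v w)
  rw [quadForm_add hP.isHermitian, add_sq, Real.sq_sqrt (quadForm_nonneg hP v),
    Real.sq_sqrt (quadForm_nonneg hP w)]
  linarith

theorem dotProduct_sq_le_mul (v w : ι → ℝ) : (v ⬝ᵥ w) ^ 2 ≤ (v ⬝ᵥ v) * (w ⬝ᵥ w) := by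
  classical
  simpa [quadForm] using dotProduct_mulVec_sq_le (PosSemidef.one (n := ι) (R := ℝ)) v w

variable [DecidableEq ι]

theorem mul_inv_of_posDef (hP : P.PosDef) : P * P⁻¹ = 1 :=
  mul_nonsing_inv _ ((isUnit_iff_isUnit_det _).mp hP.isUnit)

theorem abs_dotProduct_le_sqrt_quadForm_inv (hP : P.PosDef) (v w : ι → ℝ) :
    |v ⬝ᵥ w| ≤ √(quadForm P⁻¹ v) * √(quadForm P w) := by
  have h := abs_dotProduct_mulVec_le hP.inv.posSemidef v (P *ᵥ w)
  have hPinv : P⁻¹ * P = 1 := nonsing_inv_mul _ ((isUnit_iff_isUnit_det _).mp hP.isUnit)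
  have hform : quadForm P⁻¹ (P *ᵥ w) = quadForm P w := by
    rw [quadForm, mulVec_mulVec, hPinv, one_mulVec, dotProduct_comm, quadForm]
  rwa [mulVec_mulVec, hPinv, one_mulVec, hform] at h

-- The extremal test vector is `P⁻¹ v`.
theorem quadForm_inv_le_of_forall_sq_le (hP : P.PosDef) {v : ι → ℝ} {c : ℝ} (hc : 0 ≤ c)
    (h : ∀ w, (v ⬝ᵥ w) ^ 2 ≤ c * quadForm P w) : quadForm P⁻¹ v ≤ c := by
  have hform : quadForm P (P⁻¹ *ᵥ v) = quadForm P⁻¹ v := by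
    rw [quadForm, mulVec_mulVec, mul_inv_of_posDef hP, one_mulVec, dotProduct_comm, quadForm]
  have hsq := h (P⁻¹ *ᵥ v)
  rw [hform, ← quadForm, sq] at hsq
  rcases (quadForm_nonneg hP.inv.posSemidef v).eq_or_lt with hzero | hpos
  · rwa [← hzero]
  · exact le_of_mul_le_mul_right hsq hpos

-- Sherman–Morrison
theorem inv_add_vecMulVec (hP : P.PosDef) (f : ι → ℝ) :
    (P + vecMulVec f f)⁻¹ =
      P⁻¹ - (1 + quadForm P⁻¹ f)⁻¹ • vecMulVec (P⁻¹ *ᵥ f) (P⁻¹ *ᵥ f) := by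
  have hu := quadForm_nonneg hP.inv.posSemidef f
  have hsymm : (P⁻¹)ᵀ = P⁻¹ := by simpa using hP.inv.isHermitian.eq
  have hrow : vecMulVec f f * P⁻¹ = vecMulVec f (P⁻¹ *ᵥ f) := by
    rw [vecMulVec_mul, ← mulVec_transpose, hsymm]
  have hscale : (1 + quadForm P⁻¹ f)⁻¹ •
      (vecMulVec f (P⁻¹ *ᵥ f) + vecMulVec f (quadForm P⁻¹ f • P⁻¹ *ᵥ f)) =
        vecMulVec f (P⁻¹ *ᵥ f) := by
    nth_rewrite 1 [← one_smul ℝ (vecMulVec f (P⁻¹ *ᵥ f))]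
    rw [vecMulVec_smul, ← add_smul, inv_smul_smul₀ (by positivity)]
  refine inv_eq_right_inv ?_
  rw [mul_sub, add_mul, mul_inv_of_posDef hP, hrow, Matrix.mul_smul, add_mul, mul_vecMulVec,
    mulVec_mulVec, mul_inv_of_posDef hP, one_mulVec, vecMulVec_mul_vecMulVec, ← quadForm, hscale,
    add_sub_cancel_right]

theorem quadForm_inv_add_vecMulVec (hP : P.PosDef) (f S : ι → ℝ) (η : ℝ) :
    quadForm (P + vecMulVec f f)⁻¹ (S + η • f) =
      quadForm P⁻¹ S +
        (2 * η * (f ⬝ᵥ P⁻¹ *ᵥ S) + η ^ 2 * quadForm P⁻¹ f - (f ⬝ᵥ P⁻¹ *ᵥ S) ^ 2) /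
          (1 + quadForm P⁻¹ f) := by
  have hu := quadForm_nonneg hP.inv.posSemidef f
  have hcomm := dotProduct_mulVec_comm hP.inv.isHermitian
  have hform : f ⬝ᵥ P⁻¹ *ᵥ f = quadForm P⁻¹ f := rfl
  have hproj (v : ι → ℝ) : (P⁻¹ *ᵥ f) ⬝ᵥ v = f ⬝ᵥ P⁻¹ *ᵥ v := by
    rw [dotProduct_comm, hcomm]
  rw [quadForm, inv_add_vecMulVec hP, sub_mulVec, dotProduct_sub, ← quadForm,
    quadForm_add hP.inv.isHermitian, quadForm_smul, smul_mulVec, vecMulVec_mulVec]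
  simp only [mulVec_smul, dotProduct_smul, smul_eq_mul, hproj, mulVec_add,
    dotProduct_add, add_dotProduct, smul_dotProduct, op_smul_eq_smul, hcomm S f, hform]
  field_simp
  ring

theorem det_add_vecMulVec (hP : P.PosDef) (f : ι → ℝ) :
    (P + vecMulVec f f).det = P.det * (1 + quadForm P⁻¹ f) := by
  rw [vecMulVec_eq Unit, det_add_replicateCol_mul_replicateRow
    ((isUnit_iff_isUnit_det _).mp hP.isUnit), det_unique (n := Unit), Matrix.mul_assoc,
    ← replicateCol_mulVec]
  simp [Matrix.mul_apply, quadForm, dotProduct]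

theorem eigenvalues_le_of_forall_quadForm_le (hP : P.IsHermitian) {c : ℝ}
    (h : ∀ v, quadForm P v ≤ c * (v ⬝ᵥ v)) (i : ι) : hP.eigenvalues i ≤ c := by
  have hunit : hP.eigenvectorBasis i ⬝ᵥ hP.eigenvectorBasis i = (1 : ℝ) := by
    have hnorm := EuclideanSpace.norm_sq_eq (hP.eigenvectorBasis i)
    simp only [hP.eigenvectorBasis.norm_eq_one, Real.norm_eq_abs, sq_abs, one_pow] at hnorm
    simp only [dotProduct, ← sq, ← hnorm]
  have heigen : hP.eigenvalues i = quadForm P (hP.eigenvectorBasis i) := by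
    simp [hP.eigenvalues_eq i, quadForm]
  simpa [heigen, hunit] using h (hP.eigenvectorBasis i)

theorem det_le_pow_of_forall_quadForm_le (hP : P.PosSemidef) {c : ℝ}
    (h : ∀ v, quadForm P v ≤ c * (v ⬝ᵥ v)) : P.det ≤ c ^ Fintype.card ι := by
  rw [hP.isHermitian.det_eq_prod_eigenvalues, Fintype.card, ← Finset.prod_const]
  exact Finset.prod_le_prod (fun i _ => hP.eigenvalues_nonneg i)
    fun i _ => eigenvalues_le_of_forall_quadForm_le hP.isHermitian h i

end QuadraticForms

section Ridge

variable {ι : Type*} {lam : ℝ} {f : ℕ → ι → ℝ} {k K : ℕ}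

/-- The sum of `f 1, …, f (k - 1)` weighted by `η`, the right-hand side of the normal equations of
ridge regression with responses `η`. -/
def weightedSum (η : ℕ → ℝ) (f : ℕ → ι → ℝ) (k : ℕ) : ι → ℝ :=
  ∑ τ ∈ Finset.Ico 1 k, η τ • f τ

theorem weightedSum_dotProduct [Fintype ι] (η : ℕ → ℝ) (f : ℕ → ι → ℝ) (k : ℕ) (v : ι → ℝ) :
    weightedSum η f k ⬝ᵥ v = ∑ τ ∈ Finset.Ico 1 k, η τ * (f τ ⬝ᵥ v) := by
  simp [weightedSum, sum_dotProduct]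

variable [DecidableEq ι]

/-- The regularized Gram matrix of `f 1, …, f (k - 1)`. -/
def ridge (lam : ℝ) (f : ℕ → ι → ℝ) (k : ℕ) : Matrix ι ι ℝ :=
  ∑ τ ∈ Finset.Ico 1 k, vecMulVec (f τ) (f τ) + lam • 1

theorem ridge_one (lam : ℝ) (f : ℕ → ι → ℝ) : ridge lam f 1 = lam • 1 := by
  simp [ridge]

theorem ridge_succ (lam : ℝ) (f : ℕ → ι → ℝ) (hk : 1 ≤ k) :
    ridge lam f (k + 1) = ridge lam f k + vecMulVec (f k) (f k) := by
  rw [ridge, ridge, Finset.sum_Ico_succ_top hk]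
  abel

theorem posDef_ridge [Finite ι] (hlam : 0 < lam) (f : ℕ → ι → ℝ) (k : ℕ) :
    (ridge lam f k).PosDef :=
  PosDef.posSemidef_add
    (posSemidef_sum _ fun τ _ => by simpa using posSemidef_vecMulVec_self_star (f τ))
    (PosDef.one.smul hlam)

variable [Fintype ι]

/-- Twice the information gain of Bayesian linear regression on `f 1, …, f (k - 1)`. -/
noncomputable def infoGain (lam : ℝ) (f : ℕ → ι → ℝ) (k : ℕ) : ℝ :=
  Real.log ((ridge lam f k).det / lam ^ Fintype.card ι)

theorem posSemidef_ridge_inv (hlam : 0 < lam) (f : ℕ → ι → ℝ) (k : ℕ) :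
    (ridge lam f k)⁻¹.PosSemidef := (posDef_ridge hlam f k).inv.posSemidef

theorem ridge_mulVec (lam : ℝ) (f : ℕ → ι → ℝ) (k : ℕ) (v : ι → ℝ) :
    ridge lam f k *ᵥ v = weightedSum (fun τ => f τ ⬝ᵥ v) f k + lam • v := by
  rw [ridge, add_mulVec, Matrix.sum_mulVec, smul_mulVec, one_mulVec]
  simp [weightedSum, vecMulVec_mulVec, op_smul_eq_smul]

theorem quadForm_ridge (lam : ℝ) (f : ℕ → ι → ℝ) (k : ℕ) (v : ι → ℝ) :
    quadForm (ridge lam f k) v = ∑ τ ∈ Finset.Ico 1 k, (f τ ⬝ᵥ v) ^ 2 + lam * (v ⬝ᵥ v) := by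
  rw [quadForm, ridge_mulVec, dotProduct_add, dotProduct_comm, weightedSum_dotProduct,
    dotProduct_smul, smul_eq_mul]
  simp only [sq]

theorem quadForm_ridge_inv_le (hlam : 0 < lam) (f : ℕ → ι → ℝ) (k : ℕ) (v : ι → ℝ) :
    quadForm (ridge lam f k)⁻¹ v ≤ v ⬝ᵥ v / lam := by
  have hv : 0 ≤ v ⬝ᵥ v := by simpa using dotProduct_star_self_nonneg v
  refine quadForm_inv_le_of_forall_sq_le (posDef_ridge hlam f k) (by positivity) fun w => ?_
  calc (v ⬝ᵥ w) ^ 2 ≤ v ⬝ᵥ v * (w ⬝ᵥ w) := dotProduct_sq_le_mul v w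
    _ = v ⬝ᵥ v / lam * (lam * (w ⬝ᵥ w)) := by field_simp
    _ ≤ v ⬝ᵥ v / lam * quadForm (ridge lam f k) w := by
      rw [quadForm_ridge]
      gcongr
      exact le_add_of_nonneg_left (by positivity)

theorem quadForm_ridge_inv_weightedSum_le (hlam : 0 < lam) (f : ℕ → ι → ℝ) (k : ℕ)
    (η : ℕ → ℝ) :
    quadForm (ridge lam f k)⁻¹ (weightedSum η f k) ≤ ∑ τ ∈ Finset.Ico 1 k, η τ ^ 2 := by
  refine quadForm_inv_le_of_forall_sq_le (posDef_ridge hlam f k) (by positivity) fun w => ?_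
  have hw : 0 ≤ w ⬝ᵥ w := by simpa using dotProduct_star_self_nonneg w
  rw [weightedSum_dotProduct, quadForm_ridge]
  refine (Finset.sum_mul_sq_le_sq_mul_sq _ _ _).trans ?_
  gcongr
  exact le_add_of_nonneg_right (by positivity)

theorem quadForm_ridge_le (hf : ∀ τ, f τ ⬝ᵥ f τ ≤ 1) (hk : k ≤ K + 1) (v : ι → ℝ) :
    quadForm (ridge lam f k) v ≤ (lam + K) * (v ⬝ᵥ v) := by
  have hv : 0 ≤ v ⬝ᵥ v := by simpa using dotProduct_star_self_nonneg v
  have hterm (τ : ℕ) : (f τ ⬝ᵥ v) ^ 2 ≤ v ⬝ᵥ v :=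
    (dotProduct_sq_le_mul _ _).trans (mul_le_of_le_one_left hv (hf τ))
  have hcard : (((Finset.Ico 1 k).card : ℕ) : ℝ) ≤ K := by
    rw [Nat.card_Ico]
    exact_mod_cast (by lia : k - 1 ≤ K)
  calc quadForm (ridge lam f k) v
      = ∑ τ ∈ Finset.Ico 1 k, (f τ ⬝ᵥ v) ^ 2 + lam * (v ⬝ᵥ v) := quadForm_ridge lam f k v
    _ ≤ (Finset.Ico 1 k).card * (v ⬝ᵥ v) + lam * (v ⬝ᵥ v) := by
      gcongr
      rw [← nsmul_eq_mul]
      exact Finset.sum_le_card_nsmul _ _ _ fun τ _ => hterm τ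
    _ ≤ K * (v ⬝ᵥ v) + lam * (v ⬝ᵥ v) := by gcongr
    _ = (lam + K) * (v ⬝ᵥ v) := by ring

theorem det_ridge_succ (hlam : 0 < lam) (f : ℕ → ι → ℝ) (hk : 1 ≤ k) :
    (ridge lam f (k + 1)).det =
      (ridge lam f k).det * (1 + quadForm (ridge lam f k)⁻¹ (f k)) := by
  rw [ridge_succ lam f hk, det_add_vecMulVec (posDef_ridge hlam f k)]

theorem infoGain_one (hlam : 0 < lam) (f : ℕ → ι → ℝ) : infoGain lam f 1 = 0 := by
  simp [infoGain, ridge_one, div_self (pow_pos hlam _).ne']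

theorem infoGain_succ (hlam : 0 < lam) (f : ℕ → ι → ℝ) (hk : 1 ≤ k) :
    infoGain lam f (k + 1) =
      infoGain lam f k + Real.log (1 + quadForm (ridge lam f k)⁻¹ (f k)) := by
  have hu := quadForm_nonneg (posSemidef_ridge_inv hlam f k) (f k)
  have hdet := (posDef_ridge hlam f k).det_pos
  rw [infoGain, infoGain, det_ridge_succ hlam f hk, mul_div_right_comm,
    Real.log_mul (by positivity) (by positivity)]

theorem infoGain_le (hlam : 0 < lam) (hf : ∀ τ, f τ ⬝ᵥ f τ ≤ 1) (hk : k ≤ K + 1) :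
    infoGain lam f k ≤ Fintype.card ι * Real.log (1 + K / lam) := by
  have hP := posDef_ridge hlam f k
  have hdet : (ridge lam f k).det / lam ^ Fintype.card ι ≤ (1 + K / lam) ^ Fintype.card ι := by
    rw [one_add_div hlam.ne', div_pow]
    gcongr
    exact det_le_pow_of_forall_quadForm_le hP.posSemidef (quadForm_ridge_le hf hk)
  rw [infoGain, ← Real.log_pow]
  exact Real.log_le_log (div_pos hP.det_pos (by positivity)) hdet

theorem sum_log_one_add_quadForm_ridge_inv (hlam : 0 < lam) (f : ℕ → ι → ℝ) (hk : 1 ≤ k) :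
    ∑ τ ∈ Finset.Ico 1 k, Real.log (1 + quadForm (ridge lam f τ)⁻¹ (f τ)) = infoGain lam f k := by
  induction k, hk using Nat.le_induction with
  | base => simp [infoGain_one hlam]
  | succ k hk ih => rw [Finset.sum_Ico_succ_top hk, ih, infoGain_succ hlam f hk]

theorem mul_log_two_le_log_one_add {x : ℝ} (h0 : 0 ≤ x) (h1 : x ≤ 1) :
    x * Real.log 2 ≤ Real.log (1 + x) := by
  have h := strictConcaveOn_log_Ioi.concaveOn.2 (show (1 : ℝ) ∈ Set.Ioi 0 by simp)
    (show (2 : ℝ) ∈ Set.Ioi 0 by simp) (sub_nonneg.mpr h1) h0 (sub_add_cancel 1 x)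
  simp only [smul_eq_mul, Real.log_one, mul_zero, zero_add] at h
  exact h.trans_eq (by ring_nf)

theorem sq_min_one_sqrt_mul_log_two_le {u : ℝ} (hu : 0 ≤ u) :
    min 1 (√u) ^ 2 * Real.log 2 ≤ Real.log (1 + u) := by
  have hnonneg : 0 ≤ min 1 (√u) := by positivity
  have hle_one : min 1 (√u) ^ 2 ≤ 1 := pow_le_one₀ hnonneg (min_le_left _ _)
  have hle : min 1 (√u) ^ 2 ≤ u :=
    (pow_le_pow_left₀ hnonneg (min_le_right _ _) 2).trans_eq (Real.sq_sqrt hu)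
  exact (mul_log_two_le_log_one_add (by positivity) hle_one).trans
    (Real.log_le_log (by positivity) (by gcongr))

-- The elliptical potential lemma, after Cauchy–Schwarz.
theorem sum_min_one_sqrt_quadForm_ridge_inv_le (hlam : 0 < lam) (hf : ∀ τ, f τ ⬝ᵥ f τ ≤ 1)
    (K : ℕ) :
    ∑ k ∈ Finset.Icc 1 K, min 1 (√(quadForm (ridge lam f k)⁻¹ (f k))) ≤
      √(K * (Fintype.card ι * Real.log (1 + K / lam) / Real.log 2)) := by
  rw [← Finset.Ico_add_one_right_eq_Icc]
  refine Real.le_sqrt_of_sq_le (sq_sum_le_card_mul_sum_sq.trans ?_)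
  rw [Nat.card_Ico, Nat.add_sub_cancel]
  gcongr
  rw [le_div_iff₀ (Real.log_pos one_lt_two), Finset.sum_mul]
  calc _ ≤ ∑ k ∈ Finset.Ico 1 (K + 1), Real.log (1 + quadForm (ridge lam f k)⁻¹ (f k)) :=
        Finset.sum_le_sum fun k _ =>
          sq_min_one_sqrt_mul_log_two_le (quadForm_nonneg (posSemidef_ridge_inv hlam f k) (f k))
    _ = infoGain lam f (K + 1) := sum_log_one_add_quadForm_ridge_inv hlam f (by lia)
    _ ≤ _ := infoGain_le hlam hf le_rfl

end Ridge

section MatrixMeasurability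

variable {Ω ι : Type*} {m : MeasurableSpace Ω} {f : ℕ → Ω → ι → ℝ} {k : ℕ}

theorem measurable_weightedSum {η : ℕ → Ω → ℝ}
    (hη : ∀ τ, 1 ≤ τ → τ < k → Measurable (η τ)) (hf : ∀ τ, 1 ≤ τ → τ < k → Measurable (f τ)) :
    Measurable fun ω => weightedSum (fun τ => η τ ω) (fun τ => f τ ω) k := by
  refine Finset.measurable_fun_sum _ fun τ hτ => measurable_pi_lambda _ fun i => ?_
  rw [Finset.mem_Ico] at hτ
  exact (hη τ hτ.1 hτ.2).mul (hf τ hτ.1 hτ.2).eval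

theorem measurable_ridge_apply [DecidableEq ι] (lam : ℝ)
    (hf : ∀ τ, 1 ≤ τ → τ < k → Measurable (f τ)) (i j : ι) :
    Measurable fun ω => ridge lam (fun τ => f τ ω) k i j := by
  simp only [ridge, Matrix.add_apply, Matrix.sum_apply, vecMulVec_apply]
  refine (Finset.measurable_fun_sum _ fun τ hτ => ?_).add_const _
  rw [Finset.mem_Ico] at hτ
  exact (hf τ hτ.1 hτ.2).eval.mul (hf τ hτ.1 hτ.2).eval

variable [Fintype ι]

theorem measurable_dotProduct {v w : Ω → ι → ℝ} (hv : Measurable v) (hw : Measurable w) :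
    Measurable fun ω => v ω ⬝ᵥ w ω :=
  Finset.measurable_fun_sum _ fun i _ => (hv.eval (a := i)).mul (hw.eval (a := i))

theorem measurable_mulVec {A : Ω → Matrix ι ι ℝ} {v : Ω → ι → ℝ}
    (hA : ∀ i j, Measurable fun ω => A ω i j) (hv : Measurable v) :
    Measurable fun ω => A ω *ᵥ v ω :=
  measurable_pi_lambda _ fun i => measurable_dotProduct (measurable_pi_lambda _ (hA i)) hv

variable [DecidableEq ι]

theorem measurable_det {A : Ω → Matrix ι ι ℝ} (hA : ∀ i j, Measurable fun ω => A ω i j) :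
    Measurable fun ω => (A ω).det := by
  simp only [det_apply]
  exact Finset.measurable_fun_sum _ fun σ _ =>
    (Finset.measurable_fun_prod _ fun i _ => hA _ _).const_smul _

theorem measurable_inv_apply {A : Ω → Matrix ι ι ℝ} (hA : ∀ i j, Measurable fun ω => A ω i j)
    (i j : ι) : Measurable fun ω => (A ω)⁻¹ i j := by
  simp only [inv_def, Matrix.smul_apply, smul_eq_mul, Ring.inverse_eq_inv', adjugate_apply]
  refine (measurable_det hA).inv.mul (measurable_det fun a b => ?_)
  by_cases h : a = j
  · simp [h]
  · simpa [updateRow_ne h] using hA a b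

theorem measurable_dotProduct_ridge_inv_mulVec (lam : ℝ) {v w : Ω → ι → ℝ}
    (hf : ∀ τ, 1 ≤ τ → τ < k → Measurable (f τ)) (hv : Measurable v) (hw : Measurable w) :
    Measurable fun ω => v ω ⬝ᵥ (ridge lam (fun τ => f τ ω) k)⁻¹ *ᵥ w ω :=
  measurable_dotProduct hv
    (measurable_mulVec (measurable_inv_apply (measurable_ridge_apply lam hf)) hw)

theorem measurable_infoGain (lam : ℝ) (hf : ∀ τ, 1 ≤ τ → τ < k → Measurable (f τ)) :
    Measurable fun ω => infoGain lam (fun τ => f τ ω) k :=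
  Real.measurable_log.comp ((measurable_det (measurable_ridge_apply lam hf)).div_const _)

end MatrixMeasurability

section SelfNormalizedIncrement

variable {s u η : ℝ}

/-- The increment of `(Sᵀ Λ⁻¹ S - log det Λ) / 2` when an observation with feature `φ` and noise `η`
is added, where `s = φᵀ Λ⁻¹ S` and `u = φᵀ Λ⁻¹ φ`. -/
noncomputable def normIncr (s u η : ℝ) : ℝ :=
  (2 * η * s + η ^ 2 * u - s ^ 2) / (2 * (1 + u)) - Real.log (1 + u) / 2

/-- The slope in `η` of the chord of `exp (normIncr s u η)` over `[-1, 1]`. -/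
noncomputable def normSlope (s u : ℝ) : ℝ :=
  (Real.exp (normIncr s u 1) - Real.exp (normIncr s u (-1))) / 2

theorem exp_normIncr_average_le_one (hu : 0 ≤ u) :
    (Real.exp (normIncr s u 1) + Real.exp (normIncr s u (-1))) / 2 ≤ 1 := by
  set t := s / (1 + u) with ht
  set b := (u - s ^ 2) / (2 * (1 + u)) - Real.log (1 + u) / 2 with hb
  have hplus : normIncr s u 1 = b + t := by rw [normIncr, ht, hb]; field_simp; ring
  have hminus : normIncr s u (-1) = b + -t := by rw [normIncr, ht, hb]; field_simp; ring
  have hexponent : b + t ^ 2 / 2 ≤ 0 := by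
    have hlog := Real.one_sub_inv_le_log_of_pos (show 0 < 1 + u by positivity)
    have hrest : 0 ≤ s ^ 2 * u / (2 * (1 + u) ^ 2) := by positivity
    have hsplit : b + t ^ 2 / 2 =
        (1 - (1 + u)⁻¹ - Real.log (1 + u)) / 2 - s ^ 2 * u / (2 * (1 + u) ^ 2) := by
      rw [ht, hb]; field_simp; ring
    linarith
  calc (Real.exp (normIncr s u 1) + Real.exp (normIncr s u (-1))) / 2
      = Real.exp b * Real.cosh t := by
        rw [hplus, hminus, Real.exp_add, Real.exp_add, Real.cosh_eq]; ring
    _ ≤ Real.exp b * Real.exp (t ^ 2 / 2) := by gcongr; exact Real.cosh_le_exp_half_sq t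
    _ = Real.exp (b + t ^ 2 / 2) := (Real.exp_add _ _).symm
    _ ≤ 1 := Real.exp_le_one_iff.mpr hexponent

theorem abs_normSlope_le_one (hu : 0 ≤ u) : |normSlope s u| ≤ 1 := by
  have haverage := exp_normIncr_average_le_one (s := s) hu
  have hplus := Real.exp_pos (normIncr s u 1)
  have hminus := Real.exp_pos (normIncr s u (-1))
  rw [normSlope, abs_le]
  constructor <;> linarith

theorem normIncr_le_chord (hu : 0 ≤ u) (hη : |η| ≤ 1) :
    normIncr s u η ≤ (1 + η) / 2 * normIncr s u 1 + (1 - η) / 2 * normIncr s u (-1) := by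
  have hgap : (1 + η) / 2 * normIncr s u 1 + (1 - η) / 2 * normIncr s u (-1) - normIncr s u η =
      (1 - η ^ 2) * u / (2 * (1 + u)) := by
    simp only [normIncr]; field_simp; ring
  have hη' : 0 ≤ 1 - η ^ 2 := sub_nonneg.mpr ((sq_le_one_iff_abs_le_one η).mpr hη)
  have hgap_nonneg : 0 ≤ (1 - η ^ 2) * u / (2 * (1 + u)) := by positivity
  linarith

theorem exp_normIncr_le (hu : 0 ≤ u) (hη : |η| ≤ 1) :
    Real.exp (normIncr s u η) ≤ 1 + η * normSlope s u := by
  obtain ⟨hη_ge, hη_le⟩ := abs_le.mp hη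
  have hconvex := convexOn_exp.2 (Set.mem_univ (normIncr s u 1)) (Set.mem_univ (normIncr s u (-1)))
    (show 0 ≤ (1 + η) / 2 by linarith) (show 0 ≤ (1 - η) / 2 by linarith) (by ring)
  simp only [smul_eq_mul] at hconvex
  have hchord := Real.exp_le_exp.mpr (normIncr_le_chord (s := s) hu hη)
  have haverage := exp_normIncr_average_le_one (s := s) hu
  rw [normSlope]
  linarith

theorem measurable_normSlope {Ω : Type*} {m : MeasurableSpace Ω} {s u : Ω → ℝ}
    (hs : Measurable s) (hu : Measurable u) : Measurable fun ω => normSlope (s ω) (u ω) := by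
  unfold normSlope normIncr
  fun_prop

end SelfNormalizedIncrement

section SelfNormalizedProcess

variable {ι : Type*} [Fintype ι] [DecidableEq ι] {lam : ℝ} {k : ℕ}

/-- The self-normalized exponential process `exp ((‖S_k‖²_{Λ_k⁻¹} - log (det Λ_k / lam ^ d)) / 2)`,
a supermartingale when `η` is a sequence of martingale differences with values in `[-1, 1]`. -/
noncomputable def selfNormExp (lam : ℝ) (f : ℕ → ι → ℝ) (η : ℕ → ℝ) (k : ℕ) : ℝ :=
  Real.exp (quadForm (ridge lam f k)⁻¹ (weightedSum η f k) / 2 - infoGain lam f k / 2)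

/-- The coefficient of the noise `η k` in a linear upper bound of the increment of `selfNormExp`
at time `k`. -/
noncomputable def selfNormSlope (lam : ℝ) (f : ℕ → ι → ℝ) (η : ℕ → ℝ) (k : ℕ) : ℝ :=
  selfNormExp lam f η k * normSlope (f k ⬝ᵥ (ridge lam f k)⁻¹ *ᵥ weightedSum η f k)
    (quadForm (ridge lam f k)⁻¹ (f k))

theorem selfNormExp_pos (lam : ℝ) (f : ℕ → ι → ℝ) (η : ℕ → ℝ) (k : ℕ) : 0 < selfNormExp lam f η k :=
  Real.exp_pos _

theorem selfNormExp_one (hlam : 0 < lam) (f : ℕ → ι → ℝ) (η : ℕ → ℝ) :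
    selfNormExp lam f η 1 = 1 := by
  simp [selfNormExp, infoGain_one hlam, weightedSum, quadForm]

theorem selfNormExp_succ (hlam : 0 < lam) (f : ℕ → ι → ℝ) (η : ℕ → ℝ) (hk : 1 ≤ k) :
    selfNormExp lam f η (k + 1) = selfNormExp lam f η k *
      Real.exp (normIncr (f k ⬝ᵥ (ridge lam f k)⁻¹ *ᵥ weightedSum η f k)
        (quadForm (ridge lam f k)⁻¹ (f k)) (η k)) := by
  have hu := quadForm_nonneg (posSemidef_ridge_inv hlam f k) (f k)
  have hsum : weightedSum η f (k + 1) = weightedSum η f k + η k • f k :=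
    Finset.sum_Ico_succ_top hk _
  rw [selfNormExp, selfNormExp, ← Real.exp_add, Real.exp_eq_exp, infoGain_succ hlam f hk, hsum,
    ridge_succ lam f hk, quadForm_inv_add_vecMulVec (posDef_ridge hlam f k), normIncr]
  field_simp
  ring

variable {f : ℕ → ι → ℝ} {η : ℕ → ℝ}

theorem selfNormExp_succ_le (hlam : 0 < lam) (hk : 1 ≤ k) (hη : |η k| ≤ 1) :
    selfNormExp lam f η (k + 1) ≤ selfNormExp lam f η k + selfNormSlope lam f η k * η k := by
  have hu := quadForm_nonneg (posSemidef_ridge_inv hlam f k) (f k)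
  rw [selfNormExp_succ hlam f η hk]
  refine (mul_le_mul_of_nonneg_left (exp_normIncr_le hu hη)
    (selfNormExp_pos lam f η k).le).trans_eq ?_
  rw [selfNormSlope]
  ring

theorem abs_selfNormSlope_le (hlam : 0 < lam) :
    |selfNormSlope lam f η k| ≤ selfNormExp lam f η k := by
  have hu := quadForm_nonneg (posSemidef_ridge_inv hlam f k) (f k)
  rw [selfNormSlope, abs_mul, abs_of_pos (selfNormExp_pos lam f η k)]
  exact mul_le_of_le_one_right (selfNormExp_pos lam f η k).le (abs_normSlope_le_one hu)

theorem selfNormExp_le_two_pow (hlam : 0 < lam) (hk : 1 ≤ k)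
    (hη : ∀ τ, 1 ≤ τ → τ < k → |η τ| ≤ 1) : selfNormExp lam f η k ≤ 2 ^ k := by
  induction k, hk using Nat.le_induction with
  | base => simp [selfNormExp_one hlam]
  | succ k hk ih =>
    have hηk := hη k hk k.lt_succ_self
    have hslope : selfNormSlope lam f η k * η k ≤ selfNormExp lam f η k := by
      refine (le_abs_self _).trans ?_
      rw [abs_mul]
      exact (mul_le_of_le_one_right (abs_nonneg _) hηk).trans (abs_selfNormSlope_le hlam)
    have hle := selfNormExp_succ_le (f := f) hlam hk hηk
    have hprev := ih fun τ h1 h2 => hη τ h1 (by lia)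
    rw [pow_succ]
    linarith

end SelfNormalizedProcess

section MartingaleDifferences

variable {Ω : Type*} {mΩ : MeasurableSpace Ω} {μ : Measure Ω} {m : ℕ → MeasurableSpace Ω}
  {η : ℕ → Ω → ℝ} {n : ℕ} {c : ℝ}

/-- `η 1, …, η (n - 1)` are martingale differences with values in `[-c, c]` for the `σ`-algebras
`m 1 ≤ ⋯ ≤ m n`, where `η τ` is revealed at time `τ + 1`. -/
structure IsBoundedMartingaleDiff (m : ℕ → MeasurableSpace Ω) (η : ℕ → Ω → ℝ) (n : ℕ) (c : ℝ)
    (μ : Measure Ω) : Prop where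
  le : ∀ τ, m τ ≤ mΩ
  mono : ∀ τ, 1 ≤ τ → τ < n → m τ ≤ m (τ + 1)
  measurable : ∀ τ, 1 ≤ τ → τ < n → Measurable[m (τ + 1)] (η τ)
  abs_le : ∀ τ, 1 ≤ τ → τ < n → ∀ ω, |η τ ω| ≤ c
  condExp_eq_zero : ∀ τ, 1 ≤ τ → τ < n → μ[η τ | m τ] =ᵐ[μ] 0

namespace IsBoundedMartingaleDiff

theorem le_of_le (hη : IsBoundedMartingaleDiff m η n c μ) {τ k : ℕ} (hτ : 1 ≤ τ) (hτk : τ ≤ k)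
    (hk : k ≤ n) : m τ ≤ m k := by
  induction k, hτk using Nat.le_induction with
  | base => exact le_rfl
  | succ k hτk ih => exact (ih (by lia)).trans (hη.mono k (by lia) (by lia))

theorem measurable_of_lt (hη : IsBoundedMartingaleDiff m η n c μ) {τ k : ℕ} (hτ : 1 ≤ τ)
    (hτk : τ < k) (hk : k ≤ n) : Measurable[m k] (η τ) :=
  (hη.measurable τ hτ (by lia)).mono (hη.le_of_le (by lia) hτk hk) le_rfl

theorem div_const (hη : IsBoundedMartingaleDiff m η n c μ) (hc : 0 < c) :
    IsBoundedMartingaleDiff m (fun τ ω => η τ ω / c) n 1 μ where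
  le := hη.le
  mono := hη.mono
  measurable τ h1 h2 := (hη.measurable τ h1 h2).div_const c
  abs_le τ h1 h2 ω := by
    rw [abs_div, abs_of_pos hc]
    exact div_le_one_of_le₀ (hη.abs_le τ h1 h2 ω) hc.le
  condExp_eq_zero τ h1 h2 := by
    have hsmul : (fun ω => η τ ω / c) = c⁻¹ • η τ := by ext ω; simp [div_eq_inv_mul]
    rw [hsmul]
    filter_upwards [condExp_smul (μ := μ) c⁻¹ (η τ) (m τ), hη.condExp_eq_zero τ h1 h2]
      with ω h hzero
    simp [h, hzero]

end IsBoundedMartingaleDiff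

theorem integral_mul_eq_zero_of_condExp_eq_zero [IsFiniteMeasure μ] {m : MeasurableSpace Ω}
    (hm : m ≤ mΩ) {g η : Ω → ℝ} (hg : Measurable[m] g) (hη : Integrable η μ)
    (hgη : Integrable (g * η) μ) (hz : μ[η | m] =ᵐ[μ] 0) : ∫ ω, g ω * η ω ∂μ = 0 := by
  have hcond : μ[g * η | m] =ᵐ[μ] 0 := by
    filter_upwards [condExp_mul_of_stronglyMeasurable_left hg.stronglyMeasurable hgη hη, hz]
      with ω hmul hzero
    simp [hmul, hzero]
  calc ∫ ω, g ω * η ω ∂μ = ∫ ω, (μ[g * η | m]) ω ∂μ := (integral_condExp hm).symm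
    _ = 0 := by rw [integral_congr_ae hcond]; simp

end MartingaleDifferences

section SelfNormalizedBound

variable {Ω ι : Type*} {mΩ : MeasurableSpace Ω} {μ : Measure Ω}
  [Fintype ι] [DecidableEq ι] {m : ℕ → MeasurableSpace Ω} {η : ℕ → Ω → ℝ} {n k : ℕ} {c : ℝ}
  {f : ℕ → Ω → ι → ℝ} {lam δ : ℝ}

theorem measurable_selfNormExp (hη : IsBoundedMartingaleDiff m η n c μ)
    (hf : ∀ τ, 1 ≤ τ → τ < n → Measurable[m τ] (f τ)) (lam : ℝ) (hk : k ≤ n) :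
    Measurable[m k] fun ω => selfNormExp lam (fun τ => f τ ω) (fun τ => η τ ω) k := by
  have hf' (τ : ℕ) (h1 : 1 ≤ τ) (h2 : τ < k) : Measurable[m k] (f τ) :=
    (hf τ h1 (by lia)).mono (hη.le_of_le h1 h2.le hk) le_rfl
  have hS : Measurable[m k] fun ω => weightedSum (fun τ => η τ ω) (fun τ => f τ ω) k :=
    measurable_weightedSum (fun τ h1 h2 => hη.measurable_of_lt h1 h2 hk) hf'
  exact Real.measurable_exp.comp
    (((measurable_dotProduct_ridge_inv_mulVec lam hf' hS hS).div_const 2).sub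
      ((measurable_infoGain lam hf').div_const 2))

theorem measurable_selfNormSlope (hη : IsBoundedMartingaleDiff m η n c μ)
    (hf : ∀ τ, 1 ≤ τ → τ < n → Measurable[m τ] (f τ)) (lam : ℝ) (h1k : 1 ≤ k) (hk : k < n) :
    Measurable[m k] fun ω => selfNormSlope lam (fun τ => f τ ω) (fun τ => η τ ω) k := by
  have hf' (τ : ℕ) (h1 : 1 ≤ τ) (h2 : τ < k) : Measurable[m k] (f τ) :=
    (hf τ h1 (by lia)).mono (hη.le_of_le h1 h2.le hk.le) le_rfl
  have hS : Measurable[m k] fun ω => weightedSum (fun τ => η τ ω) (fun τ => f τ ω) k :=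
    measurable_weightedSum (fun τ h1 h2 => hη.measurable_of_lt h1 h2 hk.le) hf'
  have hs := measurable_dotProduct_ridge_inv_mulVec lam hf' (hf k h1k hk) hS
  have hu := measurable_dotProduct_ridge_inv_mulVec lam hf' (hf k h1k hk) (hf k h1k hk)
  exact (measurable_selfNormExp hη hf lam hk.le).mul (measurable_normSlope hs hu)

variable [IsProbabilityMeasure μ]

theorem integrable_selfNormExp (hη : IsBoundedMartingaleDiff m η n 1 μ)
    (hf : ∀ τ, 1 ≤ τ → τ < n → Measurable[m τ] (f τ)) (hlam : 0 < lam) (h1k : 1 ≤ k)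
    (hk : k ≤ n) :
    Integrable (fun ω => selfNormExp lam (fun τ => f τ ω) (fun τ => η τ ω) k) μ := by
  have hmeas := (measurable_selfNormExp hη hf lam hk).mono (hη.le k) le_rfl
  refine .of_bound hmeas.aestronglyMeasurable (2 ^ k) (.of_forall fun ω => ?_)
  rw [Real.norm_of_nonneg (selfNormExp_pos _ _ _ _).le]
  exact selfNormExp_le_two_pow hlam h1k fun τ h1 h2 => hη.abs_le τ h1 (by lia) ω

theorem integral_selfNormExp_le_one (hη : IsBoundedMartingaleDiff m η n 1 μ)
    (hf : ∀ τ, 1 ≤ τ → τ < n → Measurable[m τ] (f τ)) (hlam : 0 < lam) (h1k : 1 ≤ k)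
    (hk : k ≤ n) :
    ∫ ω, selfNormExp lam (fun τ => f τ ω) (fun τ => η τ ω) k ∂μ ≤ 1 := by
  induction k, h1k using Nat.le_induction with
  | base => simp [selfNormExp_one hlam]
  | succ k h1k ih =>
    have hexp := integrable_selfNormExp hη hf hlam h1k (by lia)
    have hslope := measurable_selfNormSlope hη hf lam h1k (by lia)
    have hηm := (hη.measurable k h1k (by lia)).mono (hη.le _) le_rfl
    have hηb := hη.abs_le k h1k (by lia)
    have hηi : Integrable (η k) μ :=
      .of_bound hηm.aestronglyMeasurable 1 (.of_forall hηb)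
    have hprod : Integrable
        ((fun ω => selfNormSlope lam (fun τ => f τ ω) (fun τ => η τ ω) k) * η k) μ := by
      refine (hexp.mono' (((hslope.mono (hη.le k) le_rfl)).mul hηm).aestronglyMeasurable
        (.of_forall fun ω => ?_))
      rw [Pi.mul_apply, norm_mul]
      exact (mul_le_of_le_one_right (norm_nonneg _) (hηb ω)).trans (abs_selfNormSlope_le hlam)
    calc ∫ ω, selfNormExp lam (fun τ => f τ ω) (fun τ => η τ ω) (k + 1) ∂μ
        ≤ ∫ ω, (selfNormExp lam (fun τ => f τ ω) (fun τ => η τ ω) k +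
            selfNormSlope lam (fun τ => f τ ω) (fun τ => η τ ω) k * η k ω) ∂μ :=
          integral_mono (integrable_selfNormExp hη hf hlam (by lia) hk) (hexp.add hprod)
            fun ω => selfNormExp_succ_le hlam h1k (hηb ω)
      _ = ∫ ω, selfNormExp lam (fun τ => f τ ω) (fun τ => η τ ω) k ∂μ := by
          have hprod' : Integrable (fun ω => selfNormSlope lam (fun τ => f τ ω)
            (fun τ => η τ ω) k * η k ω) μ := hprod
          rw [integral_add hexp hprod', integral_mul_eq_zero_of_condExp_eq_zero (hη.le k) hslope
            hηi hprod (hη.condExp_eq_zero k h1k (by lia)), add_zero]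
      _ ≤ 1 := ih (by lia)

theorem measure_one_div_le_selfNormExp_le (hη : IsBoundedMartingaleDiff m η n 1 μ)
    (hf : ∀ τ, 1 ≤ τ → τ < n → Measurable[m τ] (f τ)) (hn : 1 ≤ n) (hlam : 0 < lam)
    (hδ : 0 < δ) :
    μ {ω | 1 / δ ≤ selfNormExp lam (fun τ => f τ ω) (fun τ => η τ ω) n} ≤ ENNReal.ofReal δ := by
  have hmarkov := (mul_meas_ge_le_integral_of_nonneg
    (.of_forall fun ω => (selfNormExp_pos _ _ _ _).le)
    (integrable_selfNormExp hη hf hlam hn le_rfl) (1 / δ)).trans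
      (integral_selfNormExp_le_one hη hf hlam hn le_rfl)
  rw [one_div, inv_mul_le_iff₀ hδ, mul_one] at hmarkov
  rw [ENNReal.le_ofReal_iff_toReal_le (measure_ne_top μ _) hδ.le, one_div]
  exact hmarkov

-- The self-normalized bound of Abbasi-Yadkori, Pál and Szepesvári, at a fixed time.
theorem measure_quadForm_ridge_inv_weightedSum_gt_le (hη : IsBoundedMartingaleDiff m η n c μ)
    (hf : ∀ τ, 1 ≤ τ → τ < n → Measurable[m τ] (f τ)) (hn : 1 ≤ n) (hc : 0 < c) (hlam : 0 < lam)
    (hδ : 0 < δ) :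
    μ {ω | c ^ 2 * (infoGain lam (fun τ => f τ ω) n + 2 * Real.log (1 / δ)) <
        quadForm (ridge lam (fun τ => f τ ω) n)⁻¹
          (weightedSum (fun τ => η τ ω) (fun τ => f τ ω) n)} ≤ ENNReal.ofReal δ := by
  refine (measure_mono fun ω hω => ?_).trans
    (measure_one_div_le_selfNormExp_le (hη.div_const hc) hf hn hlam hδ)
  have hscale : weightedSum (fun τ => η τ ω / c) (fun τ => f τ ω) n =
      c⁻¹ • weightedSum (fun τ => η τ ω) (fun τ => f τ ω) n := by
    simp only [weightedSum, Finset.smul_sum, smul_smul, div_eq_inv_mul]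
  have hω' := (lt_div_iff₀' (pow_pos hc 2)).mpr hω
  rw [Set.mem_ofPred_eq, selfNormExp, ← Real.log_le_iff_le_exp (by positivity), hscale,
    quadForm_smul, inv_pow, ← div_eq_inv_mul]
  linarith

end SelfNormalizedBound

section Coherent

variable {X : Type*} {ρ : (X → ℝ) → ℝ}

theorem IsCoherent.const (hρ : IsCoherent ρ) (b : ℝ) : ρ (fun _ => b) = b := by
  have hzero : ρ (fun _ => 0) = 0 := by
    simpa using hρ.pos_homogeneous (fun _ => 0) 0 le_rfl
  simpa [hzero] using hρ.translation (fun _ => 0) b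

theorem IsCoherent.mem_Icc (hρ : IsCoherent ρ) {V : X → ℝ} {a b : ℝ}
    (hV : ∀ x, V x ∈ Set.Icc a b) : ρ V ∈ Set.Icc a b := by
  constructor
  · rw [← hρ.const a]; exact hρ.monotone _ _ fun x => (hV x).1
  · rw [← hρ.const b]; exact hρ.monotone _ _ fun x => (hV x).2

theorem IsCoherent.add_le (hρ : IsCoherent ρ) (V W : X → ℝ) :
    ρ (fun x => V x + W x) ≤ ρ V + ρ W := by
  have hconv :=
    hρ.convex (fun x => 2 * V x) (fun x => 2 * W x) (1 / 2) (by norm_num) (by norm_num)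
  rw [hρ.pos_homogeneous V 2 (by norm_num), hρ.pos_homogeneous W 2 (by norm_num)] at hconv
  have hmid : (fun x => 1 / 2 * (2 * V x) + (1 - 1 / 2) * (2 * W x)) = fun x => V x + W x := by
    funext x; ring
  rw [hmid] at hconv
  linarith

theorem IsCoherent.sub_le (hρ : IsCoherent ρ) (V W : X → ℝ) :
    ρ V - ρ W ≤ ρ (fun x => V x - W x) := by
  have := hρ.add_le (fun x => V x - W x) W
  simp only [sub_add_cancel] at this
  linarith

theorem IsCoherent.abs_sub_le (hρ : IsCoherent ρ) {V W : X → ℝ} {ε : ℝ}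
    (hVW : ∀ x, |V x - W x| ≤ ε) : |ρ V - ρ W| ≤ ε := by
  have hVW_le : ρ V ≤ ρ W + ε := by
    rw [← hρ.translation]
    exact hρ.monotone _ _ fun x => by linarith [(abs_le.mp (hVW x)).2]
  have hWV_le : ρ W ≤ ρ V + ε := by
    rw [← hρ.translation]
    exact hρ.monotone _ _ fun x => by linarith [(abs_le.mp (hVW x)).1]
  rw [abs_le]; constructor <;> linarith

end Coherent

section MiniBatch

variable {X : Type*} {N : ℕ}

theorem batchProb_nonneg (P : PMF X) (y : Fin N → X) : 0 ≤ batchProb P y :=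
  Finset.prod_nonneg fun _ _ => ENNReal.toReal_nonneg

theorem sum_batchProb [Fintype X] (P : PMF X) : ∑ y : Fin N → X, batchProb P y = 1 := by
  classical
  have hP : ∑ x, (P x).toReal = 1 := by
    rw [← ENNReal.toReal_sum fun x _ => P.apply_ne_top x, ← tsum_fintype (L := .unconditional X),
      P.tsum_coe, ENNReal.toReal_one]
  simpa only [batchProb, hP, Finset.prod_const_one, Fintype.piFinset_univ] using
    (Finset.prod_univ_sum (fun _ : Fin N => (Finset.univ : Finset X))
      fun _ x => (P x).toReal).symm

/-- The expectation of `W` at a uniformly chosen element of a batch of `N` draws from `P`, that is,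
at the next state of a run. -/
noncomputable def pickMean [Fintype X] (N : ℕ) (P : PMF X) (W : X → ℝ) : ℝ :=
  ∑ y : Fin N → X, ∑ j, batchProb P y * (1 / (N : ℝ)) * W (y j)

theorem pickMean_mono [Fintype X] (P : PMF X) {V W : X → ℝ} (hVW : ∀ x, V x ≤ W x) :
    pickMean N P V ≤ pickMean N P W :=
  Finset.sum_le_sum fun y _ => Finset.sum_le_sum fun _ _ =>
    mul_le_mul_of_nonneg_left (hVW _) (mul_nonneg (batchProb_nonneg P y) (by positivity))

variable [NeZero N]

theorem pickMean_const [Fintype X] (P : PMF X) (b : ℝ) : pickMean N P (fun _ => b) = b := by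
  have hN : (N : ℝ) ≠ 0 := Nat.cast_ne_zero.mpr (NeZero.ne N)
  calc pickMean N P (fun _ => b) = ∑ y : Fin N → X, batchProb P y * b := by
        simp only [pickMean, Finset.sum_const, Finset.card_univ, Fintype.card_fin, nsmul_eq_mul]
        exact Finset.sum_congr rfl fun y _ => by field_simp
    _ = b := by rw [← Finset.sum_mul, sum_batchProb, one_mul]

theorem pickMean_mem_Icc [Fintype X] (P : PMF X) {V : X → ℝ} {a b : ℝ}
    (hV : ∀ x, V x ∈ Set.Icc a b) : pickMean N P V ∈ Set.Icc a b := by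
  constructor
  · rw [← pickMean_const (N := N) P a]; exact pickMean_mono P fun x => (hV x).1
  · rw [← pickMean_const (N := N) P b]; exact pickMean_mono P fun x => (hV x).2

theorem exists_eq_of_mem_support_empirical {y : Fin N → X} {z : X}
    (hz : z ∈ (empirical y).support) : ∃ j, y j = z := by
  rw [empirical, PMF.mem_support_map_iff] at hz
  obtain ⟨j, -, hj⟩ := hz
  exact ⟨j, hj⟩

namespace IsTransitionRiskMapping

variable {σb : X → PMF X → (X → ℝ) → ℝ}

theorem isCoherent_miniBatch [Fintype X] (hσ : IsTransitionRiskMapping σb) (x : X) (P : PMF X) :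
    IsCoherent (miniBatch N σb x P) where
  convex V W t ht₀ ht₁ := by
    simp only [miniBatch, Finset.mul_sum, ← Finset.sum_add_distrib]
    refine Finset.sum_le_sum fun y _ => ?_
    have := mul_le_mul_of_nonneg_left ((hσ.coherent x (empirical y)).convex V W t ht₀ ht₁)
      (batchProb_nonneg P y)
    linarith
  monotone V W hVW := Finset.sum_le_sum fun y _ =>
    mul_le_mul_of_nonneg_left ((hσ.coherent x (empirical y)).monotone V W hVW)
      (batchProb_nonneg P y)
  translation V b := by
    simp only [miniBatch, (hσ.coherent x _).translation, mul_add, Finset.sum_add_distrib,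
      ← Finset.sum_mul, sum_batchProb, one_mul]
  pos_homogeneous V t ht := by
    simp only [miniBatch, (hσ.coherent x _).pos_homogeneous V t ht, Finset.mul_sum]
    exact Finset.sum_congr rfl fun y _ => by ring

theorem empirical_le_sum (hσ : IsTransitionRiskMapping σb) (x : X) (y : Fin N → X) {D : X → ℝ}
    (hD : ∀ z, 0 ≤ D z) : σb x (empirical y) D ≤ ∑ j, D (y j) := by
  classical
  have hcoh := hσ.coherent x (empirical y)
  rw [← hcoh.const (∑ j, D (y j)),
    hσ.congr_support x (empirical y) D (fun z => if ∃ j, y j = z then D z else 0)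
      fun z hz => by rw [if_pos (exists_eq_of_mem_support_empirical hz)]]
  refine hcoh.monotone _ _ fun z => ?_
  split_ifs with hz
  · obtain ⟨j, rfl⟩ := hz
    exact Finset.single_le_sum (f := fun j => D (y j)) (fun j _ => hD _) (Finset.mem_univ j)
  · exact Finset.sum_nonneg fun j _ => hD _

theorem miniBatch_le_pickMean [Fintype X] (hσ : IsTransitionRiskMapping σb) (x : X) (P : PMF X)
    {D : X → ℝ} (hD : ∀ z, 0 ≤ D z) : miniBatch N σb x P D ≤ N * pickMean N P D := by
  have hN : (N : ℝ) ≠ 0 := Nat.cast_ne_zero.mpr (NeZero.ne N)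
  unfold pickMean miniBatch
  rw [Finset.mul_sum]
  refine Finset.sum_le_sum fun y _ => ?_
  calc batchProb P y * σb x (empirical y) D
      ≤ batchProb P y * ∑ j, D (y j) :=
        mul_le_mul_of_nonneg_left (hσ.empirical_le_sum x y hD) (batchProb_nonneg P y)
    _ = N * ∑ j, batchProb P y * (1 / N) * D (y j) := by
        rw [← Finset.mul_sum]
        field_simp

end IsTransitionRiskMapping

end MiniBatch

namespace RiskMDP

variable {X A : Type*} {H N : ℕ} (M : RiskMDP X A H)

theorem stageCost_of_lt {h : ℕ} (hH : h < H) (x : X) (a : A) :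
    M.stageCost h x a = M.cost h x a := if_neg hH.ne

theorem stageCost_mem {h : ℕ} (h1 : 1 ≤ h) (hH : h ≤ H) (x : X) (a : A) :
    M.stageCost h x a ∈ Set.Icc (0 : ℝ) 1 := by
  unfold stageCost
  split_ifs with hh
  · exact M.termCost_mem x
  · exact M.cost_mem h h1 (lt_of_le_of_ne hH hh) x a

variable [NeZero N] [Fintype X]

theorem isCoherent_risk {h : ℕ} (h1 : 1 ≤ h) (hH : h < H) (x : X) (a : A) :
    IsCoherent (M.risk N h x a) :=
  (M.baseRisk_coherent h h1 hH).isCoherent_miniBatch x _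

theorem policyValueAux_mem (π : ℕ → X → A) {n : ℕ} (hn : n < H) (x : X) :
    M.policyValueAux N π n x ∈ Set.Icc (0 : ℝ) (n + 1) := by
  induction n generalizing x with
  | zero => simpa [policyValueAux] using M.termCost_mem x
  | succ n ih =>
    have h1 : 1 ≤ H - (n + 1) := by lia
    have hH : H - (n + 1) < H := by lia
    have hrisk := (M.isCoherent_risk (N := N) h1 hH x (π (H - (n + 1)) x)).mem_Icc (ih (by lia))
    have hcost := M.cost_mem _ h1 hH x (π (H - (n + 1)) x)
    simp only [policyValueAux, Set.mem_Icc] at *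
    push_cast
    constructor <;> linarith [hrisk.1, hrisk.2, hcost.1, hcost.2]

theorem optValueAux_le_policyValueAux [Finite A] (π : ℕ → X → A) {n : ℕ} (hn : n < H) (x : X) :
    M.optValueAux N n x ≤ M.policyValueAux N π n x := by
  induction n generalizing x with
  | zero => rfl
  | succ n ih =>
    refine (ciInf_le (Set.finite_range _).bddBelow (π (H - (n + 1)) x)).trans ?_
    simp only [policyValueAux]
    gcongr
    exact (M.isCoherent_risk (N := N) (by lia) (by lia) x _).monotone _ _ (ih (by lia))

end RiskMDP

section RandomSubstitution

variable {Ω S : Type*}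

theorem measurable_eval_of_countable {T : Type*} [Countable S] {m : MeasurableSpace Ω}
    [mT : MeasurableSpace T] {s : Ω → S} (hs : Measurable[m, ⊤] s) {F : S → Ω → T}
    (hF : ∀ a, Measurable[m] (F a)) : Measurable[m] fun ω => F (s ω) ω := by
  intro t ht
  have hpre : (fun ω => F (s ω) ω) ⁻¹' t = ⋃ a, s ⁻¹' {a} ∩ F a ⁻¹' t := by
    ext ω; simp
  rw [hpre]
  exact MeasurableSet.iUnion fun a => (hs trivial).inter (hF a ht)

theorem condExp_eval_eq_sum [Fintype S] {m mΩ : MeasurableSpace Ω} {μ : Measure Ω}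
    [IsFiniteMeasure μ] (hm : m ≤ mΩ) {s : Ω → S} (hs : Measurable[mΩ, ⊤] s) {p : S → Ω → ℝ}
    (hp : ∀ a, μ[(s ⁻¹' {a}).indicator fun _ => (1 : ℝ) | m] =ᵐ[μ] p a)
    {c : S → Ω → ℝ} (hc : ∀ a, Measurable[m] (c a)) {C : ℝ} (hC : ∀ a ω, |c a ω| ≤ C) :
    μ[fun ω => c (s ω) ω | m] =ᵐ[μ] fun ω => ∑ a, p a ω * c a ω := by
  classical
  have hmeas : ∀ a, MeasurableSet (s ⁻¹' {a}) := fun a => hs trivial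
  have hind : ∀ a, Integrable ((s ⁻¹' {a}).indicator fun _ => (1 : ℝ)) μ := fun a =>
    (integrable_const 1).indicator (hmeas a)
  have hprod : ∀ a, Integrable (c a * (s ⁻¹' {a}).indicator fun _ => (1 : ℝ)) μ := fun a =>
    (hind a).bdd_mul ((hc a).mono hm le_rfl).aestronglyMeasurable (.of_forall (hC a))
  have hsum : (fun ω => c (s ω) ω) = ∑ a, c a * (s ⁻¹' {a}).indicator fun _ => (1 : ℝ) := by
    funext ω
    simp [Finset.sum_apply, Set.indicator_apply]
  have hterm : ∀ᵐ ω ∂μ, ∀ a,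
      (μ[c a * (s ⁻¹' {a}).indicator fun _ => (1 : ℝ) | m]) ω = p a ω * c a ω := by
    rw [ae_all_iff]
    intro a
    filter_upwards [condExp_mul_of_stronglyMeasurable_left (hc a).stronglyMeasurable
      (hprod a) (hind a), hp a] with ω hpull hpa
    rw [hpull, Pi.mul_apply, hpa, mul_comm]
  rw [hsum]
  filter_upwards [condExp_finsetSum (fun a _ => hprod a) m, hterm] with ω hlin hω
  rw [hlin, Finset.sum_apply]
  exact Finset.sum_congr rfl fun a _ => hω a

end RandomSubstitution

theorem abs_ciInf_sub_ciInf_le {ι : Type*} [Finite ι] [Nonempty ι] {f g : ι → ℝ} {ε : ℝ}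
    (hfg : ∀ a, |f a - g a| ≤ ε) : |(⨅ a, f a) - ⨅ a, g a| ≤ ε := by
  have hle : (⨅ a, f a) - ε ≤ ⨅ a, g a := le_ciInf fun a => by
    linarith [ciInf_le (Set.finite_range f).bddBelow a, (abs_le.mp (hfg a)).2]
  have hge : (⨅ a, g a) - ε ≤ ⨅ a, f a := le_ciInf fun a => by
    linarith [ciInf_le (Set.finite_range g).bddBelow a, (abs_le.mp (hfg a)).1]
  rw [abs_le]; constructor <;> linarith

theorem abs_apply_sub_le_norm {X A : Type*} [Fintype X] [Fintype A] (Q Q' : X → A → ℝ) (x : X)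
    (a : A) : |Q x a - Q' x a| ≤ ‖Q - Q'‖ :=
  (norm_le_pi_norm ((Q - Q') x) a).trans (norm_le_pi_norm (Q - Q') x)

namespace QLearningRun

variable {Ω X A : Type*} {H d N : ℕ} [NeZero N] {M : RiskMDP X A H}
  {φ : X → A → Fin d → ℝ} {K : ℕ} {lam β : ℝ} [mΩ : MeasurableSpace Ω] {μ : Measure Ω}
  (R : QLearningRun M N φ K lam β μ)

theorem history_stage_mono {k h h' : ℕ} (hk : 1 ≤ k) (hkK : k ≤ K) (h1 : 1 ≤ h) (hh : h ≤ h')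
    (hH : h' ≤ H) : R.history k h ≤ R.history k h' := by
  induction h', hh using Nat.le_induction with
  | base => exact le_rfl
  | succ j hj ih => exact (ih (by lia)).trans (R.history_stage k j hk hkK (by lia) (by lia))

theorem history_le_history_succ {k h h' : ℕ} (hk : 1 ≤ k) (hkK : k < K) (h1 : 1 ≤ h) (hH : h ≤ H)
    (h1' : 1 ≤ h') (hH' : h' ≤ H) : R.history k h ≤ R.history (k + 1) h' :=
  calc R.history k h ≤ R.history k H := R.history_stage_mono hk hkK.le h1 hH le_rfl
    _ ≤ R.history (k + 1) 1 := R.history_episode k hk hkK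
    _ ≤ R.history (k + 1) h' := R.history_stage_mono (by lia) (by lia) le_rfl h1' hH'

theorem history_episode_mono {k k' h : ℕ} (hk : 1 ≤ k) (hkk : k ≤ k') (hkK : k' ≤ K)
    (h1 : 1 ≤ h) (hH : h ≤ H) : R.history k h ≤ R.history k' h := by
  induction k', hkk using Nat.le_induction with
  | base => exact le_rfl
  | succ j hj ih =>
    exact (ih (by lia)).trans (R.history_le_history_succ (by lia) (by lia) h1 hH h1 hH)

theorem measurable_state [Finite X] {k h : ℕ} (hk : 1 ≤ k) (hkK : k ≤ K) (h1 : 1 ≤ h)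
    (hH : h ≤ H) : Measurable[R.history k h, ⊤] (R.state h k) := by
  rcases h1.eq_or_lt with rfl | h2
  · exact R.state_one_measurable k hk hkK
  obtain ⟨j, rfl⟩ : ∃ j, h = j + 1 := ⟨h - 1, by lia⟩
  rw [funext (R.state_next k j hk hkK (by lia) (by lia))]
  refine measurable_eval_of_countable (mT := ⊤) (R.pick_measurable k j hk hkK (by lia) (by lia))
    (F := fun i ω => R.batch (j + 1) k ω i) fun i => ?_
  exact (@measurable_from_top _ _ ⊤ fun y : Fin N → X => y i).comp
    (R.batch_measurable k j hk hkK (by lia) (by lia))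

theorem measurable_action [Finite X] {k h : ℕ} (hk : 1 ≤ k) (hkK : k ≤ K) (h1 : 1 ≤ h)
    (hH : h ≤ H) : Measurable[R.history k h, ⊤] (R.action h k) :=
  measurable_eval_of_countable (mT := ⊤) (R.measurable_state hk hkK h1 hH)
    (F := fun x ω => R.policy k ω h x) fun x =>
      (R.policy_measurable k h hk hkK h1 hH x).mono
        (R.history_stage_mono hk hkK le_rfl h1 hH) le_rfl

theorem measurable_comp_state_action [Finite X] [Finite A] {T : Type*} [MeasurableSpace T]
    (g : X → A → T) {k h : ℕ} (hk : 1 ≤ k) (hkK : k ≤ K) (h1 : 1 ≤ h) (hH : h ≤ H) :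
    Measurable[R.history k h] fun ω => g (R.state h k ω) (R.action h k ω) :=
  measurable_eval_of_countable (R.measurable_state hk hkK h1 hH)
    (F := fun x ω => g x (R.action h k ω)) fun x =>
      measurable_eval_of_countable (R.measurable_action hk hkK h1 hH)
        (F := fun a _ => g x a) fun _ => measurable_const

theorem condExp_batch [Fintype X] [IsFiniteMeasure μ] {k h : ℕ} (hk : 1 ≤ k) (hkK : k ≤ K)
    (h1 : 1 ≤ h) (hH : h < H) {c : (Fin N → X) → Fin N → Ω → ℝ}
    (hc : ∀ y j, Measurable[R.history k h] (c y j)) {C : ℝ} (hC : ∀ y j ω, |c y j ω| ≤ C) :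
    μ[fun ω => c (R.batch (h + 1) k ω) (R.pick (h + 1) k ω) ω | R.history k h] =ᵐ[μ] fun ω =>
      ∑ y : Fin N → X, ∑ j, batchProb (M.kernel h (R.state h k ω) (R.action h k ω)) y *
        (1 / (N : ℝ)) * c y j ω := by
  have hdraw : Measurable[mΩ, ⊤] fun ω => (R.batch (h + 1) k ω, R.pick (h + 1) k ω) :=
    have hpair := measurable_eval_of_countable (mT := ⊤)
      (R.batch_measurable k h hk hkK h1 hH) (F := fun y ω => (y, R.pick (h + 1) k ω)) fun y =>
        (@measurable_from_top _ _ ⊤ (Prod.mk y)).comp (R.pick_measurable k h hk hkK h1 hH)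
    hpair.mono (R.history_le k (h + 1)) le_rfl
  simpa only [Fintype.sum_prod_type] using
    condExp_eval_eq_sum (R.history_le k h) hdraw
      (p := fun q ω => batchProb (M.kernel h (R.state h k ω) (R.action h k ω)) q.1 * (1 / (N : ℝ)))
      (fun q => by
        have hevent : (fun ω => (R.batch (h + 1) k ω, R.pick (h + 1) k ω)) ⁻¹' {q} =
            {ω | R.batch (h + 1) k ω = q.1 ∧ R.pick (h + 1) k ω = q.2} :=
          Set.ext fun _ => Prod.ext_iff
        rw [hevent]
        exact R.sampling k h hk hkK h1 hH q.1 q.2)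
      (c := fun q => c q.1 q.2) (fun q => hc q.1 q.2) (fun q => hC q.1 q.2)

theorem condExp_state_next [Fintype X] [IsFiniteMeasure μ] {k h : ℕ} (hk : 1 ≤ k)
    (hkK : k ≤ K) (h1 : 1 ≤ h) (hH : h < H) {W : Ω → X → ℝ}
    (hW : ∀ x, Measurable[R.history k h] fun ω => W ω x) {C : ℝ} (hC : ∀ ω x, |W ω x| ≤ C) :
    μ[fun ω => W ω (R.state (h + 1) k ω) | R.history k h] =ᵐ[μ] fun ω =>
      pickMean N (M.kernel h (R.state h k ω) (R.action h k ω)) (W ω) := by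
  simpa only [R.state_next k h hk hkK h1 hH, pickMean] using
    R.condExp_batch hk hkK h1 hH (c := fun y j ω => W ω (y j)) (fun _ _ => hW _)
      (fun _ _ ω => hC ω _)

theorem condExp_baseRisk_empirical [Fintype X] [Finite A] [IsFiniteMeasure μ] {k h : ℕ}
    (hk : 1 ≤ k) (hkK : k ≤ K) (h1 : 1 ≤ h) (hH : h < H) (V : X → ℝ) :
    μ[fun ω => M.baseRisk h (R.state h k ω) (empirical (R.batch (h + 1) k ω)) V | R.history k h]
      =ᵐ[μ] fun ω => M.risk N h (R.state h k ω) (R.action h k ω) V := by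
  obtain ⟨C, hC⟩ : ∃ C, ∀ y, |V y| ≤ C := by
    obtain ⟨C, hC⟩ := (Set.finite_range fun y => |V y|).bddAbove
    exact ⟨C, fun y => hC ⟨y, rfl⟩⟩
  have hN : (N : ℝ) ≠ 0 := Nat.cast_ne_zero.mpr (NeZero.ne N)
  refine (R.condExp_batch hk hkK h1 hH
    (c := fun y _ ω => M.baseRisk h (R.state h k ω) (empirical y) V)
    (fun y _ => R.measurable_comp_state_action (fun x _ => M.baseRisk h x (empirical y) V)
      hk hkK h1 hH.le)
    (fun y _ ω => abs_le.mpr (((M.baseRisk_coherent h h1 hH).coherent _ _).mem_Icc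
      fun x => abs_le.mp (hC x)))).trans (.of_forall fun ω => ?_)
  simp only [RiskMDP.risk, miniBatch, Finset.sum_const, Finset.card_univ, Fintype.card_fin,
    nsmul_eq_mul]
  exact Finset.sum_congr rfl fun y _ => by field_simp

theorem UsesAggregator.usesUnbiasedEstimator [Fintype X] [Fintype A] [Nonempty A]
    [IsFiniteMeasure μ] {R : QLearningRun M N φ K lam β μ} (hR : R.UsesAggregator)
    {L : ℝ} (hL : 1 ≤ L) : R.UsesUnbiasedEstimator L where
  measurable h τ hτ hτK h1 hH Q := by
    simp only [hR h τ hτ hτK h1 hH]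
    exact measurable_eval_of_countable ((R.measurable_state hτ hτK h1 hH.le).mono
      (R.history_stage τ h hτ hτK h1 hH) le_rfl)
      (F := fun x ω => M.baseRisk h x (empirical (R.batch (h + 1) τ ω)) fun y => ⨅ a, Q y a)
      fun x => measurable_eval_of_countable (R.batch_measurable τ h hτ hτK h1 hH)
        (F := fun y _ => M.baseRisk h x (empirical y) fun y => ⨅ a, Q y a)
        fun _ => measurable_const
  lipschitz h τ hτ hτK h1 hH ω Q Q' := by
    rw [hR h τ hτ hτK h1 hH, hR h τ hτ hτK h1 hH]
    exact (((M.baseRisk_coherent h h1 hH).coherent _ _).abs_sub_le fun x =>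
      abs_ciInf_sub_ciInf_le fun a => abs_apply_sub_le_norm Q Q' x a).trans
        (le_mul_of_one_le_left (norm_nonneg _) hL)
  zero h τ hτ hτK h1 hH ω := by
    rw [hR h τ hτ hτK h1 hH]
    simpa using ((M.baseRisk_coherent h h1 hH).coherent (R.state h τ ω)
      (empirical (R.batch (h + 1) τ ω))).const 0
  unbiased h τ hτ hτK h1 hH Q := by
    simp only [hR h τ hτ hτK h1 hH]
    exact R.condExp_baseRisk_empirical hτ hτK h1 hH _

end QLearningRun

section Azuma

variable {Ω : Type*} {mΩ : MeasurableSpace Ω} {μ : Measure Ω} [IsProbabilityMeasure μ]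

-- The self-normalized bound for the constant feature `1` in dimension one.
theorem measure_sum_gt_le {m : ℕ → MeasurableSpace Ω} {η : ℕ → Ω → ℝ} {n : ℕ} {c δ : ℝ}
    (hη : IsBoundedMartingaleDiff m η (n + 1) c μ) (hc : 0 < c) (hδ : 0 < δ) :
    μ {ω | c * √((n + 1) * (Real.log (1 + n) + 2 * Real.log (1 / δ))) <
      ∑ τ ∈ Finset.Icc 1 n, η τ ω} ≤ ENNReal.ofReal δ := by
  refine (measure_mono fun ω hω => ?_).trans (measure_quadForm_ridge_inv_weightedSum_gt_le
    (f := fun _ _ (_ : Unit) => (1 : ℝ)) hη (fun _ _ _ => measurable_const) (by lia) hc one_pos hδ)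
  rw [Set.mem_ofPred_eq] at hω ⊢
  set S := weightedSum (fun τ => η τ ω) (fun _ (_ : Unit) => (1 : ℝ)) (n + 1)
  have hsum : S ⬝ᵥ (fun _ => 1) = ∑ τ ∈ Finset.Icc 1 n, η τ ω := by
    rw [weightedSum_dotProduct]
    simp [dotProduct, show Finset.Icc 1 n = Finset.Ico 1 (n + 1) from rfl]
  have hform : quadForm (ridge 1 (fun _ (_ : Unit) => (1 : ℝ)) (n + 1)) (fun _ => 1) = n + 1 := by
    simp [quadForm_ridge, dotProduct]
  have hcauchy := abs_dotProduct_le_sqrt_quadForm_inv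
    (posDef_ridge one_pos (fun _ (_ : Unit) => (1 : ℝ)) (n + 1)) S (fun _ => 1)
  rw [hsum, hform] at hcauchy
  have hgain := infoGain_le one_pos (f := fun _ (_ : Unit) => (1 : ℝ)) (by simp [dotProduct])
    (le_refl (n + 1))
  simp only [Fintype.card_unit, Nat.cast_one, one_mul, div_one] at hgain
  rw [mul_comm (n + 1 : ℝ), Real.sqrt_mul' _ (by positivity), ← mul_assoc] at hω
  have hlt := lt_of_mul_lt_mul_right (hω.trans_le ((le_abs_self _).trans hcauchy))
    (Real.sqrt_nonneg _)
  calc c ^ 2 * (infoGain 1 (fun _ (_ : Unit) => (1 : ℝ)) (n + 1) + 2 * Real.log (1 / δ))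
      ≤ c ^ 2 * (Real.log (1 + n) + 2 * Real.log (1 / δ)) := by gcongr
    _ < quadForm (ridge 1 (fun _ (_ : Unit) => (1 : ℝ)) (n + 1))⁻¹ S := by
      refine (Real.sqrt_lt_sqrt_iff_of_pos ?_).mp ?_
      · exact Real.sqrt_pos.mp ((mul_nonneg hc.le (Real.sqrt_nonneg _)).trans_lt hlt)
      · rwa [Real.sqrt_mul (by positivity), Real.sqrt_sq hc.le]

end Azuma

section RidgeEstimate

variable {ι : Type*} [Fintype ι] [DecidableEq ι] {lam : ℝ}

/-- The ridge regression estimate from the features `f 1, …, f (k - 1)` and responses `y`. -/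
noncomputable def ridgeEstimate (lam : ℝ) (f : ℕ → ι → ℝ) (k : ℕ) (y : ℕ → ℝ) : ι → ℝ :=
  (ridge lam f k)⁻¹ *ᵥ weightedSum y f k

theorem abs_dotProduct_ridge_inv_mulVec_le (hlam : 0 < lam) (f : ℕ → ι → ℝ) (k : ℕ)
    {v w : ι → ℝ} (hv : v ⬝ᵥ v ≤ 1) (hw : w ⬝ᵥ w ≤ 1) :
    |v ⬝ᵥ (ridge lam f k)⁻¹ *ᵥ w| ≤ 1 / lam := by
  have hunit {u : ι → ℝ} (hu : u ⬝ᵥ u ≤ 1) : quadForm (ridge lam f k)⁻¹ u ≤ 1 / lam :=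
    (quadForm_ridge_inv_le hlam f k u).trans (by gcongr)
  calc |v ⬝ᵥ (ridge lam f k)⁻¹ *ᵥ w|
      ≤ √(quadForm (ridge lam f k)⁻¹ v) * √(quadForm (ridge lam f k)⁻¹ w) :=
        abs_dotProduct_mulVec_le (posSemidef_ridge_inv hlam f k) v w
    _ ≤ √(1 / lam) * √(1 / lam) := by
        gcongr
        exacts [hunit hv, hunit hw]
    _ = 1 / lam := Real.mul_self_sqrt (by positivity)

theorem abs_ridge_inv_apply_le (hlam : 0 < lam) (f : ℕ → ι → ℝ) (k : ℕ) (i j : ι) :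
    |(ridge lam f k)⁻¹ i j| ≤ 1 / lam := by
  simpa using abs_dotProduct_ridge_inv_mulVec_le hlam f k (v := Pi.single i 1)
    (w := Pi.single j 1) (by simp) (by simp)

theorem abs_ridgeEstimate_apply_le (hlam : 0 < lam) {f : ℕ → ι → ℝ}
    (hf : ∀ τ, f τ ⬝ᵥ f τ ≤ 1) {k K : ℕ} (hkK : k ≤ K + 1) {y : ℕ → ℝ} {Y : ℝ}
    (hY : 0 ≤ Y) (hy : ∀ τ, 1 ≤ τ → τ < k → |y τ| ≤ Y) (i : ι) :
    |ridgeEstimate lam f k y i| ≤ K * Y / lam := by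
  have hexpand : ridgeEstimate lam f k y i =
      ∑ τ ∈ Finset.Ico 1 k, y τ * (f τ ⬝ᵥ (ridge lam f k)⁻¹ *ᵥ Pi.single i 1) := by
    rw [← weightedSum_dotProduct,
      dotProduct_mulVec_comm (posSemidef_ridge_inv hlam f k).isHermitian,
      single_one_dotProduct, ridgeEstimate]
  have hk : ((k - 1 : ℕ) : ℝ) ≤ K := by exact_mod_cast (by lia : k - 1 ≤ K)
  rw [hexpand]
  calc |∑ τ ∈ Finset.Ico 1 k, y τ * (f τ ⬝ᵥ (ridge lam f k)⁻¹ *ᵥ Pi.single i 1)|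
      ≤ ∑ τ ∈ Finset.Ico 1 k, |y τ * (f τ ⬝ᵥ (ridge lam f k)⁻¹ *ᵥ Pi.single i 1)| :=
        Finset.abs_sum_le_sum_abs _ _
    _ ≤ ∑ τ ∈ Finset.Ico 1 k, Y * (1 / lam) := by
        refine Finset.sum_le_sum fun τ hτ => ?_
        rw [Finset.mem_Ico] at hτ
        rw [abs_mul]
        exact mul_le_mul (hy τ hτ.1 hτ.2)
          (abs_dotProduct_ridge_inv_mulVec_le hlam f k (hf τ) (by simp)) (abs_nonneg _) hY
    _ = ((k - 1 : ℕ) : ℝ) * (Y / lam) := by simp [div_eq_mul_inv]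
    _ ≤ K * (Y / lam) := by gcongr
    _ = K * Y / lam := by ring

theorem ridgeEstimate_of_linear_add_noise (hlam : 0 < lam) (f : ℕ → ι → ℝ) (k : ℕ) (w : ι → ℝ)
    {y ν : ℕ → ℝ} (hy : ∀ τ, 1 ≤ τ → τ < k → y τ = f τ ⬝ᵥ w + ν τ) :
    ridgeEstimate lam f k y = w + (ridge lam f k)⁻¹ *ᵥ (weightedSum ν f k - lam • w) := by
  have hP := posDef_ridge hlam f k
  have hinv : (ridge lam f k)⁻¹ * ridge lam f k = 1 :=
    nonsing_inv_mul _ ((isUnit_iff_isUnit_det _).mp hP.isUnit)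
  have hsum : weightedSum y f k = ridge lam f k *ᵥ w + (weightedSum ν f k - lam • w) := by
    have hsplit : weightedSum y f k = weightedSum (fun τ => f τ ⬝ᵥ w) f k + weightedSum ν f k := by
      rw [weightedSum, weightedSum, weightedSum, ← Finset.sum_add_distrib]
      refine Finset.sum_congr rfl fun τ hτ => ?_
      rw [Finset.mem_Ico] at hτ
      rw [hy τ hτ.1 hτ.2, add_smul]
    rw [ridge_mulVec, hsplit]
    abel
  rw [ridgeEstimate, hsum, mulVec_add, mulVec_mulVec, hinv, one_mulVec]

theorem mul_sqrt_quadForm_ridge_inv_le (hlam : 0 < lam) (f : ℕ → ι → ℝ) (k : ℕ) (w : ι → ℝ) :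
    lam * √(quadForm (ridge lam f k)⁻¹ w) ≤ √(lam * (w ⬝ᵥ w)) := by
  refine Real.le_sqrt_of_sq_le ?_
  rw [mul_pow, Real.sq_sqrt (quadForm_nonneg (posSemidef_ridge_inv hlam f k) w)]
  calc lam ^ 2 * quadForm (ridge lam f k)⁻¹ w ≤ lam ^ 2 * (w ⬝ᵥ w / lam) := by
        gcongr
        exact quadForm_ridge_inv_le hlam f k w
    _ = lam * (w ⬝ᵥ w) := by field_simp

theorem abs_ridgeEstimate_dotProduct_sub_le (hlam : 0 < lam) (f : ℕ → ι → ℝ) (k : ℕ)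
    (w : ι → ℝ) {y ν : ℕ → ℝ} (hy : ∀ τ, 1 ≤ τ → τ < k → y τ = f τ ⬝ᵥ w + ν τ) (v : ι → ℝ) :
    |ridgeEstimate lam f k y ⬝ᵥ v - v ⬝ᵥ w| ≤
      (√(quadForm (ridge lam f k)⁻¹ (weightedSum ν f k)) + √(lam * (w ⬝ᵥ w))) *
        √(quadForm (ridge lam f k)⁻¹ v) := by
  have hP := posSemidef_ridge_inv hlam f k
  set S := weightedSum ν f k
  set q := quadForm (ridge lam f k)⁻¹
  have hsplit : ridgeEstimate lam f k y ⬝ᵥ v - v ⬝ᵥ w =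
      v ⬝ᵥ (ridge lam f k)⁻¹ *ᵥ S - lam * (v ⬝ᵥ (ridge lam f k)⁻¹ *ᵥ w) := by
    rw [ridgeEstimate_of_linear_add_noise hlam f k w hy, dotProduct_comm, dotProduct_add,
      mulVec_sub, mulVec_smul, dotProduct_sub, dotProduct_smul, smul_eq_mul]
    ring
  rw [hsplit]
  calc |v ⬝ᵥ (ridge lam f k)⁻¹ *ᵥ S - lam * (v ⬝ᵥ (ridge lam f k)⁻¹ *ᵥ w)|
      ≤ |v ⬝ᵥ (ridge lam f k)⁻¹ *ᵥ S| + lam * |v ⬝ᵥ (ridge lam f k)⁻¹ *ᵥ w| := by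
        refine (abs_sub _ _).trans_eq ?_
        rw [abs_mul, abs_of_pos hlam]
    _ ≤ √(q v) * √(q S) + lam * (√(q v) * √(q w)) := by
        gcongr <;> exact abs_dotProduct_mulVec_le hP v _
    _ = (√(q S) + lam * √(q w)) * √(q v) := by ring
    _ ≤ (√(q S) + √(lam * (w ⬝ᵥ w))) * √(q v) := by
        gcongr
        exact mul_sqrt_quadForm_ridge_inv_le hlam f k w

end RidgeEstimate

section Simplex

variable {ι : Type*} [Fintype ι] {v w : ι → ℝ}

theorem abs_dotProduct_le_of_mem_stdSimplex (hv : v ∈ stdSimplex ℝ ι) {ε : ℝ}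
    (hw : ∀ i, |w i| ≤ ε) : |v ⬝ᵥ w| ≤ ε := by
  calc |v ⬝ᵥ w| ≤ ∑ i, |v i * w i| := Finset.abs_sum_le_sum_abs _ _
    _ ≤ ∑ i, v i * ε := by
        refine Finset.sum_le_sum fun i _ => ?_
        rw [abs_mul, abs_of_nonneg (hv.1 i)]
        exact mul_le_mul_of_nonneg_left (hw i) (hv.1 i)
    _ = ε := by rw [← Finset.sum_mul, hv.2, one_mul]

theorem dotProduct_self_le_one_of_mem_stdSimplex (hv : v ∈ stdSimplex ℝ ι) : v ⬝ᵥ v ≤ 1 :=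
  (le_abs_self _).trans (abs_dotProduct_le_of_mem_stdSimplex hv fun i => by
    rw [abs_of_nonneg (hv.1 i)]
    exact (mem_Icc_of_mem_stdSimplex hv i).2)

end Simplex

theorem sqrt_le_sqrt_add_sqrt_abs_sub (a b : ℝ) : √a ≤ √b + √|a - b| := by
  rcases le_total 0 b with hb | hb
  · refine Real.sqrt_le_iff.mpr ⟨by positivity, ?_⟩
    nlinarith [le_abs_self (a - b), Real.sq_sqrt hb, Real.sq_sqrt (abs_nonneg (a - b)),
      mul_nonneg (Real.sqrt_nonneg b) (Real.sqrt_nonneg |a - b|)]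
  · rw [Real.sqrt_eq_zero_of_nonpos hb, zero_add]
    exact Real.sqrt_le_sqrt (by linarith [le_abs_self (a - b)])

theorem abs_sqrt_sub_sqrt_le (a b : ℝ) : |√a - √b| ≤ √|a - b| := by
  rw [abs_sub_le_iff, sub_le_iff_le_add', sub_le_iff_le_add']
  exact ⟨sqrt_le_sqrt_add_sqrt_abs_sub a b, abs_sub_comm a b ▸ sqrt_le_sqrt_add_sqrt_abs_sub b a⟩

section Cover

variable {X A ι : Type*} [Fintype ι]

/-- The parametric form of the functions produced by the backward pass: a linear function minus a
bonus, truncated at `0`. -/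
noncomputable def qForm (φ : X → A → ι → ℝ) (w : ι → ℝ) (G : Matrix ι ι ℝ) (x : X) (a : A) : ℝ :=
  max (w ⬝ᵥ φ x a - √(quadForm G (φ x a))) 0

theorem abs_qForm_sub_le {φ : X → A → ι → ℝ} (hφ : ∀ x a, φ x a ∈ stdSimplex ℝ ι)
    {w w' : ι → ℝ} {G G' : Matrix ι ι ℝ} {ε : ℝ}
    (hw : ∀ i, |w i - w' i| ≤ ε) (hG : ∀ i j, |G i j - G' i j| ≤ ε) (x : X) (a : A) :
    |qForm φ w G x a - qForm φ w' G' x a| ≤ ε + √ε := by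
  have hlinear : |w ⬝ᵥ φ x a - w' ⬝ᵥ φ x a| ≤ ε := by
    rw [← sub_dotProduct, dotProduct_comm]
    exact abs_dotProduct_le_of_mem_stdSimplex (hφ x a) hw
  have hquad : |quadForm G (φ x a) - quadForm G' (φ x a)| ≤ ε := by
    rw [quadForm, quadForm, ← dotProduct_sub, ← sub_mulVec]
    refine abs_dotProduct_le_of_mem_stdSimplex (hφ x a) fun i => ?_
    rw [mulVec, dotProduct_comm]
    exact abs_dotProduct_le_of_mem_stdSimplex (hφ x a) fun j => hG i j
  have hbonus : |√(quadForm G (φ x a)) - √(quadForm G' (φ x a))| ≤ √ε :=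
    (abs_sqrt_sub_sqrt_le _ _).trans (Real.sqrt_le_sqrt hquad)
  refine (abs_max_sub_max_le_abs _ _ _).trans ?_
  rw [abs_le] at *
  constructor <;> linarith [hlinear.1, hlinear.2, hbonus.1, hbonus.2]

/-- Indices of a grid of parameters `(w, G)` of `qForm`, with `2 m + 1` values per coordinate. -/
abbrev GridIndex (ι : Type*) (m : ℕ) : Type _ := (ι ⊕ ι × ι) → Fin (2 * m + 1)

/-- The function with parameters on the grid `{-m/K, …, m/K}`, truncated at `H` so that it is
bounded for every index. -/
noncomputable def gridQ (φ : X → A → ι → ℝ) (H K : ℕ) {m : ℕ} (q : GridIndex ι m)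
    (x : X) (a : A) : ℝ :=
  min (qForm φ (fun i => ((q (.inl i) : ℝ) - m) / K)
    (Matrix.of fun i j => ((q (.inr (i, j)) : ℝ) - m) / K) x a) H

theorem gridQ_mem_Icc (φ : X → A → ι → ℝ) (H K : ℕ) {m : ℕ} (q : GridIndex ι m) (x : X) (a : A) :
    gridQ φ H K q x a ∈ Set.Icc (0 : ℝ) H :=
  ⟨le_min (le_max_right _ _) (Nat.cast_nonneg H), min_le_right _ _⟩

theorem exists_abs_sub_grid_le {K m : ℕ} (hK : 1 ≤ K) {t : ℝ} (ht : |t| * K ≤ m) :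
    ∃ i : Fin (2 * m + 1), |t - ((i : ℝ) - m) / K| ≤ 1 / K := by
  have hKpos : (0 : ℝ) < K := by exact_mod_cast hK
  have hnonneg : 0 ≤ t * K + m := by nlinarith [neg_abs_le t]
  have hfloor : ⌊t * K + m⌋₊ ≤ 2 * m :=
    Nat.floor_le_of_le (by push_cast; nlinarith [le_abs_self t])
  refine ⟨⟨⌊t * K + m⌋₊, by lia⟩, ?_⟩
  have herr : t - ((⌊t * K + m⌋₊ : ℝ) - m) / K = (t * K + m - ⌊t * K + m⌋₊) / K := by
    field_simp; ring
  rw [herr, abs_div, abs_of_pos hKpos]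
  gcongr
  rw [abs_le]
  constructor <;> linarith [Nat.floor_le hnonneg, Nat.lt_floor_add_one (t * K + m)]

theorem one_div_add_sqrt_one_div_le {t : ℝ} (ht : 1 ≤ t) : 1 / t + √(1 / t) ≤ 2 / √t := by
  have hsqrt : 1 / t ≤ 1 / √t :=
    one_div_le_one_div_of_le (by positivity) (Real.sqrt_le_left (by linarith) |>.mpr (by nlinarith))
  calc 1 / t + √(1 / t) ≤ 1 / √t + 1 / √t := by
        rw [Real.sqrt_div zero_le_one, Real.sqrt_one]
        gcongr
    _ = 2 / √t := by ring

theorem exists_abs_qForm_sub_gridQ_le {φ : X → A → ι → ℝ} (hφ : ∀ x a, φ x a ∈ stdSimplex ℝ ι)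
    {H K m : ℕ} (hK : 1 ≤ K) {w : ι → ℝ} {G : Matrix ι ι ℝ}
    (hw : ∀ i, |w i| * K ≤ m) (hG : ∀ i j, |G i j| * K ≤ m) (hQ : ∀ x a, qForm φ w G x a ≤ H) :
    ∃ q : GridIndex ι m, ∀ x a, |qForm φ w G x a - gridQ φ H K q x a| ≤ 2 / √K := by
  choose qw hqw using fun i => exists_abs_sub_grid_le hK (hw i)
  choose qG hqG using fun i j => exists_abs_sub_grid_le hK (hG i j)
  refine ⟨Sum.elim qw fun ij => qG ij.1 ij.2, fun x a => ?_⟩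
  set Q' := qForm φ (fun i => ((qw i : ℝ) - m) / K)
    (Matrix.of fun i j => ((qG i j : ℝ) - m) / K) x a
  calc |qForm φ w G x a - min Q' H|
      = |min (qForm φ w G x a) H - min Q' H| := by rw [min_eq_left (hQ x a)]
    _ ≤ |qForm φ w G x a - Q'| := by
        refine (abs_min_sub_min_le_max _ _ _ _).trans (max_le le_rfl ?_)
        simp
    _ ≤ 1 / K + √(1 / K) := abs_qForm_sub_le hφ hqw hqG x a
    _ ≤ 2 / √K := one_div_add_sqrt_one_div_le (by exact_mod_cast hK)

end Cover

theorem norm_le_of_forall_abs_apply_le {X A : Type*} [Fintype X] [Fintype A] {Q : X → A → ℝ}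
    {ε : ℝ} (hε : 0 ≤ ε) (hQ : ∀ x a, |Q x a| ≤ ε) : ‖Q‖ ≤ ε :=
  (pi_norm_le_iff_of_nonneg hε).mpr fun x => (pi_norm_le_iff_of_nonneg hε).mpr (hQ x)

theorem ciInf_mem_Icc {ι : Type*} [Finite ι] [Nonempty ι] {q : ι → ℝ} {a b : ℝ}
    (hq : ∀ i, q i ∈ Set.Icc a b) : (⨅ i, q i) ∈ Set.Icc a b :=
  ⟨le_ciInf fun i => (hq i).1, (ciInf_le (Set.finite_range q).bddBelow
    (Classical.arbitrary ι)).trans (hq _).2⟩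

namespace QLearningRun

variable {X A : Type*} {H d N : ℕ} [NeZero N]
  {M : RiskMDP X A H} {φ : X → A → Fin d → ℝ} {K : ℕ} {lam β : ℝ} {Ω : Type*}
  [mΩ : MeasurableSpace Ω] {μ : Measure Ω} (R : QLearningRun M N φ K lam β μ)

/-- The feature `φ(x_h^τ, a_h^τ)` of stage `h` of episode `τ`, a regressor of the backward pass. -/
def feature (h τ : ℕ) (ω : Ω) : Fin d → ℝ := φ (R.state h τ ω) (R.action h τ ω)

/-- The error of the estimate of the transition risk at stage `h` of episode `τ`; for a fixed `Q` it
is a martingale difference in `τ`. -/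
noncomputable def noise [Fintype X] (h τ : ℕ) (ω : Ω) (Q : X → A → ℝ) : ℝ :=
  R.est h τ ω Q - M.risk N h (R.state h τ ω) (R.action h τ ω) fun y => ⨅ a, Q y a

variable [Fintype X] [Fintype A] {R} {L : ℝ} {h τ : ℕ}

namespace UsesUnbiasedEstimator

theorem abs_est_le (hR : R.UsesUnbiasedEstimator L) (hL : 0 ≤ L)
    (hτ : 1 ≤ τ) (hτK : τ ≤ K) (h1 : 1 ≤ h) (hH : h < H) (ω : Ω) {Q : X → A → ℝ}
    (hQ : ∀ x a, Q x a ∈ Set.Icc (0 : ℝ) H) : |R.est h τ ω Q| ≤ L * H := by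
  have hQnorm : ‖Q‖ ≤ H := norm_le_of_forall_abs_apply_le (Nat.cast_nonneg H) fun x a => by
    rw [abs_of_nonneg (hQ x a).1]
    exact (hQ x a).2
  calc |R.est h τ ω Q| = |R.est h τ ω Q - R.est h τ ω 0| := by
        rw [hR.zero h τ hτ hτK h1 hH, sub_zero]
    _ ≤ L * ‖Q‖ := by simpa using hR.lipschitz h τ hτ hτK h1 hH ω Q 0
    _ ≤ L * H := by gcongr

theorem measurable_noise (hR : R.UsesUnbiasedEstimator L) (hτ : 1 ≤ τ) (hτK : τ ≤ K) (h1 : 1 ≤ h)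
    (hH : h < H) (Q : X → A → ℝ) :
    Measurable[R.history τ (h + 1)] fun ω => R.noise h τ ω Q :=
  (hR.measurable h τ hτ hτK h1 hH Q).sub
    ((R.measurable_comp_state_action (fun x a => M.risk N h x a fun y => ⨅ a, Q y a)
      hτ hτK h1 hH.le).mono (R.history_stage τ h hτ hτK h1 hH) le_rfl)

variable [Nonempty A]

theorem abs_noise_le (hR : R.UsesUnbiasedEstimator L) (hL : 1 ≤ L)
    (hτ : 1 ≤ τ) (hτK : τ ≤ K) (h1 : 1 ≤ h) (hH : h < H) (ω : Ω) {Q : X → A → ℝ}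
    (hQ : ∀ x a, Q x a ∈ Set.Icc (0 : ℝ) H) : |R.noise h τ ω Q| ≤ 2 * L * H := by
  have hest := abs_le.mp (hR.abs_est_le (by linarith) hτ hτK h1 hH ω hQ)
  have hrisk := (M.isCoherent_risk (N := N) h1 hH (R.state h τ ω) (R.action h τ ω)).mem_Icc
    fun y => ciInf_mem_Icc (hQ y)
  have hLH : (H : ℝ) ≤ L * H := le_mul_of_one_le_left (Nat.cast_nonneg H) hL
  rw [noise, abs_le]
  constructor <;> linarith [hest.1, hest.2, hrisk.1, hrisk.2]

theorem abs_noise_sub_le (hR : R.UsesUnbiasedEstimator L) (hL : 1 ≤ L)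
    (hτ : 1 ≤ τ) (hτK : τ ≤ K) (h1 : 1 ≤ h) (hH : h < H) (ω : Ω) {Q Q' : X → A → ℝ}
    {ε : ℝ} (hε : 0 ≤ ε) (hQ : ∀ x a, |Q x a - Q' x a| ≤ ε) :
    |R.noise h τ ω Q - R.noise h τ ω Q'| ≤ 2 * L * ε := by
  have hest : |R.est h τ ω Q - R.est h τ ω Q'| ≤ L * ε :=
    (hR.lipschitz h τ hτ hτK h1 hH ω Q Q').trans (mul_le_mul_of_nonneg_left
      (norm_le_of_forall_abs_apply_le hε hQ) (by linarith))
  have hrisk := (M.isCoherent_risk (N := N) h1 hH (R.state h τ ω) (R.action h τ ω)).abs_sub_le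
    fun y => abs_ciInf_sub_ciInf_le (hQ y)
  have hLε : ε ≤ L * ε := le_mul_of_one_le_left hε hL
  unfold noise
  rw [abs_le] at *
  constructor <;> linarith [hest.1, hest.2, hrisk.1, hrisk.2]

theorem sqrt_quadForm_noise_le_of_abs_sub_le (hR : R.UsesUnbiasedEstimator L) (hL : 1 ≤ L) {k : ℕ}
    (hk : 1 ≤ k) (hkK : k ≤ K) (h1 : 1 ≤ h) (hH : h < H) (hlam : 0 < lam) {ω : Ω}
    {Q Q' : X → A → ℝ} (hQ : ∀ x a, |Q x a - Q' x a| ≤ 2 / √K) :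
    √(quadForm (ridge lam (fun τ => R.feature h τ ω) k)⁻¹
        (weightedSum (fun τ => R.noise h τ ω Q) (fun τ => R.feature h τ ω) k)) ≤
      √(quadForm (ridge lam (fun τ => R.feature h τ ω) k)⁻¹
        (weightedSum (fun τ => R.noise h τ ω Q') (fun τ => R.feature h τ ω) k)) + 4 * L := by
  have hK : (0 : ℝ) < K := by exact_mod_cast (by lia : 0 < K)
  set f : ℕ → Fin d → ℝ := fun τ => R.feature h τ ω
  set Δ : ℕ → ℝ := fun τ => R.noise h τ ω Q - R.noise h τ ω Q'
  have hsplit : weightedSum (fun τ => R.noise h τ ω Q) f k =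
      weightedSum (fun τ => R.noise h τ ω Q') f k + weightedSum Δ f k := by
    rw [weightedSum, weightedSum, weightedSum, ← Finset.sum_add_distrib]
    exact Finset.sum_congr rfl fun τ _ => by rw [← add_smul, add_sub_cancel]
  rw [hsplit]
  refine (sqrt_quadForm_add_le (posSemidef_ridge_inv hlam _ k) _ _).trans ?_
  gcongr
  refine Real.sqrt_le_iff.mpr
    ⟨by linarith, (quadForm_ridge_inv_weightedSum_le hlam _ k Δ).trans ?_⟩
  calc ∑ τ ∈ Finset.Ico 1 k, Δ τ ^ 2 ≤ ∑ τ ∈ Finset.Ico 1 k, (2 * L * (2 / √(K : ℝ))) ^ 2 := by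
        refine Finset.sum_le_sum fun τ hτ => ?_
        rw [Finset.mem_Ico] at hτ
        have hΔ := hR.abs_noise_sub_le hL hτ.1 (by lia) h1 hH ω (by positivity) hQ
        rw [← sq_abs]
        gcongr
    _ = ((k - 1 : ℕ) : ℝ) * ((4 * L) ^ 2 / K) := by
        rw [Finset.sum_const, Nat.card_Ico, nsmul_eq_mul,
          show 2 * L * (2 / √(K : ℝ)) = 4 * L / √K by ring, div_pow, Real.sq_sqrt hK.le]
    _ ≤ (K : ℝ) * ((4 * L) ^ 2 / K) := by
        gcongr; lia
    _ = (4 * L) ^ 2 := by field_simp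

variable [IsProbabilityMeasure μ]

theorem condExp_noise (hR : R.UsesUnbiasedEstimator L) (hL : 0 ≤ L)
    (hτ : 1 ≤ τ) (hτK : τ ≤ K) (h1 : 1 ≤ h) (hH : h < H) {Q : X → A → ℝ}
    (hQ : ∀ x a, Q x a ∈ Set.Icc (0 : ℝ) H) :
    μ[fun ω => R.noise h τ ω Q | R.history τ h] =ᵐ[μ] 0 := by
  set V : X → ℝ := fun y => ⨅ a, Q y a
  have hle := R.history_le τ h
  have hrisk := R.measurable_comp_state_action (fun x a => M.risk N h x a V) hτ hτK h1 hH.le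
  have hestInt : Integrable (fun ω => R.est h τ ω Q) μ :=
    .of_bound ((hR.measurable h τ hτ hτK h1 hH Q).mono
      (R.history_le τ (h + 1)) le_rfl).aestronglyMeasurable (L * H)
      (.of_forall fun ω => hR.abs_est_le hL hτ hτK h1 hH ω hQ)
  have hriskInt : Integrable (fun ω => M.risk N h (R.state h τ ω) (R.action h τ ω) V) μ :=
    .of_bound (hrisk.mono hle le_rfl).aestronglyMeasurable H (.of_forall fun ω => by
      have hmem := (M.isCoherent_risk (N := N) h1 hH (R.state h τ ω) (R.action h τ ω)).mem_Icc
        fun y => ciInf_mem_Icc (hQ y)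
      rw [Real.norm_of_nonneg hmem.1]
      exact hmem.2)
  filter_upwards [condExp_sub hestInt hriskInt (R.history τ h),
    hR.unbiased h τ hτ hτK h1 hH Q] with ω hsub hunb
  refine hsub.trans ?_
  rw [Pi.sub_apply, hunb, condExp_of_stronglyMeasurable hle hrisk.stronglyMeasurable hriskInt]
  exact sub_self _

theorem isBoundedMartingaleDiff_noise (hR : R.UsesUnbiasedEstimator L) (hL : 1 ≤ L)
    {k : ℕ} (hkK : k ≤ K) (h1 : 1 ≤ h) (hH : h < H) {Q : X → A → ℝ}
    (hQ : ∀ x a, Q x a ∈ Set.Icc (0 : ℝ) H) :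
    IsBoundedMartingaleDiff (fun τ => R.history τ h) (fun τ ω => R.noise h τ ω Q) k (2 * L * H)
      μ where
  le τ := R.history_le τ h
  mono τ hτ hτk := R.history_le_history_succ hτ (by lia) h1 hH.le h1 hH.le
  measurable τ hτ hτk := (hR.measurable_noise hτ (by lia) h1 hH Q).mono
    (R.history_le_history_succ hτ (by lia) (by lia) (by lia) h1 hH.le) le_rfl
  abs_le τ hτ hτk ω := hR.abs_noise_le hL hτ (by lia) h1 hH ω hQ
  condExp_eq_zero τ hτ hτk := hR.condExp_noise (by linarith) hτ (by lia) h1 hH hQ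

theorem measure_quadForm_noise_gt_le (hR : R.UsesUnbiasedEstimator L) (hL : 1 ≤ L)
    {k : ℕ} (hk : 1 ≤ k) (hkK : k ≤ K) (h1 : 1 ≤ h) (hH : h < H) (hlam : 0 < lam)
    {δ : ℝ} (hδ : 0 < δ) {Q : X → A → ℝ} (hQ : ∀ x a, Q x a ∈ Set.Icc (0 : ℝ) H) :
    μ {ω | (2 * L * H) ^ 2 * (infoGain lam (fun τ => R.feature h τ ω) k + 2 * Real.log (1 / δ)) <
        quadForm (ridge lam (fun τ => R.feature h τ ω) k)⁻¹
          (weightedSum (fun τ => R.noise h τ ω Q) (fun τ => R.feature h τ ω) k)} ≤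
      ENNReal.ofReal δ := by
  have hHpos : (0 : ℝ) < H := by exact_mod_cast (by lia : 0 < H)
  exact measure_quadForm_ridge_inv_weightedSum_gt_le
    (hR.isBoundedMartingaleDiff_noise hL hkK h1 hH hQ)
    (fun τ hτ hτk => R.measurable_comp_state_action φ hτ (by lia) h1 hH.le)
    hk (by positivity) hlam hδ

end UsesUnbiasedEstimator

end QLearningRun

theorem norm_toLp_le_mul_sqrt {d : ℕ} {v : Fin d → ℝ} {c : ℝ} (hc : 0 ≤ c) (hv : ∀ j, |v j| ≤ c) :
    ‖WithLp.toLp 2 v‖ ≤ c * √(d : ℝ) := by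
  rw [EuclideanSpace.norm_eq]
  refine Real.sqrt_le_iff.mpr ⟨by positivity, ?_⟩
  calc ∑ j, ‖v j‖ ^ 2 ≤ ∑ _j : Fin d, c ^ 2 :=
        Finset.sum_le_sum fun j _ => pow_le_pow_left₀ (norm_nonneg _) (hv j) 2
    _ = (c * √(d : ℝ)) ^ 2 := by
        rw [mul_pow, Real.sq_sqrt (Nat.cast_nonneg d), Finset.sum_const, Finset.card_univ,
          Fintype.card_fin, nsmul_eq_mul, mul_comm]

namespace RiskMDP

variable {X A : Type*} [Fintype X] {H N d : ℕ} [NeZero N] {M : RiskMDP X A H}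
  {φ : X → A → Fin d → ℝ}

/-- The right-hand side of the dynamic-programming recursion at stage `h`, for a function `V` in the
place of the value function of stage `h + 1`. The last stage has no transition and ignores `V`. -/
noncomputable def costToGo (M : RiskMDP X A H) (N : ℕ) [NeZero N] (h : ℕ) (V : X → ℝ) (x : X)
    (a : A) : ℝ :=
  M.stageCost h x a + if h < H then M.risk N h x a V else 0

theorem costToGo_of_lt {h : ℕ} (hH : h < H) (V : X → ℝ) (x : X) (a : A) :
    M.costToGo N h V x a = M.cost h x a + M.risk N h x a V := by
  rw [costToGo, if_pos hH, M.stageCost_of_lt hH]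

theorem costToGo_last (V : X → ℝ) (x : X) (a : A) : M.costToGo N H V x a = M.termCost x := by
  simp [costToGo, stageCost]

theorem costToGo_mem {h : ℕ} (h1 : 1 ≤ h) (hH : h ≤ H) {V : X → ℝ} {c : ℝ} (hc : 0 ≤ c)
    (hV : ∀ x, V x ∈ Set.Icc 0 c) (x : X) (a : A) :
    M.costToGo N h V x a ∈ Set.Icc 0 (c + 1) := by
  have hcost := M.stageCost_mem h1 hH x a
  unfold costToGo
  split_ifs with hlt
  · have hrisk := (M.isCoherent_risk (N := N) h1 hlt x a).mem_Icc hV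
    constructor <;> linarith [hcost.1, hcost.2, hrisk.1, hrisk.2]
  · constructor <;> linarith [hcost.1, hcost.2]

theorem costToGo_mono {h : ℕ} (h1 : 1 ≤ h) {V W : X → ℝ} (hVW : ∀ x, V x ≤ W x) (x : X) (a : A) :
    M.costToGo N h V x a ≤ M.costToGo N h W x a := by
  unfold costToGo
  split_ifs with hlt
  · gcongr
    exact (M.isCoherent_risk (N := N) h1 hlt x a).monotone _ _ hVW
  · rfl

theorem costToGo_sub_le_pickMean {h : ℕ} (h1 : 1 ≤ h) (hH : h < H) {V W : X → ℝ}
    (hWV : ∀ x, W x ≤ V x) (x : X) (a : A) :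
    M.costToGo N h V x a - M.costToGo N h W x a ≤
      N * pickMean N (M.kernel h x a) fun y => V y - W y := by
  have hsub := (M.isCoherent_risk (N := N) h1 hH x a).sub_le V W
  have hrisk := (M.baseRisk_coherent h h1 hH).miniBatch_le_pickMean (N := N) x (M.kernel h x a)
    fun y => sub_nonneg.mpr (hWV y)
  rw [costToGo_of_lt hH, costToGo_of_lt hH]
  unfold risk at *
  linarith

namespace IsMultipattern

theorem one_le_dim (hM : M.IsMultipattern N φ) (x : X) (a : A) : 1 ≤ d := by
  rw [Nat.one_le_iff_ne_zero]
  rintro rfl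
  simpa using (hM.simplex x a).2

theorem exists_risk_eq_dotProduct (hM : M.IsMultipattern N φ) {h : ℕ} (h1 : 1 ≤ h) (hH : h < H)
    {V : X → ℝ} {c : ℝ} (hc : 0 ≤ c) (hV : ∀ x, V x ∈ Set.Icc 0 c) :
    ∃ w : Fin d → ℝ, ‖WithLp.toLp 2 w‖ ≤ c * √(d : ℝ) ∧
      ∀ x a, M.risk N h x a V = φ x a ⬝ᵥ w := by
  obtain ⟨ρ, hρ, -, hrisk⟩ := hM.risk_patterns h h1 hH
  refine ⟨fun j => ρ j V, norm_toLp_le_mul_sqrt hc fun j => ?_, fun x a => hrisk x a V⟩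
  have hmem := (hρ j).mem_Icc hV
  rw [abs_of_nonneg hmem.1]
  exact hmem.2

theorem exists_costToGo_eq_dotProduct (hM : M.IsMultipattern N φ) {h : ℕ} (h1 : 1 ≤ h)
    (hH : h ≤ H) {V : X → ℝ} {c : ℝ} (hc : 0 ≤ c) (hV : ∀ x, V x ∈ Set.Icc 0 c) :
    ∃ w : Fin d → ℝ, ‖WithLp.toLp 2 w‖ ≤ (c + 1) * √(d : ℝ) ∧
      ∀ x a, M.costToGo N h V x a = φ x a ⬝ᵥ w := by
  obtain ⟨θ, hθ, hcost⟩ := hM.cost_linear h h1 hH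
  rcases hH.lt_or_eq with hlt | rfl
  · obtain ⟨w, hw, hrisk⟩ := hM.exists_risk_eq_dotProduct h1 hlt hc hV
    refine ⟨θ + w, ?_, fun x a => ?_⟩
    · rw [WithLp.toLp_add]
      linarith [norm_add_le (WithLp.toLp 2 θ) (WithLp.toLp 2 w)]
    · rw [costToGo, if_pos hlt, hcost, hrisk, dotProduct_add]
      rfl
  · refine ⟨θ, hθ.trans (le_mul_of_one_le_left (Real.sqrt_nonneg _) (by linarith)), fun x a => ?_⟩
    rw [costToGo, if_neg (lt_irrefl _), add_zero, hcost]
    rfl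

end IsMultipattern

end RiskMDP

theorem dotProduct_self_eq_norm_sq {d : ℕ} (v : Fin d → ℝ) :
    v ⬝ᵥ v = ‖WithLp.toLp 2 v‖ ^ 2 := by
  rw [EuclideanSpace.norm_sq_eq]
  simp only [dotProduct, Real.norm_eq_abs, sq, abs_mul_abs_self]

/-- The functions of the form of a `Q`-estimate whose coefficients are at most `m / K`, the range
covered by the grid of mesh `1 / K` indexed by `GridIndex`. -/
def HasBoundedQForm {X A : Type*} {d : ℕ} (φ : X → A → Fin d → ℝ) (K m : ℕ) (Q : X → A → ℝ) :
    Prop :=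
  ∃ (w : Fin d → ℝ) (G : Matrix (Fin d) (Fin d) ℝ),
    (∀ i, |w i| * K ≤ m) ∧ (∀ i j, |G i j| * K ≤ m) ∧ Q = qForm φ w G

namespace QLearningRun

variable {X A : Type*} {H d N : ℕ} [NeZero N]
  {M : RiskMDP X A H} {φ : X → A → Fin d → ℝ} {K : ℕ} {lam β : ℝ} {Ω : Type*}
  [mΩ : MeasurableSpace Ω] {μ : Measure Ω}

section BackwardPass

variable (R : QLearningRun M N φ K lam β μ)

/-- The function `Q_{H+1-n}^k` of the run: `n` counts the steps of the backward pass. -/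
noncomputable def qRun (k : ℕ) (ω : Ω) (n : ℕ) : X → A → ℝ :=
  qHatAux M φ lam β (fun h τ => R.state h τ ω) (fun h τ => R.policy τ ω h (R.state h τ ω))
    (fun h τ => R.est h τ ω) k n

/-- The exploration bonus `[φ(x, a)ᵀ (Λ_h^k)⁻¹ φ(x, a)]^{1/2}`, without the factor `β`. -/
noncomputable def bonus (k : ℕ) (ω : Ω) (h : ℕ) (x : X) (a : A) : ℝ :=
  √(quadForm (ridge lam (fun τ => R.feature h τ ω) k)⁻¹ (φ x a))

/-- The response of episode `τ` in the regression of stage `H - n` carried out in episode `k`. -/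
noncomputable def target (k : ℕ) (ω : Ω) (n τ : ℕ) : ℝ :=
  M.stageCost (H - n) (R.state (H - n) τ ω) (R.action (H - n) τ ω) +
    if H - n < H then R.est (H - n) τ ω (R.qRun k ω n) else 0

/-- The regression weights `w_{H-n}^k` of the run. -/
noncomputable def wRun (k : ℕ) (ω : Ω) (n : ℕ) : Fin d → ℝ :=
  ridgeEstimate lam (fun τ => R.feature (H - n) τ ω) k (R.target k ω n)

variable {k : ℕ} {ω : Ω} {n : ℕ}

theorem bonus_nonneg {h : ℕ} (x : X) (a : A) : 0 ≤ R.bonus k ω h x a := Real.sqrt_nonneg _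

theorem qRun_succ (x : X) (a : A) :
    R.qRun k ω (n + 1) x a = max (R.wRun k ω n ⬝ᵥ φ x a - β * R.bonus k ω (H - n) x a) 0 := rfl

theorem qRun_nonneg (x : X) (a : A) : 0 ≤ R.qRun k ω n x a := by
  cases n with
  | zero => exact le_rfl
  | succ n => exact le_max_right _ _

theorem qRun_succ_eq_qForm (hβ : 0 ≤ β) :
    R.qRun k ω (n + 1) = qForm φ (R.wRun k ω n)
      (β ^ 2 • (ridge lam (fun τ => R.feature (H - n) τ ω) k)⁻¹) := by
  funext x a
  rw [qRun_succ, qForm, quadForm, smul_mulVec, dotProduct_smul, smul_eq_mul,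
    Real.sqrt_mul (sq_nonneg β), Real.sqrt_sq hβ]
  rfl

theorem iInf_qRun_eq [Finite A] [Nonempty A] (hk : 1 ≤ k) (hkK : k ≤ K) (hn : n < H) (x : X) :
    ⨅ a, R.qRun k ω (n + 1) x a = R.qRun k ω (n + 1) x (R.policy k ω (H - n) x) := by
  refine le_antisymm (ciInf_le (Set.finite_range _).bddBelow _) (le_ciInf fun a => ?_)
  have hgreedy := R.greedy k (H - n) hk hkK (by lia) (by lia) ω x a
  rwa [qHat, show H + 1 - (H - n) = n + 1 by lia] at hgreedy

variable [Fintype X]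

/-- The exact cost-to-go that the regression of stage `H - n` aims at. -/
noncomputable def bellman (k : ℕ) (ω : Ω) (n : ℕ) : X → A → ℝ :=
  M.costToGo N (H - n) fun y => ⨅ a, R.qRun k ω n y a

/-- The regression of stage `H - n` in episode `k` has error at most `b` times the bonus. -/
def IsAccurate (k : ℕ) (b : ℝ) (ω : Ω) (n : ℕ) : Prop :=
  ∀ x a, |R.wRun k ω n ⬝ᵥ φ x a - R.bellman k ω n x a| ≤ b * R.bonus k ω (H - n) x a

/-- Upper bound for the gap between the value of the policy of episode `k` and its estimate with `n`
transitions to go, for errors of the backward pass of at most `C` times the bonus. The factor `N`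
converts the transition risk into an expectation over the next state. -/
noncomputable def gapBound (k : ℕ) (C : ℝ) (ω : Ω) : ℕ → X → ℝ
  | 0 => fun x => min H (C * min 1 (R.bonus k ω H x (R.policy k ω H x)))
  | n + 1 => fun x =>
      min H (C * min 1 (R.bonus k ω (H - (n + 1)) x (R.policy k ω (H - (n + 1)) x)) +
        N * pickMean N (M.kernel (H - (n + 1)) x (R.policy k ω (H - (n + 1)) x))
          (gapBound k C ω n))

theorem gapBound_mem {C : ℝ} (hC : 0 ≤ C) (x : X) :
    R.gapBound k C ω n x ∈ Set.Icc (0 : ℝ) H := by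
  have hbonus : ∀ h x a, 0 ≤ C * min 1 (R.bonus k ω h x a) := fun h x a =>
    mul_nonneg hC (le_min zero_le_one (R.bonus_nonneg x a))
  induction n generalizing x with
  | zero => exact ⟨le_min (Nat.cast_nonneg H) (hbonus _ _ _), min_le_left _ _⟩
  | succ n ih =>
    exact ⟨le_min (Nat.cast_nonneg H) (add_nonneg (hbonus _ _ _)
      (mul_nonneg (Nat.cast_nonneg N) (pickMean_mem_Icc _ ih).1)), min_le_left _ _⟩

end BackwardPass

variable [Fintype X] {R : QLearningRun M N φ K lam β μ} {k : ℕ} {ω : Ω} {b L : ℝ}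

namespace IsAccurate

theorem bellman_sub_qRun_succ_le {n : ℕ} (hacc : R.IsAccurate k b ω n) (x : X) (a : A) :
    R.bellman k ω n x a - R.qRun k ω (n + 1) x a ≤ (β + b) * R.bonus k ω (H - n) x a := by
  have herr := (abs_le.mp (hacc x a)).1
  have hmax := le_max_left (R.wRun k ω n ⬝ᵥ φ x a - β * R.bonus k ω (H - n) x a) 0
  rw [qRun_succ]
  linarith

theorem qRun_succ_le_bellman {n : ℕ} (hacc : R.IsAccurate k b ω n) (hb : b ≤ β) {x : X} {a : A}
    (hbellman : 0 ≤ R.bellman k ω n x a) : R.qRun k ω (n + 1) x a ≤ R.bellman k ω n x a := by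
  have herr := (abs_le.mp (hacc x a)).2
  have hbonus := mul_le_mul_of_nonneg_right hb (R.bonus_nonneg (k := k) (ω := ω) (h := H - n) x a)
  rw [qRun_succ]
  exact max_le (by linarith) hbellman

end IsAccurate

section Gap

variable [Nonempty A]

theorem policyValueAux_sub_iInf_qRun_le {n : ℕ} (hn : n < H) (x : X) :
    M.policyValueAux N (R.policy k ω) n x - ⨅ a, R.qRun k ω (n + 1) x a ≤ H := by
  have hpolicy := (M.policyValueAux_mem (N := N) (R.policy k ω) hn x).2
  have hq : 0 ≤ ⨅ a, R.qRun k ω (n + 1) x a := le_ciInf fun a => R.qRun_nonneg x a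
  have hnH : (n : ℝ) + 1 ≤ H := by exact_mod_cast hn
  linarith

variable [Finite A]

theorem bellman_mem {n : ℕ} (hn : n < H) (hq : ∀ x a, R.qRun k ω n x a ∈ Set.Icc (0 : ℝ) n)
    (x : X) (a : A) : R.bellman k ω n x a ∈ Set.Icc (0 : ℝ) (n + 1) :=
  M.costToGo_mem (by lia) (by lia) (Nat.cast_nonneg n) (fun y => ciInf_mem_Icc (hq y)) x a

theorem qRun_mem (hb : b ≤ β) {n : ℕ} (hn : n ≤ H) (hacc : ∀ j < n, R.IsAccurate k b ω j)
    (x : X) (a : A) : R.qRun k ω n x a ∈ Set.Icc (0 : ℝ) n := by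
  induction n generalizing x a with
  | zero => simp [qRun, qHatAux]
  | succ n ih =>
    have hbellman := R.bellman_mem hn (fun x a =>
      ih (by lia) (fun j hj => hacc j (by lia)) x a) x a
    refine ⟨R.qRun_nonneg x a, ?_⟩
    push_cast
    exact ((hacc n n.lt_succ_self).qRun_succ_le_bellman hb hbellman.1).trans hbellman.2

section Optimism

variable {n : ℕ}

theorem bellman_mem_of_forall_isAccurate (hb : b ≤ β) (hn : n < H)
    (hacc : ∀ j ≤ n, R.IsAccurate k b ω j) (x : X) (a : A) :
    R.bellman k ω n x a ∈ Set.Icc (0 : ℝ) (n + 1) :=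
  R.bellman_mem hn (R.qRun_mem hb hn.le fun j hj => hacc j hj.le) x a

theorem qRun_succ_le_bellman_of_forall_isAccurate (hb : b ≤ β) (hn : n < H)
    (hacc : ∀ j ≤ n, R.IsAccurate k b ω j) (x : X) (a : A) :
    R.qRun k ω (n + 1) x a ≤ R.bellman k ω n x a :=
  (hacc n le_rfl).qRun_succ_le_bellman hb (bellman_mem_of_forall_isAccurate hb hn hacc x a).1

theorem iInf_qRun_succ_le_optValueAux (hb : b ≤ β) (hn : n < H)
    (hacc : ∀ j ≤ n, R.IsAccurate k b ω j) (x : X) :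
    ⨅ a, R.qRun k ω (n + 1) x a ≤ M.optValueAux N n x := by
  have hle := qRun_succ_le_bellman_of_forall_isAccurate hb hn hacc x
  induction n generalizing x with
  | zero =>
    refine (ciInf_le (Set.finite_range _).bddBelow (Classical.arbitrary A)).trans
      ((hle _).trans_eq ?_)
    exact RiskMDP.costToGo_last _ x _
  | succ n ih =>
    refine ciInf_mono (Set.finite_range _).bddBelow fun a => (hle a).trans ?_
    rw [← RiskMDP.costToGo_of_lt (by lia)]
    refine RiskMDP.costToGo_mono (by lia) (fun y => ?_) x a
    have hacc' : ∀ j ≤ n, R.IsAccurate k b ω j := fun j hj => hacc j (by lia)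
    exact ih (by lia) hacc' y (qRun_succ_le_bellman_of_forall_isAccurate hb (by lia) hacc' y)

theorem bellman_sub_qRun_succ_le_mul_min (hb : b ≤ β) (hHb : H ≤ β + b) (hn : n < H)
    (hacc : ∀ j ≤ n, R.IsAccurate k b ω j) (x : X) (a : A) :
    R.bellman k ω n x a - R.qRun k ω (n + 1) x a ≤
      (β + b) * min 1 (R.bonus k ω (H - n) x a) := by
  rcases min_choice 1 (R.bonus k ω (H - n) x a) with hmin | hmin
  · have hbellman := (bellman_mem_of_forall_isAccurate hb hn hacc x a).2
    have hnH : (n : ℝ) + 1 ≤ H := by exact_mod_cast hn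
    rw [hmin]
    linarith [R.qRun_nonneg (k := k) (ω := ω) (n := n + 1) x a]
  · rw [hmin]
    exact (hacc n le_rfl).bellman_sub_qRun_succ_le x a

end Optimism

theorem policyValueAux_sub_le_gapBound (hb : b ≤ β) (hHb : H ≤ β + b) (hk : 1 ≤ k) (hkK : k ≤ K)
    {n : ℕ} (hn : n < H) (hacc : ∀ j ≤ n, R.IsAccurate k b ω j) (x : X) :
    M.policyValueAux N (R.policy k ω) n x - ⨅ a, R.qRun k ω (n + 1) x a ≤
      R.gapBound k (β + b) ω n x := by
  set π := R.policy k ω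
  have hloss := bellman_sub_qRun_succ_le_mul_min hb hHb hn hacc x (π (H - n) x)
  induction n generalizing x with
  | zero =>
    refine le_min (R.policyValueAux_sub_iInf_qRun_le hn x) ?_
    rw [R.iInf_qRun_eq hk hkK hn]
    rwa [bellman, tsub_zero, RiskMDP.costToGo_last] at hloss
  | succ n ih =>
    refine le_min (R.policyValueAux_sub_iInf_qRun_le hn x) ?_
    rw [R.iInf_qRun_eq hk hkK hn]
    have h1 : 1 ≤ H - (n + 1) := by lia
    have hH : H - (n + 1) < H := by lia
    have hacc' : ∀ j ≤ n, R.IsAccurate k b ω j := fun j hj => hacc j (by lia)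
    have hoptimism : ∀ y, ⨅ a, R.qRun k ω (n + 1) y a ≤ M.policyValueAux N π n y := fun y =>
      (iInf_qRun_succ_le_optValueAux hb (by lia) hacc' y).trans
        (M.optValueAux_le_policyValueAux π (by lia) y)
    have hnext : pickMean N (M.kernel (H - (n + 1)) x (π (H - (n + 1)) x))
        (fun y => M.policyValueAux N π n y - ⨅ a, R.qRun k ω (n + 1) y a) ≤
        pickMean N (M.kernel (H - (n + 1)) x (π (H - (n + 1)) x))
          (R.gapBound k (β + b) ω n) :=
      pickMean_mono _ fun y => ih (by lia) hacc' y
        (bellman_sub_qRun_succ_le_mul_min hb hHb (by lia) hacc' y _)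
    calc M.policyValueAux N π (n + 1) x - R.qRun k ω (n + 1 + 1) x (π (H - (n + 1)) x)
        = (M.costToGo N (H - (n + 1)) (M.policyValueAux N π n) x (π (H - (n + 1)) x) -
            R.bellman k ω (n + 1) x (π (H - (n + 1)) x)) +
          (R.bellman k ω (n + 1) x (π (H - (n + 1)) x) -
            R.qRun k ω (n + 1 + 1) x (π (H - (n + 1)) x)) := by
          rw [sub_add_sub_cancel, RiskMDP.costToGo_of_lt hH]; rfl
      _ ≤ N * pickMean N (M.kernel (H - (n + 1)) x (π (H - (n + 1)) x))
            (R.gapBound k (β + b) ω n) +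
          (β + b) * min 1 (R.bonus k ω (H - (n + 1)) x (π (H - (n + 1)) x)) :=
          add_le_add ((RiskMDP.costToGo_sub_le_pickMean h1 hH hoptimism x _).trans
            (by gcongr)) hloss
      _ = _ := add_comm _ _

theorem policyValue_sub_optValue_le_gapBound (hb : b ≤ β) (hHb : H ≤ β + b) (hk : 1 ≤ k)
    (hkK : k ≤ K) (h1H : 1 ≤ H) (hacc : ∀ n < H, R.IsAccurate k b ω n) (x : X) :
    M.policyValue N (R.policy k ω) 1 x - M.optValue N 1 x ≤ R.gapBound k (β + b) ω (H - 1) x := by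
  have hlast : H - 1 < H := by lia
  have hacc' : ∀ j ≤ H - 1, R.IsAccurate k b ω j := fun j hj => hacc j (by lia)
  exact (sub_le_sub_left (iInf_qRun_succ_le_optValueAux hb hlast hacc' x) _).trans
    (policyValueAux_sub_le_gapBound hb hHb hk hkK hlast hacc' x)

theorem isAccurate_of_sqrt_quadForm_noise_le {ε : ℝ} (hM : M.IsMultipattern N φ) (hlam : 0 < lam)
    (hε : 0 ≤ ε) {n : ℕ} (hn : n < H) (hq : ∀ x a, R.qRun k ω n x a ∈ Set.Icc (0 : ℝ) n)
    (hnoise : 0 < n → √(quadForm (ridge lam (fun τ => R.feature (H - n) τ ω) k)⁻¹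
      (weightedSum (fun τ => R.noise (H - n) τ ω (R.qRun k ω n))
        (fun τ => R.feature (H - n) τ ω) k)) ≤ ε) :
    R.IsAccurate k (ε + H * √(lam * d)) ω n := by
  intro x a
  obtain ⟨w, hw, hlin⟩ := hM.exists_costToGo_eq_dotProduct (N := N) (by lia : 1 ≤ H - n)
    (by lia) (Nat.cast_nonneg n) fun y => ciInf_mem_Icc (hq y)
  set ν : ℕ → ℝ := fun τ => if H - n < H then R.noise (H - n) τ ω (R.qRun k ω n) else 0 with hν
  have htarget : ∀ τ, R.target k ω n τ = R.feature (H - n) τ ω ⬝ᵥ w + ν τ := by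
    intro τ
    rw [feature, ← hlin, target, hν, RiskMDP.costToGo]
    simp only [noise]
    split_ifs <;> ring
  have hνε : √(quadForm (ridge lam (fun τ => R.feature (H - n) τ ω) k)⁻¹
      (weightedSum ν (fun τ => R.feature (H - n) τ ω) k)) ≤ ε := by
    rcases Nat.eq_zero_or_pos n with rfl | hpos
    · simpa [hν, weightedSum, quadForm] using hε
    · simpa only [hν, if_pos (by lia : H - n < H)] using hnoise hpos
  have hbias : √(lam * (w ⬝ᵥ w)) ≤ H * √(lam * d) := by
    have hnH : (n : ℝ) + 1 ≤ H := by exact_mod_cast hn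
    rw [dotProduct_self_eq_norm_sq, Real.sqrt_mul hlam.le, Real.sqrt_sq (norm_nonneg _),
      Real.sqrt_mul hlam.le, mul_left_comm]
    gcongr
    exact hw.trans (by gcongr)
  rw [bellman, hlin]
  refine (abs_ridgeEstimate_dotProduct_sub_le hlam _ k w (fun τ _ _ => htarget τ) (φ x a)).trans ?_
  unfold bonus
  gcongr

end Gap

section NoiseControl

variable {m n : ℕ} {ε : ℝ}

variable (R) in
/-- The accumulated noise of the first `k - 1` episodes has norm at most `ε`, at every stage and
uniformly over all functions that the backward pass can produce. -/
def NoiseControlled (k m : ℕ) (ε : ℝ) (ω : Ω) : Prop :=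
  ∀ h, 1 ≤ h → h < H → ∀ Q, HasBoundedQForm φ K m Q → (∀ x a, Q x a ≤ H) →
    √(quadForm (ridge lam (fun τ => R.feature h τ ω) k)⁻¹
      (weightedSum (fun τ => R.noise h τ ω Q) (fun τ => R.feature h τ ω) k)) ≤ ε

variable [Fintype A]

theorem abs_target_le (hR : R.UsesUnbiasedEstimator L) (hL : 0 ≤ L) (hn : n < H)
    (hq : ∀ x a, R.qRun k ω n x a ∈ Set.Icc (0 : ℝ) H) {τ : ℕ} (hτ : 1 ≤ τ) (hτK : τ ≤ K) :
    |R.target k ω n τ| ≤ 1 + L * H := by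
  have hcost : |M.stageCost (H - n) (R.state (H - n) τ ω) (R.action (H - n) τ ω)| ≤ 1 := by
    have hmem := M.stageCost_mem (by lia : 1 ≤ H - n) (by lia) (R.state (H - n) τ ω)
      (R.action (H - n) τ ω)
    rw [abs_of_nonneg hmem.1]
    exact hmem.2
  unfold target
  refine (abs_add_le _ _).trans (add_le_add hcost ?_)
  split_ifs with hlt
  · exact hR.abs_est_le hL hτ hτK (by lia) hlt ω hq
  · rw [abs_zero]; positivity

theorem hasBoundedQForm_qRun_succ (hR : R.UsesUnbiasedEstimator L) (hL : 0 ≤ L)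
    (hφ : ∀ x a, φ x a ∈ stdSimplex ℝ (Fin d)) (hlam : 0 < lam) (hβ : 0 ≤ β) (hkK : k ≤ K)
    (hm : (K * (1 + L * H) + β ^ 2) / lam * K ≤ m) (hn : n < H)
    (hq : ∀ x a, R.qRun k ω n x a ∈ Set.Icc (0 : ℝ) H) :
    HasBoundedQForm φ K m (R.qRun k ω (n + 1)) := by
  have hsq : 0 ≤ β ^ 2 / lam := by positivity
  have hlin : 0 ≤ K * (1 + L * H) / lam := by positivity
  rw [add_div] at hm
  refine ⟨R.wRun k ω n, _, fun i => ?_, fun i j => ?_, R.qRun_succ_eq_qForm hβ⟩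
  · refine le_trans ?_ hm
    gcongr
    refine le_add_of_le_of_nonneg ?_ hsq
    exact abs_ridgeEstimate_apply_le hlam
      (fun τ => dotProduct_self_le_one_of_mem_stdSimplex (hφ _ _)) (by lia) (by positivity)
      (fun τ hτ hτk => abs_target_le hR hL hn hq hτ (by lia)) i
  · refine le_trans ?_ hm
    gcongr
    refine le_add_of_nonneg_of_le hlin ?_
    rw [Matrix.smul_apply, smul_eq_mul, abs_mul, abs_of_nonneg (sq_nonneg β), ← mul_one_div]
    gcongr
    exact abs_ridge_inv_apply_le hlam _ k i j

variable [Nonempty A]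

theorem NoiseControlled.isAccurate (hctl : R.NoiseControlled k m ε ω)
    (hR : R.UsesUnbiasedEstimator L) (hL : 0 ≤ L)
    (hM : M.IsMultipattern N φ) (hlam : 0 < lam) (hε : 0 ≤ ε) (hb : ε + H * √(lam * d) ≤ β)
    (hkK : k ≤ K) (hm : (K * (1 + L * H) + β ^ 2) / lam * K ≤ m) (hn : n < H) :
    R.IsAccurate k (ε + H * √(lam * d)) ω n := by
  induction n using Nat.strong_induction_on with
  | _ n ih =>
    have hacc : ∀ j < n, R.IsAccurate k (ε + H * √(lam * d)) ω j := fun j hj => ih j hj (by lia)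
    have hmem : ∀ j ≤ n, ∀ x a, R.qRun k ω j x a ∈ Set.Icc (0 : ℝ) H := by
      intro j hj x a
      have hq := qRun_mem hb (by lia) (fun i hi => hacc i (by lia)) x a (n := j)
      exact ⟨hq.1, hq.2.trans (by exact_mod_cast (by lia : j ≤ H))⟩
    refine isAccurate_of_sqrt_quadForm_noise_le hM hlam hε hn (qRun_mem hb hn.le hacc)
      fun hpos => hctl _ (by lia) (by lia) _ ?_ fun x a => (hmem n le_rfl x a).2
    have hβ : 0 ≤ β := le_trans (by positivity) hb
    obtain ⟨j, rfl⟩ : ∃ j, n = j + 1 := ⟨n - 1, by lia⟩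
    exact hasBoundedQForm_qRun_succ hR hL hM.simplex hlam hβ hkK hm (by lia) (hmem j (by lia))

end NoiseControl

end QLearningRun

/-- High-probability bound for the sum of the transition noises of a function with values in
`[0, H]` over `K` episodes. -/
noncomputable def transitionRadius (H K : ℕ) (δ : ℝ) : ℝ :=
  H * √((K + 1) * (Real.log (1 + K) + 2 * Real.log (1 / δ)))

/-- High-probability bound for the norm of the accumulated estimation noise. The summand `4 * L`
pays for the replacement of a function by its nearest neighbour in the grid. -/
noncomputable def noiseRadius (L : ℝ) (H d K : ℕ) (lam δ : ℝ) : ℝ :=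
  √((2 * L * H) ^ 2 * (d * Real.log (1 + K / lam) + 2 * Real.log (1 / δ))) + 4 * L

namespace QLearningRun

variable {X A : Type*} {H d N : ℕ} [NeZero N]
  {M : RiskMDP X A H} {φ : X → A → Fin d → ℝ} {K : ℕ} {lam β : ℝ} {Ω : Type*}
  [mΩ : MeasurableSpace Ω] {μ : Measure Ω} (R : QLearningRun M N φ K lam β μ)

variable {R} in
theorem sum_bonus_le (hφ : ∀ x a, φ x a ∈ stdSimplex ℝ (Fin d)) (hlam : 0 < lam) {C : ℝ}
    (hC : 0 ≤ C) (h : ℕ) (ω : Ω) :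
    ∑ k ∈ Finset.Icc 1 K, C * min 1 (R.bonus k ω h (R.state h k ω) (R.action h k ω)) ≤
      C * √(K * (d * Real.log (1 + K / lam) / Real.log 2)) := by
  rw [← Finset.mul_sum]
  gcongr
  have hsum := sum_min_one_sqrt_quadForm_ridge_inv_le hlam
    (f := fun τ => R.feature h τ ω)
    (fun τ => dotProduct_self_le_one_of_mem_stdSimplex (hφ _ _)) K
  rwa [Fintype.card_fin] at hsum

section Measurability

variable [Finite X]

theorem measurable_apply_state_succ {k h : ℕ} (hk : 1 ≤ k) (hkK : k ≤ K) (h1 : 1 ≤ h)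
    (hH : h < H) {W : Ω → X → ℝ} (hW : ∀ x, Measurable[R.history k h] fun ω => W ω x) :
    Measurable[R.history k (h + 1)] fun ω => W ω (R.state (h + 1) k ω) :=
  measurable_eval_of_countable (R.measurable_state hk hkK (by lia) hH)
    (F := fun x ω => W ω x) fun x => (hW x).mono (R.history_stage k h hk hkK h1 hH) le_rfl

variable [Finite A]

theorem measurable_bonus {k h : ℕ} (hkK : k ≤ K) (h1 : 1 ≤ h) (hH : h ≤ H) (x : X)
    (a : A) : Measurable[R.history k 1] fun ω => R.bonus k ω h x a :=
  Real.continuous_sqrt.measurable.comp (measurable_dotProduct_ridge_inv_mulVec lam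
    (fun _ hτ hτk => (R.measurable_comp_state_action φ hτ (by lia) h1 hH).mono
      ((R.history_le_history_succ hτ (by lia) h1 hH le_rfl (by lia)).trans
        (R.history_episode_mono (by lia) hτk hkK le_rfl (by lia))) le_rfl)
    measurable_const measurable_const)

theorem measurable_bonus_policy {k h : ℕ} (hk : 1 ≤ k) (hkK : k ≤ K) (h1 : 1 ≤ h) (hH : h ≤ H)
    (x : X) : Measurable[R.history k 1] fun ω => R.bonus k ω h x (R.policy k ω h x) :=
  measurable_eval_of_countable (R.policy_measurable k h hk hkK h1 hH x)
    (F := fun a ω => R.bonus k ω h x a) fun a => R.measurable_bonus hkK h1 hH x a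

end Measurability

variable [Fintype X]

section TransitionNoise

/-- The deviation of a function `W k ω` of the state reached from stage `h` of episode `k` from its
conditional expectation. -/
noncomputable def transitionNoise (h : ℕ) (W : ℕ → Ω → X → ℝ) (k : ℕ) (ω : Ω) : ℝ :=
  pickMean N (M.kernel h (R.state h k ω) (R.action h k ω)) (W k ω) - W k ω (R.state (h + 1) k ω)

theorem measurable_pickMean_kernel [Finite A] {k h : ℕ} (hk : 1 ≤ k) (hkK : k ≤ K) (h1 : 1 ≤ h)
    (hH : h ≤ H) {W : Ω → X → ℝ} (hW : ∀ x, Measurable[R.history k h] fun ω => W ω x) :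
    Measurable[R.history k h] fun ω =>
      pickMean N (M.kernel h (R.state h k ω) (R.action h k ω)) (W ω) :=
  measurable_eval_of_countable (R.measurable_state hk hkK h1 hH)
    (F := fun x ω => pickMean N (M.kernel h x (R.action h k ω)) (W ω)) fun x =>
      measurable_eval_of_countable (R.measurable_action hk hkK h1 hH)
        (F := fun a ω => pickMean N (M.kernel h x a) (W ω)) fun _ =>
          Finset.measurable_fun_sum _ fun _ _ => Finset.measurable_fun_sum _ fun _ _ =>
            (hW _).const_mul _

variable {R} {h : ℕ} {W : ℕ → Ω → X → ℝ} {c : ℝ}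

theorem abs_transitionNoise_le (hWc : ∀ k ω x, W k ω x ∈ Set.Icc 0 c) (k : ℕ) (ω : Ω) :
    |R.transitionNoise h W k ω| ≤ c := by
  have hmean := pickMean_mem_Icc (N := N) (M.kernel h (R.state h k ω) (R.action h k ω)) (hWc k ω)
  have hnext := hWc k ω (R.state (h + 1) k ω)
  rw [transitionNoise, abs_le]
  constructor <;> linarith [hmean.1, hmean.2, hnext.1, hnext.2]

variable [IsProbabilityMeasure μ] [Finite A]

theorem condExp_transitionNoise {k : ℕ} (hk : 1 ≤ k) (hkK : k ≤ K) (h1 : 1 ≤ h) (hH : h < H)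
    (hW : ∀ x, Measurable[R.history k h] fun ω => W k ω x)
    (hWc : ∀ ω x, W k ω x ∈ Set.Icc 0 c) :
    μ[R.transitionNoise h W k | R.history k h] =ᵐ[μ] 0 := by
  have hle := R.history_le k h
  have hmean := R.measurable_pickMean_kernel hk hkK h1 hH.le hW
  have hmeanInt : Integrable
      (fun ω => pickMean N (M.kernel h (R.state h k ω) (R.action h k ω)) (W k ω)) μ :=
    .of_bound (hmean.mono hle le_rfl).aestronglyMeasurable c (.of_forall fun ω => by
      have hmem := pickMean_mem_Icc (N := N) (M.kernel h (R.state h k ω) (R.action h k ω)) (hWc ω)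
      rw [Real.norm_of_nonneg hmem.1]
      exact hmem.2)
  have hnextInt : Integrable (fun ω => W k ω (R.state (h + 1) k ω)) μ :=
    .of_bound ((R.measurable_apply_state_succ hk hkK h1 hH hW).mono (R.history_le _ _)
      le_rfl).aestronglyMeasurable c (.of_forall fun ω => by
        rw [Real.norm_of_nonneg (hWc ω _).1]
        exact (hWc ω _).2)
  filter_upwards [condExp_sub hmeanInt hnextInt (R.history k h),
    R.condExp_state_next hk hkK h1 hH (W := W k) hW (C := c) fun ω x => by
      rw [abs_of_nonneg (hWc ω x).1]; exact (hWc ω x).2] with ω hsub hnext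
  refine hsub.trans ?_
  rw [Pi.sub_apply, hnext, condExp_of_stronglyMeasurable hle hmean.stronglyMeasurable hmeanInt]
  exact sub_self _

-- The histories are only known to increase up to episode `K`; beyond it the filtration is constant.
theorem isBoundedMartingaleDiff_transitionNoise (h1 : 1 ≤ h) (hH : h < H)
    (hW : ∀ k, 1 ≤ k → k ≤ K → ∀ x, Measurable[R.history k h] fun ω => W k ω x)
    (hWc : ∀ k ω x, W k ω x ∈ Set.Icc 0 c) :
    IsBoundedMartingaleDiff (fun k => if k ≤ K then R.history k h else mΩ)
      (R.transitionNoise h W) (K + 1) c μ := by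
  have hsucc : ∀ k, 1 ≤ k → k < K + 1 →
      R.history k (h + 1) ≤ if k + 1 ≤ K then R.history (k + 1) h else mΩ := by
    intro k hk hkK
    split_ifs with hlt
    · exact R.history_le_history_succ hk (by lia) (by lia) hH h1 hH.le
    · exact R.history_le k (h + 1)
  refine ⟨fun k => ?_, fun k hk hkK => ?_, fun k hk hkK => ?_,
    fun k _ _ ω => abs_transitionNoise_le hWc k ω, fun k hk hkK => ?_⟩
  · split_ifs
    exacts [R.history_le k h, le_rfl]
  · rw [if_pos (by lia)]
    exact (R.history_stage k h hk (by lia) h1 hH).trans (hsucc k hk hkK)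
  · have hWk := hW k hk (by lia)
    exact (((R.measurable_pickMean_kernel hk (by lia) h1 hH.le hWk).mono
      (R.history_stage k h hk (by lia) h1 hH) le_rfl).sub
        (R.measurable_apply_state_succ hk (by lia) h1 hH hWk)).mono (hsucc k hk hkK) le_rfl
  · rw [if_pos (by lia)]
    exact condExp_transitionNoise hk (by lia) h1 hH (hW k hk (by lia)) (hWc k)

end TransitionNoise

section GapNoise

/-- The transition noise of the gap bound with `n` transitions to go. -/
noncomputable def gapNoise (C : ℝ) (n : ℕ) : ℕ → Ω → ℝ :=
  R.transitionNoise (H - (n + 1)) fun k ω => R.gapBound k C ω n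

theorem sum_gapBound_succ_le {C : ℝ} {n : ℕ} (hn : n + 1 < H) (ω : Ω) :
    ∑ k ∈ Finset.Icc 1 K, R.gapBound k C ω (n + 1) (R.state (H - (n + 1)) k ω) ≤
      ∑ k ∈ Finset.Icc 1 K, C * min 1 (R.bonus k ω (H - (n + 1)) (R.state (H - (n + 1)) k ω)
        (R.action (H - (n + 1)) k ω)) +
      N * (∑ k ∈ Finset.Icc 1 K, R.gapNoise C n k ω +
        ∑ k ∈ Finset.Icc 1 K, R.gapBound k C ω n (R.state (H - n) k ω)) := by
  rw [← Finset.sum_add_distrib, Finset.mul_sum, ← Finset.sum_add_distrib]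
  refine Finset.sum_le_sum fun k _ => (min_le_right _ _).trans_eq ?_
  rw [gapNoise, transitionNoise, show H - (n + 1) + 1 = H - n by lia, sub_add_cancel]
  rfl

variable {R} in
theorem sum_gapBound_le (hφ : ∀ x a, φ x a ∈ stdSimplex ℝ (Fin d)) (hlam : 0 < lam) {C Z : ℝ}
    (hC : 0 ≤ C) (hZ : 0 ≤ Z) {ω : Ω}
    (hdev : ∀ n, n + 1 < H → ∑ k ∈ Finset.Icc 1 K, R.gapNoise C n k ω ≤ Z) {n : ℕ} (hn : n < H) :
    ∑ k ∈ Finset.Icc 1 K, R.gapBound k C ω n (R.state (H - n) k ω) ≤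
      (n + 1) * (N : ℝ) ^ n * (C * √(K * (d * Real.log (1 + K / lam) / Real.log 2)) + Z) := by
  set E := C * √(K * (d * Real.log (1 + K / lam) / Real.log 2))
  have : 0 ≤ E := by positivity
  have hN : (1 : ℝ) ≤ N := by exact_mod_cast NeZero.one_le
  induction n with
  | zero =>
    calc ∑ k ∈ Finset.Icc 1 K, R.gapBound k C ω 0 (R.state H k ω)
        ≤ E := (Finset.sum_le_sum fun k _ => min_le_right _ _).trans
          (sum_bonus_le hφ hlam hC H ω)
      _ ≤ (((0 : ℕ) : ℝ) + 1) * (N : ℝ) ^ 0 * (E + Z) := by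
          simpa using hZ
  | succ n ih =>
    calc ∑ k ∈ Finset.Icc 1 K, R.gapBound k C ω (n + 1) (R.state (H - (n + 1)) k ω)
        ≤ E + N * (Z + (n + 1) * (N : ℝ) ^ n * (E + Z)) := by
          refine (R.sum_gapBound_succ_le hn ω).trans ?_
          gcongr
          exacts [sum_bonus_le hφ hlam hC _ ω, hdev n hn, ih (by lia)]
      _ = 1 * E + N * Z + (n + 1) * (N : ℝ) ^ (n + 1) * (E + Z) := by ring
      _ ≤ (N : ℝ) ^ (n + 1) * E + (N : ℝ) ^ (n + 1) * Z +
          (n + 1) * (N : ℝ) ^ (n + 1) * (E + Z) := by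
          gcongr
          exacts [one_le_pow₀ hN, le_self_pow₀ hN n.succ_ne_zero]
      _ = (((n + 1 : ℕ) : ℝ) + 1) * (N : ℝ) ^ (n + 1) * (E + Z) := by push_cast; ring

variable [Finite A]

theorem measurable_gapBound (C : ℝ) {k n : ℕ} (hk : 1 ≤ k) (hkK : k ≤ K) (hn : n < H) (x : X) :
    Measurable[R.history k 1] fun ω => R.gapBound k C ω n x := by
  induction n generalizing x with
  | zero =>
    exact measurable_const.min ((measurable_const.min
      (R.measurable_bonus_policy hk hkK (by lia) le_rfl x)).const_mul C)
  | succ n ih =>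
    have hmean : Measurable[R.history k 1] fun ω => pickMean N
        (M.kernel (H - (n + 1)) x (R.policy k ω (H - (n + 1)) x)) (R.gapBound k C ω n) :=
      measurable_eval_of_countable (R.policy_measurable k _ hk hkK (by lia) (by lia) x)
        (F := fun a ω => pickMean N (M.kernel (H - (n + 1)) x a) (R.gapBound k C ω n)) fun _ =>
          Finset.measurable_fun_sum _ fun _ _ => Finset.measurable_fun_sum _ fun _ _ =>
            (ih (by lia) _).const_mul _
    exact measurable_const.min (((measurable_const.min
      (R.measurable_bonus_policy hk hkK (by lia) (by lia) x)).const_mul C).add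
        (hmean.const_mul _))

variable [IsProbabilityMeasure μ]

theorem isBoundedMartingaleDiff_gapNoise {C : ℝ} (hC : 0 ≤ C) {n : ℕ} (hn : n + 1 < H) :
    IsBoundedMartingaleDiff (fun k => if k ≤ K then R.history k (H - (n + 1)) else mΩ)
      (R.gapNoise C n) (K + 1) H μ :=
  isBoundedMartingaleDiff_transitionNoise (by lia) (by lia)
    (fun _ hk hkK x => (R.measurable_gapBound C hk hkK (by lia) x).mono
      (R.history_stage_mono hk hkK le_rfl (by lia) (by lia)) le_rfl)
    fun _ _ x => R.gapBound_mem hC x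

theorem measure_exists_sum_gapNoise_gt_le {C : ℝ} (hC : 0 ≤ C) {δ : ℝ} (hδ : 0 < δ) :
    μ {ω | ∃ n, n + 1 < H ∧ transitionRadius H K δ < ∑ k ∈ Finset.Icc 1 K, R.gapNoise C n k ω} ≤
      ENNReal.ofReal (H * δ) := by
  calc _ ≤ μ (⋃ n ∈ Finset.range (H - 1),
          {ω | transitionRadius H K δ < ∑ k ∈ Finset.Icc 1 K, R.gapNoise C n k ω}) := by
        refine measure_mono fun ω ⟨n, hn, hgt⟩ => ?_
        exact Set.mem_biUnion (Finset.mem_coe.mpr (Finset.mem_range.mpr (by lia : n < H - 1))) hgt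
    _ ≤ ∑ _n ∈ Finset.range (H - 1), ENNReal.ofReal δ := by
        refine (measure_biUnion_finset_le _ _).trans (Finset.sum_le_sum fun _ hn => ?_)
        rw [Finset.mem_range] at hn
        exact measure_sum_gt_le (R.isBoundedMartingaleDiff_gapNoise hC (by lia))
          (by exact_mod_cast (by lia : 0 < H)) hδ
    _ ≤ ENNReal.ofReal (H * δ) := by
        rw [Finset.sum_const, Finset.card_range, ← ENNReal.ofReal_nsmul, nsmul_eq_mul]
        gcongr
        lia

end GapNoise

variable {R} [Fintype A] [Nonempty A]

theorem noiseControlled_of_forall_gridQ {L δ : ℝ} (hR : R.UsesUnbiasedEstimator L) (hL : 1 ≤ L)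
    (hφ : ∀ x a, φ x a ∈ stdSimplex ℝ (Fin d)) (hlam : 0 < lam) {k m : ℕ} (hk : 1 ≤ k)
    (hkK : k ≤ K) {ω : Ω}
    (hgrid : ∀ h, 1 ≤ h → h < H → ∀ q : GridIndex (Fin d) m,
      quadForm (ridge lam (fun τ => R.feature h τ ω) k)⁻¹
        (weightedSum (fun τ => R.noise h τ ω (gridQ φ H K q)) (fun τ => R.feature h τ ω) k) ≤
      (2 * L * H) ^ 2 * (infoGain lam (fun τ => R.feature h τ ω) k + 2 * Real.log (1 / δ))) :
    R.NoiseControlled k m (noiseRadius L H d K lam δ) ω := by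
  rintro h h1 hH _ ⟨w, G, hw, hG, rfl⟩ hQ
  obtain ⟨q, hq⟩ := exists_abs_qForm_sub_gridQ_le hφ (by lia) hw hG hQ
  refine (hR.sqrt_quadForm_noise_le_of_abs_sub_le hL hk hkK h1 hH hlam hq).trans ?_
  unfold noiseRadius
  gcongr
  refine (hgrid h h1 hH q).trans ?_
  gcongr
  simpa only [Fintype.card_fin] using infoGain_le hlam (f := fun τ => R.feature h τ ω)
    (fun τ => dotProduct_self_le_one_of_mem_stdSimplex (hφ _ _)) (by lia)

theorem regret_le_of_noiseControlled {L ε Z : ℝ} {m : ℕ} {ω : Ω} (hR : R.UsesUnbiasedEstimator L)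
    (hL : 0 ≤ L) (hM : M.IsMultipattern N φ) (hH : 1 ≤ H) (hlam : 0 < lam) (hε : 0 ≤ ε)
    (hb : ε + H * √(lam * d) ≤ β) (hHβ : H ≤ β) (hm : (K * (1 + L * H) + β ^ 2) / lam * K ≤ m)
    (hctl : ∀ k ∈ Finset.Icc 1 K, R.NoiseControlled k m ε ω) (hZ : 0 ≤ Z)
    (hdev : ∀ n, n + 1 < H →
      ∑ k ∈ Finset.Icc 1 K, R.gapNoise (β + (ε + H * √(lam * d))) n k ω ≤ Z) :
    R.regret ω ≤ H * (N : ℝ) ^ H * ((β + (ε + H * √(lam * d))) *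
      √(K * (d * Real.log (1 + K / lam) / Real.log 2)) + Z) := by
  set b := ε + H * √(lam * d)
  have hb0 : 0 ≤ b := by positivity
  have hβ : 0 ≤ β := hb0.trans hb
  have hsum := sum_gapBound_le hM.simplex hlam (add_nonneg hβ hb0) hZ hdev (by lia : H - 1 < H)
  rw [Nat.sub_sub_self hH, Nat.cast_sub hH, Nat.cast_one, sub_add_cancel] at hsum
  calc R.regret ω ≤ ∑ k ∈ Finset.Icc 1 K, R.gapBound k (β + b) ω (H - 1) (R.state 1 k ω) := by
        refine Finset.sum_le_sum fun k hk => ?_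
        obtain ⟨h1k, hkK⟩ := Finset.mem_Icc.mp hk
        exact policyValue_sub_optValue_le_gapBound hb (by linarith) h1k hkK hH
          (fun n hn => (hctl k hk).isAccurate hR hL hM hlam hε hb hkK hm hn) _
    _ ≤ _ := hsum
    _ ≤ _ := by
        gcongr
        exacts [by exact_mod_cast NeZero.one_le, Nat.sub_le H 1]

variable [IsProbabilityMeasure μ]

theorem measure_exists_not_noiseControlled_le {L δ : ℝ} (hR : R.UsesUnbiasedEstimator L)
    (hL : 1 ≤ L) (hφ : ∀ x a, φ x a ∈ stdSimplex ℝ (Fin d)) (hlam : 0 < lam) (hδ : 0 < δ) (m : ℕ) :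
    μ {ω | ∃ k ∈ Finset.Icc 1 K, ¬ R.NoiseControlled k m (noiseRadius L H d K lam δ) ω} ≤
      ENNReal.ofReal (H * K * (2 * m + 1) ^ (d + d * d) * δ) := by
  set bad : ℕ → ℕ → GridIndex (Fin d) m → Set Ω := fun h k q =>
    {ω | (2 * L * H) ^ 2 * (infoGain lam (fun τ => R.feature h τ ω) k + 2 * Real.log (1 / δ)) <
      quadForm (ridge lam (fun τ => R.feature h τ ω) k)⁻¹
        (weightedSum (fun τ => R.noise h τ ω (gridQ φ H K q)) (fun τ => R.feature h τ ω) k)}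
    with hbad
  calc _ ≤ μ (⋃ h ∈ Finset.Ico 1 H, ⋃ k ∈ Finset.Icc 1 K, ⋃ q ∈ Finset.univ, bad h k q) := by
        refine measure_mono fun ω ⟨k, hk, hnot⟩ => ?_
        by_contra hgood
        simp only [Set.mem_iUnion, not_exists, hbad, Set.mem_ofPred_eq, not_lt] at hgood
        obtain ⟨h1k, hkK⟩ := Finset.mem_Icc.mp hk
        exact hnot (noiseControlled_of_forall_gridQ hR hL hφ hlam h1k hkK fun h h1 hH q =>
          hgood h (Finset.mem_Ico.mpr ⟨h1, hH⟩) k hk q (Finset.mem_univ q))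
    _ ≤ ∑ _h ∈ Finset.Ico 1 H, ∑ _k ∈ Finset.Icc 1 K, ∑ _q : GridIndex (Fin d) m,
          ENNReal.ofReal δ := by
        refine (measure_biUnion_finset_le _ _).trans (Finset.sum_le_sum fun h hh => ?_)
        refine (measure_biUnion_finset_le _ _).trans (Finset.sum_le_sum fun k hk => ?_)
        refine (measure_biUnion_finset_le _ _).trans (Finset.sum_le_sum fun q _ => ?_)
        rw [Finset.mem_Ico] at hh
        rw [Finset.mem_Icc] at hk
        exact hR.measure_quadForm_noise_gt_le hL hk.1 hk.2 hh.1 hh.2 hlam hδ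
          (gridQ_mem_Icc φ H K q)
    _ = ENNReal.ofReal ((H - 1 : ℕ) * (K * ((2 * m + 1) ^ (d + d * d) * δ))) := by
        simp only [Finset.sum_const, ← ENNReal.ofReal_nsmul]
        congr 1
        simp
    _ ≤ _ := by
        rw [mul_assoc, mul_assoc]
        gcongr
        exact Nat.sub_le H 1

theorem measure_regret_gt_le {L p : ℝ} {m : ℕ} {δ δ' b : ℝ} (hR : R.UsesUnbiasedEstimator L)
    (hL : 1 ≤ L) (hM : M.IsMultipattern N φ) (hH : 1 ≤ H) (hK : 1 ≤ K) (hlam : 0 < lam)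
    (hp : 0 < p) (hδ : δ = p / (2 * H * K * (2 * m + 1) ^ (d + d * d))) (hδ' : δ' = p / (2 * H))
    (hb : b = noiseRadius L H d K lam δ + H * √(lam * d)) (hbβ : b ≤ β) (hHβ : H ≤ β)
    (hm : (K * (1 + L * H) + β ^ 2) / lam * K ≤ m) :
    μ {ω | H * (N : ℝ) ^ H * ((β + b) * √(K * (d * Real.log (1 + K / lam) / Real.log 2)) +
        transitionRadius H K δ') < R.regret ω} ≤ ENNReal.ofReal p := by
  have hHpos : (0 : ℝ) < H := by exact_mod_cast hH
  have : (0 : ℝ) < K := by exact_mod_cast hK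
  have hε : 0 ≤ noiseRadius L H d K lam δ := by unfold noiseRadius; positivity
  have hC : 0 ≤ β + b := by rw [hb]; have := hHpos.le.trans hHβ; positivity
  calc _ ≤ μ ({ω | ∃ k ∈ Finset.Icc 1 K, ¬ R.NoiseControlled k m (noiseRadius L H d K lam δ) ω} ∪
          {ω | ∃ n, n + 1 < H ∧ transitionRadius H K δ' <
            ∑ k ∈ Finset.Icc 1 K, R.gapNoise (β + b) n k ω}) := by
        refine measure_mono fun ω hω => ?_
        by_contra hgood
        simp only [Set.mem_union, Set.mem_ofPred_eq, not_or, not_exists, not_and, not_not,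
          not_lt] at hgood hω
        obtain ⟨hctl, hdev⟩ := hgood
        subst hb
        exact absurd hω (not_lt.mpr (regret_le_of_noiseControlled hR (by linarith) hM hH hlam hε
          hbβ hHβ hm hctl (by unfold transitionRadius; positivity) hdev))
    _ ≤ ENNReal.ofReal (p / 2) + ENNReal.ofReal (p / 2) := by
        refine (measure_union_le _ _).trans (add_le_add ?_ ?_)
        · refine (measure_exists_not_noiseControlled_le hR hL hM.simplex hlam
            (by rw [hδ]; positivity) m).trans_eq ?_
          rw [hδ]
          congr 1
          field_simp
        · refine (R.measure_exists_sum_gapNoise_gt_le hC (by rw [hδ']; positivity)).trans_eq ?_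
          rw [hδ']
          congr 1
          field_simp
    _ = ENNReal.ofReal p := by
        rw [← ENNReal.ofReal_add (by positivity) (by positivity), add_halves]

end QLearningRun

section Constants

/-- The ratio of the width of the confidence sets to `d * H * √Γ` when the bonus is scaled by
`c * d * H * √Γ`. -/
noncomputable def widthConst (B L c : ℝ) : ℝ :=
  2 * L * √(20 + 5 * B + 8 * Real.log (2 * L + 2 * c ^ 2 + 3)) + 8 * L + 2 * B

variable {B L c : ℝ}

theorem widthConst_nonneg (hB : 0 ≤ B) (hL : 0 ≤ L) : 0 ≤ widthConst B L c := by
  unfold widthConst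
  positivity

theorem log_quadratic_le (hL : 0 ≤ L) (hc : 1 ≤ c) :
    Real.log (2 * L + 2 * c ^ 2 + 3) ≤ 2 * L + 5 + 2 * c := by
  calc Real.log (2 * L + 2 * c ^ 2 + 3) ≤ Real.log ((2 * L + 5) * c ^ 2) :=
        Real.log_le_log (by positivity) (by nlinarith [one_le_pow₀ hc (n := 2)])
    _ = Real.log (2 * L + 5) + 2 * Real.log c := by
        rw [Real.log_mul (by positivity) (by positivity), Real.log_pow, Nat.cast_ofNat]
    _ ≤ 2 * L + 5 + 2 * c := by
        gcongr <;> exact Real.log_le_self (by positivity)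

theorem widthConst_sq_le (hB : 0 ≤ B) (hL : 0 ≤ L) {t : ℝ} (ht : 1 ≤ t) :
    widthConst B L (t ^ 2) ≤ (2 * L * (5 * B + 16 * L + 76) + 8 * L + 2 * B) * t := by
  set D := 5 * B + 16 * L + 76 with hD
  have hD1 : 1 ≤ D := by rw [hD]; linarith
  have ht2 : 1 ≤ t ^ 2 := one_le_pow₀ ht
  have hsqrt : √(20 + 5 * B + 8 * Real.log (2 * L + 2 * (t ^ 2) ^ 2 + 3)) ≤ D * t := by
    refine Real.sqrt_le_iff.mpr ⟨by positivity, ?_⟩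
    calc _ ≤ (5 * B + 16 * L + 60) * 1 + 16 * t ^ 2 := by linarith [log_quadratic_le hL ht2]
      _ ≤ (5 * B + 16 * L + 60) * t ^ 2 + 16 * t ^ 2 := by gcongr
      _ = D * t ^ 2 := by ring
      _ ≤ D ^ 2 * t ^ 2 := by gcongr; exact le_self_pow₀ hD1 two_ne_zero
      _ = (D * t) ^ 2 := by ring
  calc widthConst B L (t ^ 2) ≤ 2 * L * (D * t) + 8 * L * t + 2 * B * t := by
        unfold widthConst
        refine add_le_add (add_le_add (by gcongr) ?_) ?_ <;>
          exact le_mul_of_one_le_right (by positivity) ht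
    _ = _ := by ring

-- The width grows only like `√(log c)`, so it is dominated by `c`.
theorem exists_const_dominating_width (hB : 1 ≤ B) (hL : 1 ≤ L) :
    ∃ c : ℝ, 2 ≤ c ∧ 7 * widthConst B L c + 20 * B ≤ c := by
  set F := 2 * L * (5 * B + 16 * L + 76) + 8 * L + 2 * B
  have hF : 0 ≤ F := by positivity
  set t := 7 * F + 20 * B with ht
  have : 2 ≤ t := by linarith
  refine ⟨t ^ 2, by nlinarith, ?_⟩
  calc 7 * widthConst B L (t ^ 2) + 20 * B ≤ 7 * (F * t) + 20 * B * t := by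
        gcongr ?_ + ?_
        · gcongr
          exact widthConst_sq_le (by positivity) (by positivity) (by linarith)
        · exact le_mul_of_one_le_right (by positivity) (by linarith)
    _ = t ^ 2 := by rw [ht]; ring

end Constants

section Width

variable {B L c p lam Γ : ℝ} {d K H : ℕ}

theorem log_le_of_mul_le {p x y : ℝ} (hp : 0 < p) (hx : 0 < x) (hxy : x * p ≤ y) :
    Real.log x ≤ Real.log (y / p) :=
  Real.log_le_log hx ((le_div_iff₀ hp).mpr hxy)

theorem one_le_two_mul_sqrt (hΓ : Real.log 2 ≤ Γ) : 1 ≤ 2 * √Γ := by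
  have : 1 / 2 ≤ √Γ := Real.le_sqrt_of_sq_le (by linarith [Real.log_two_gt_d9])
  linarith

theorem log_one_add_div_le (hB : 0 ≤ B) (hΓ : Real.log 2 ≤ Γ) (hK : K ≤ Real.exp Γ)
    (hlam : 0 < lam) (hlog : Real.log (1 / lam) ≤ B * Γ) :
    Real.log (1 + K / lam) ≤ (2 + B) * Γ := by
  have hΓ0 : 0 ≤ Γ := (Real.log_nonneg one_le_two).trans hΓ
  have hratio : K / lam ≤ Real.exp (Γ + B * Γ) := by
    rw [Real.exp_add, div_eq_mul_one_div]
    gcongr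
    exact (Real.log_le_iff_le_exp (by positivity)).mp hlog
  have hbound : 1 + K / lam ≤ 2 * Real.exp (Γ + B * Γ) := by
    linarith [Real.one_le_exp (x := Γ + B * Γ) (by positivity)]
  calc Real.log (1 + K / lam) ≤ Real.log (2 * Real.exp (Γ + B * Γ)) :=
        Real.log_le_log (by positivity) hbound
    _ = Real.log 2 + (Γ + B * Γ) := by rw [Real.log_mul two_ne_zero (by positivity), Real.log_exp]
    _ ≤ (2 + B) * Γ := by linarith

theorem gridNumerator_le (hL : 0 ≤ L) (hΓ : 0 ≤ Γ) {d K H z : ℝ} (hd : 1 ≤ d) (hK : 1 ≤ K)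
    (hH : 1 ≤ H) (hL1 : 1 ≤ L * H) (hz : 1 ≤ z) (hΓz : Γ ≤ z) (hprod : 2 * d * K * H ≤ z) :
    K * (1 + L * H) + (c * d * H * √Γ) ^ 2 ≤ (L + c ^ 2) * z ^ 3 := by
  have hKH : 2 * (K * H) ≤ z := by nlinarith [(by positivity : 0 < K * H)]
  have hdH : d * H ≤ z := by nlinarith [(by positivity : 0 < d * H)]
  calc K * (1 + L * H) + (c * d * H * √Γ) ^ 2
      ≤ K * (L * H + L * H) + c ^ 2 * ((d * H) ^ 2 * Γ) := by
        gcongr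
        rw [mul_pow, Real.sq_sqrt hΓ]
        exact le_of_eq (by ring)
    _ = L * (2 * (K * H)) + c ^ 2 * ((d * H) ^ 2 * Γ) := by ring
    _ ≤ L * z + c ^ 2 * (z ^ 2 * z) := by gcongr
    _ ≤ L * z ^ 3 + c ^ 2 * (z ^ 2 * z) := by gcongr; exact le_self_pow₀ hz (by norm_num)
    _ = _ := by ring

theorem log_two_mul_add_one_le (hB : 0 ≤ B) (hL : 1 ≤ L) (hd : 1 ≤ d) (hK : 1 ≤ K) (hH : 1 ≤ H)
    (hΓ : 0 ≤ Γ) (hprod : 2 * d * K * H ≤ Real.exp Γ) (hlam : 0 < lam)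
    (hlog : Real.log (1 / lam) ≤ B * Γ) {m : ℝ} (hm0 : 0 ≤ m)
    (hm : m ≤ (K * (1 + L * H) + (c * d * H * √Γ) ^ 2) / lam * K + 1) :
    Real.log (2 * m + 1) ≤ Real.log (2 * L + 2 * c ^ 2 + 3) + (4 + B) * Γ := by
  have hd' : (1 : ℝ) ≤ d := by exact_mod_cast hd
  have hK' : (1 : ℝ) ≤ K := by exact_mod_cast hK
  have hH' : (1 : ℝ) ≤ H := by exact_mod_cast hH
  set z := Real.exp Γ with hz
  set E := Real.exp (B * Γ) with hE
  have hinv : 1 / lam ≤ E := (Real.log_le_iff_le_exp (by positivity)).mp hlog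
  have hz1 : 1 ≤ z := Real.one_le_exp hΓ
  have hzE : 1 ≤ z ^ 4 * E :=
    one_le_mul_of_one_le_of_one_le (one_le_pow₀ hz1) (Real.one_le_exp (by positivity))
  have hKz : (K : ℝ) ≤ z := by
    have hdH : (1 : ℝ) ≤ d * H := one_le_mul_of_one_le_of_one_le hd' hH'
    nlinarith
  have hbound : 2 * m + 1 ≤ (2 * L + 2 * c ^ 2 + 3) * (z ^ 4 * E) := by
    calc 2 * m + 1 ≤ 2 * ((K * (1 + L * H) + (c * d * H * √Γ) ^ 2) * (1 / lam) * K) + 3 := by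
          rw [div_eq_mul_one_div] at hm
          linarith
      _ ≤ 2 * ((L + c ^ 2) * z ^ 3 * E * z) + 3 * (z ^ 4 * E) := by
          gcongr
          · exact gridNumerator_le (by positivity) hΓ hd' hK' hH'
              (one_le_mul_of_one_le_of_one_le hL hH') hz1
              (by linarith [Real.add_one_le_exp Γ]) hprod
          · linarith
      _ = _ := by ring
  calc Real.log (2 * m + 1) ≤ Real.log ((2 * L + 2 * c ^ 2 + 3) * (z ^ 4 * E)) :=
        Real.log_le_log (by positivity) hbound
    _ = _ := by
        rw [Real.log_mul (by positivity) (by positivity),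
          Real.log_mul (by positivity) (by positivity), Real.log_pow, hz, hE, Real.log_exp,
          Real.log_exp]
        push_cast
        ring

theorem log_one_div_div_pow_le (hB : 0 ≤ B) (hΓ : Real.log 2 ≤ Γ) (hd : 1 ≤ d) {ℓ q m : ℝ}
    (hℓ : 0 ≤ ℓ) (hq : 0 < q) (hm : 0 ≤ m) (hqΓ : Real.log (q / p) ≤ Γ) (hp : 0 < p)
    (hgrid : Real.log (2 * m + 1) ≤ ℓ + (4 + B) * Γ) :
    Real.log (1 / (p / (q * (2 * m + 1) ^ (d + d * d)))) ≤ d ^ 2 * Γ * (9 + 2 * B + 4 * ℓ) := by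
  have hd' : (1 : ℝ) ≤ d := by exact_mod_cast hd
  have hΓ2 : 1 ≤ 2 * Γ := by linarith [Real.log_two_gt_d9]
  have hΓ0 : 0 ≤ Γ := by linarith
  have hsplit : 1 / (p / (q * (2 * m + 1) ^ (d + d * d))) =
      q / p * (2 * m + 1) ^ (d + d * d) := by field_simp
  rw [hsplit, Real.log_mul (by positivity) (by positivity), Real.log_pow]
  calc _ ≤ Γ + ((d + d * d : ℕ) : ℝ) * (ℓ + (4 + B) * Γ) := by gcongr
    _ ≤ d ^ 2 * Γ + (2 * d ^ 2) * (ℓ * (2 * Γ) + (4 + B) * Γ) := by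
        gcongr
        · exact le_mul_of_one_le_left hΓ0 (one_le_pow₀ hd')
        · push_cast
          nlinarith
        · exact le_mul_of_one_le_right hℓ hΓ2
    _ = _ := by ring

theorem noiseRadius_le (hB : 0 ≤ B) (hL : 0 ≤ L) (hd : 1 ≤ d) (hH : 1 ≤ H)
    (hΓ : Real.log 2 ≤ Γ) {ℓ δ : ℝ} (hℓ : 0 ≤ ℓ) (hlog : Real.log (1 + K / lam) ≤ (2 + B) * Γ)
    (hδ : Real.log (1 / δ) ≤ d ^ 2 * Γ * (9 + 2 * B + 4 * ℓ)) :
    noiseRadius L H d K lam δ ≤ (2 * L * √(20 + 5 * B + 8 * ℓ) + 8 * L) * (d * H * √Γ) := by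
  have hd' : (1 : ℝ) ≤ d := by exact_mod_cast hd
  have hH' : (1 : ℝ) ≤ H := by exact_mod_cast hH
  have hΓ0 : 0 ≤ Γ := (Real.log_nonneg one_le_two).trans hΓ
  have hdet : d * Real.log (1 + K / lam) ≤ d ^ 2 * ((2 + B) * Γ) := by
    refine (mul_le_mul_of_nonneg_left hlog d.cast_nonneg).trans ?_
    gcongr
    exact le_self_pow₀ hd' two_ne_zero
  have hsqrt : √((2 * L * H) ^ 2 * (d * Real.log (1 + K / lam) + 2 * Real.log (1 / δ))) ≤
      2 * L * √(20 + 5 * B + 8 * ℓ) * (d * H * √Γ) := by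
    refine Real.sqrt_le_iff.mpr ⟨by positivity, ?_⟩
    calc _ ≤ (2 * L * H) ^ 2 *
          (d ^ 2 * ((2 + B) * Γ) + 2 * (d ^ 2 * Γ * (9 + 2 * B + 4 * ℓ))) := by gcongr
      _ = (2 * L * H) ^ 2 * (d ^ 2 * √Γ ^ 2 * √(20 + 5 * B + 8 * ℓ) ^ 2) := by
          rw [Real.sq_sqrt hΓ0, Real.sq_sqrt (by positivity)]; ring
      _ = _ := by ring
  have hgridErr : 4 * L ≤ 8 * L * (d * H * √Γ) := by
    calc 4 * L = 4 * L * (1 * 1 * 1) := by ring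
      _ ≤ 4 * L * (d * H * (2 * √Γ)) := by gcongr; exact one_le_two_mul_sqrt hΓ
      _ = _ := by ring
  unfold noiseRadius
  linarith

theorem mul_sqrt_mul_le (hB : 1 ≤ B) (hlamB : lam ≤ B) (hd : 1 ≤ d) (hΓ : Real.log 2 ≤ Γ) :
    H * √(lam * d) ≤ 2 * B * (d * H * √Γ) := by
  have hd' : (1 : ℝ) ≤ d := by exact_mod_cast hd
  have hBd : 1 ≤ B * d := one_le_mul_of_one_le_of_one_le hB hd'
  calc H * √(lam * d) ≤ H * (B * d * 1) := by
        gcongr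
        refine (Real.sqrt_le_sqrt (by gcongr : lam * d ≤ B * d)).trans ?_
        rw [mul_one, Real.sqrt_le_left (by positivity)]
        exact le_self_pow₀ hBd two_ne_zero
    _ ≤ H * (B * d * (2 * √Γ)) := by gcongr; exact one_le_two_mul_sqrt hΓ
    _ = _ := by ring

theorem log_two_le_gamma (hd : 1 ≤ d) (hK : 1 ≤ K) (hH : 1 ≤ H) (hp : 0 < p) (hp1 : p ≤ 1)
    (hΓ : Γ = Real.log (2 * d * K * H / p)) : Real.log 2 ≤ Γ := by
  have hd' : (1 : ℝ) ≤ d := by exact_mod_cast hd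
  have hK' : (1 : ℝ) ≤ K := by exact_mod_cast hK
  have hH' : (1 : ℝ) ≤ H := by exact_mod_cast hH
  rw [hΓ]
  refine log_le_of_mul_le hp two_pos ?_
  calc 2 * p ≤ 2 * 1 * 1 * 1 := by linarith
    _ ≤ 2 * d * K * H := by gcongr

theorem le_mul_mul_mul_sqrt (hc : 2 ≤ c) (hd : 1 ≤ d) (hΓ : Real.log 2 ≤ Γ) :
    H ≤ c * d * H * √Γ := by
  calc (H : ℝ) = 1 * H * 1 := by ring
    _ ≤ d * H * (2 * √Γ) := by
        gcongr
        exacts [by exact_mod_cast hd, one_le_two_mul_sqrt hΓ]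
    _ = 2 * d * H * √Γ := by ring
    _ ≤ c * d * H * √Γ := by gcongr

theorem width_le (hB : 1 ≤ B) (hL : 1 ≤ L) (hd : 1 ≤ d) (hK : 1 ≤ K) (hH : 1 ≤ H) (hp : 0 < p)
    (hp1 : p < 1) (hΓ : Γ = Real.log (2 * d * K * H / p)) (hlam : 0 < lam) (hlamB : lam ≤ B)
    (hlog : Real.log (1 / lam) ≤ B * Γ) {m : ℕ}
    (hm : (m : ℝ) ≤ (K * (1 + L * H) + (c * d * H * √Γ) ^ 2) / lam * K + 1) :
    noiseRadius L H d K lam (p / (2 * H * K * (2 * m + 1) ^ (d + d * d))) + H * √(lam * d) ≤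
      widthConst B L c * (d * H * √Γ) := by
  have hd' : (1 : ℝ) ≤ d := by exact_mod_cast hd
  have hK' : (1 : ℝ) ≤ K := by exact_mod_cast hK
  have hH' : (1 : ℝ) ≤ H := by exact_mod_cast hH
  have hKH : (1 : ℝ) ≤ K * H := one_le_mul_of_one_le_of_one_le hK' hH'
  have hdH : (1 : ℝ) ≤ d * H := one_le_mul_of_one_le_of_one_le hd' hH'
  have hlog2 : Real.log 2 ≤ Γ := log_two_le_gamma hd hK hH hp hp1.le hΓ
  have hΓ0 : 0 ≤ Γ := (Real.log_nonneg one_le_two).trans hlog2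
  have hlogHK : Real.log (2 * H * K / p) ≤ Γ := by
    rw [hΓ, show (2 * H * K : ℝ) = 2 * 1 * K * H by ring]
    gcongr
  have hprod : 2 * d * K * H ≤ Real.exp Γ := by
    rw [hΓ, Real.exp_log (by positivity), le_div_iff₀ hp]
    exact mul_le_of_le_one_right (by positivity) hp1.le
  set ℓ := Real.log (2 * L + 2 * c ^ 2 + 3)
  have hℓ : 0 ≤ ℓ := Real.log_nonneg (by nlinarith [sq_nonneg c])
  have hgrid : Real.log (2 * m + 1) ≤ ℓ + (4 + B) * Γ :=
    log_two_mul_add_one_le (by positivity) hL hd hK hH hΓ0 hprod hlam hlog m.cast_nonneg hm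
  have hδ := log_one_div_div_pow_le (by positivity) hlog2 hd hℓ (by positivity) m.cast_nonneg
    hlogHK hp hgrid
  have hdet := log_one_add_div_le (by positivity) hlog2 (by nlinarith : (K : ℝ) ≤ Real.exp Γ)
    hlam hlog
  calc _ ≤ (2 * L * √(20 + 5 * B + 8 * ℓ) + 8 * L) * (d * H * √Γ) + 2 * B * (d * H * √Γ) :=
        add_le_add (noiseRadius_le (by positivity) (by positivity) hd hH hlog2 hℓ hdet hδ)
          (mul_sqrt_mul_le hB hlamB hd hlog2)
    _ = _ := by rw [widthConst]; ring

end Width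

section Regret

variable {B c p lam Γ : ℝ} {d K H : ℕ}

theorem one_le_two_mul_mul_log_one_add_div (hB : 1 ≤ B) (hK : 1 ≤ K) (hlam : 0 < lam)
    (hlamB : lam ≤ B) : 1 ≤ 2 * B * Real.log (1 + K / lam) := by
  have hK' : (1 : ℝ) ≤ K := by exact_mod_cast hK
  calc 1 ≤ 2 * B * (1 - (1 + 1 / B)⁻¹) := by
        field_simp
        linarith
    _ ≤ 2 * B * Real.log (1 + 1 / B) := by
        gcongr
        exact Real.one_sub_inv_le_log_of_pos (by positivity)
    _ ≤ 2 * B * Real.log (1 + K / lam) := by gcongr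

theorem sqrt_div_log_two_le {x : ℝ} (hx : 0 ≤ x) : √(x / Real.log 2) ≤ 1.21 * √x := by
  refine Real.sqrt_le_iff.mpr ⟨by positivity, ?_⟩
  rw [mul_pow, Real.sq_sqrt hx, div_le_iff₀ (Real.log_pos one_lt_two)]
  nlinarith [Real.log_two_gt_d9]

theorem mul_sqrt_mul_sqrt_le {l : ℝ} (hΓ : 0 ≤ Γ) (hl : 0 ≤ l) :
    1.41 * (√Γ * √(K * d * l)) ≤ √K * √(2 * d * Γ * l) := by
  rw [← Real.sqrt_mul hΓ, ← Real.sqrt_mul K.cast_nonneg]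
  refine Real.le_sqrt_of_sq_le ?_
  rw [mul_pow, Real.sq_sqrt (by positivity)]
  nlinarith [(by positivity : 0 ≤ Γ * (K * d * l))]

theorem transitionRadius_le (hB : 1 ≤ B) (hd : 1 ≤ d) (hK : 1 ≤ K) (hΓ : 0 ≤ Γ) {l δ : ℝ}
    (hl : 1 ≤ 2 * B * l) (hlogK : Real.log (1 + K) ≤ Γ) (hδ : Real.log (1 / δ) ≤ Γ) :
    transitionRadius H K δ ≤ H * (4 * B * (√Γ * √(K * d * l))) := by
  have hd' : (1 : ℝ) ≤ d := by exact_mod_cast hd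
  have hK' : (1 : ℝ) ≤ K := by exact_mod_cast hK
  have hl0 : 0 ≤ l := by
    by_contra! hneg
    nlinarith
  unfold transitionRadius
  gcongr
  refine Real.sqrt_le_iff.mpr ⟨by positivity, ?_⟩
  calc _ ≤ (K + 1) * (Γ + 2 * Γ) := by gcongr
    _ ≤ (K + K) * (Γ + 2 * Γ) := by gcongr
    _ = 6 * (K * Γ) * 1 := by ring
    _ ≤ 6 * (K * Γ) * (2 * B * l) := by gcongr
    _ = 12 * B * (K * Γ * l * 1) := by ring
    _ ≤ 16 * B ^ 2 * (K * Γ * l * d) := by gcongr <;> nlinarith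
    _ = (4 * B) ^ 2 * (√Γ ^ 2 * √(K * d * l) ^ 2) := by
        rw [Real.sq_sqrt hΓ, Real.sq_sqrt (by positivity)]; ring
    _ = _ := by ring

theorem regret_bound_le {N : ℕ} (hB : 1 ≤ B) (hd : 1 ≤ d) (hK : 1 ≤ K) (hH : 1 ≤ H) (hp : 0 < p)
    (hp1 : p < 1) (hΓ : Γ = Real.log (2 * d * K * H / p)) (hlam : 0 < lam) (hlamB : lam ≤ B)
    {b c₀ : ℝ} (hc₀ : 0 ≤ c₀) (hc : 7 * c₀ + 20 * B ≤ c) (hb : b ≤ c₀ * (d * H * √Γ)) :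
    H * (N : ℝ) ^ H * ((c * d * H * √Γ + b) * √(K * (d * Real.log (1 + K / lam) / Real.log 2)) +
        transitionRadius H K (p / (2 * H))) ≤
      c * (H : ℝ) ^ 2 * (N : ℝ) ^ H * d * √(K : ℝ) * √(2 * d * Γ * Real.log (1 + K / lam)) := by
  have hd' : (1 : ℝ) ≤ d := by exact_mod_cast hd
  have hK' : (1 : ℝ) ≤ K := by exact_mod_cast hK
  have hH' : (1 : ℝ) ≤ H := by exact_mod_cast hH
  have hdH : (1 : ℝ) ≤ d * H := one_le_mul_of_one_le_of_one_le hd' hH'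
  have hdK : (1 : ℝ) ≤ d * K := one_le_mul_of_one_le_of_one_le hd' hK'
  have hlogK : Real.log (1 + K) ≤ Γ :=
    hΓ ▸ log_le_of_mul_le hp (by positivity) (by nlinarith)
  have hlogH : Real.log (1 / (p / (2 * H))) ≤ Γ := by
    rw [hΓ, one_div_div]
    gcongr
    nlinarith
  have hΓ0 : 0 ≤ Γ := (Real.log_nonneg (by linarith)).trans hlogK
  set l := Real.log (1 + K / lam)
  have hl0 : 0 ≤ l := Real.log_nonneg (le_add_of_nonneg_right (by positivity))
  set E := √(K * d * l)
  have hE : √(K * (d * l / Real.log 2)) ≤ 1.21 * E := by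
    rw [← mul_div_assoc, ← mul_assoc]
    exact sqrt_div_log_two_le (by positivity)
  have hc0 : 0 ≤ c := by linarith
  have hrad := transitionRadius_le (H := H) hB hd hK hΓ0
    (one_le_two_mul_mul_log_one_add_div hB hK hlam hlamB) hlogK hlogH
  calc _ ≤ H * (N : ℝ) ^ H * ((c * d * H * √Γ + c₀ * (d * H * √Γ)) * (1.21 * E) +
        H * (4 * B * (√Γ * E))) := by gcongr
    _ ≤ H * (N : ℝ) ^ H * ((c * d * H * √Γ + c₀ * (d * H * √Γ)) * (1.21 * E) +
        d * H * (4 * B * (√Γ * E))) := by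
        gcongr
        exact le_mul_of_one_le_left (by positivity) hd'
    _ = H ^ 2 * (N : ℝ) ^ H * d * ((1.21 * (c + c₀) + 4 * B) * (√Γ * E)) := by ring
    _ ≤ H ^ 2 * (N : ℝ) ^ H * d * (c * 1.41 * (√Γ * E)) := by
        gcongr
        linarith
    _ = c * H ^ 2 * (N : ℝ) ^ H * d * (1.41 * (√Γ * E)) := by ring
    _ ≤ c * H ^ 2 * (N : ℝ) ^ H * d * (√K * √(2 * d * Γ * l)) := by
        exact mul_le_mul_of_nonneg_left (mul_sqrt_mul_sqrt_le hΓ0 hl0) (by positivity)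
    _ = _ := by ring

end Regret

end RiskQ

theorem theorem1 (B L : ℝ) (hB : 1 ≤ B) (hL : 1 ≤ L) :
    ∃ cβ : ℝ, 0 < cβ ∧
      ∀ (X A Ω : Type*) [Fintype X] [Fintype A] [Nonempty A] [MeasurableSpace Ω]
        (μ : MeasureTheory.Measure Ω) [MeasureTheory.IsProbabilityMeasure μ]
        (H N d K : ℕ) [NeZero N] (_ : 1 ≤ H) (_ : 1 ≤ K)
        (M : RiskQ.RiskMDP X A H) (φ : X → A → Fin d → ℝ) (_ : M.IsMultipattern N φ)
        (p : ℝ) (_ : 0 < p) (_ : p < 1)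
        (Γ : ℝ) (_ : Γ = Real.log (2 * d * K * H / p))
        (lam : ℝ) (_ : 0 < lam) (_ : lam ≤ B) (_ : Real.log (1 / lam) ≤ B * Γ)
        (β : ℝ) (_ : β = cβ * d * H * √Γ)
        (R : RiskQ.QLearningRun M N φ K lam β μ)
        (_ : R.UsesAggregator ∨ R.UsesUnbiasedEstimator L),
        μ {ω | cβ * (H : ℝ) ^ 2 * (N : ℝ) ^ H * d * √(K : ℝ) *
              √(2 * d * Γ * Real.log (1 + K / lam)) < R.regret ω} ≤ ENNReal.ofReal p := by
  obtain ⟨c, hc2, hc⟩ := RiskQ.exists_const_dominating_width hB hL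
  refine ⟨c, by linarith, ?_⟩
  intro X A Ω _ _ _ _ μ _ H N d K _ hH hK M φ hM p hp hp1 Γ hΓ lam hlam hlamB hlog β hβ R hR
  subst hβ
  have hR' : R.UsesUnbiasedEstimator L := hR.elim (fun h => h.usesUnbiasedEstimator hL) id
  obtain ⟨ω₀⟩ : Nonempty Ω := μ.nonempty_of_neZero
  have hd : 1 ≤ d := hM.one_le_dim (R.state 1 1 ω₀) (Classical.arbitrary A)
  have hw : 0 ≤ RiskQ.widthConst B L c := RiskQ.widthConst_nonneg (by linarith) (by linarith)
  set m : ℕ := ⌈(K * (1 + L * H) + (c * d * H * √Γ) ^ 2) / lam * K⌉₊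
  have hwidth := RiskQ.width_le (c := c) (m := m) hB hL hd hK hH hp hp1 hΓ hlam hlamB hlog
    (Nat.ceil_lt_add_one (by positivity)).le
  have hwβ : RiskQ.widthConst B L c * (d * H * √Γ) ≤ c * d * H * √Γ := by
    rw [mul_assoc c, mul_assoc c]
    gcongr
    linarith
  have hHβ : H ≤ c * d * H * √Γ := RiskQ.le_mul_mul_mul_sqrt hc2 hd
    (RiskQ.log_two_le_gamma hd hK hH hp hp1.le hΓ)
  refine (MeasureTheory.measure_mono fun ω hω => ?_).trans
    (RiskQ.QLearningRun.measure_regret_gt_le hR' hL hM hH hK hlam hp rfl rfl rfl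
      (hwidth.trans hwβ) hHβ (Nat.le_ceil _))
  exact (RiskQ.regret_bound_le hB hd hK hH hp hp1 hΓ hlam hlamB hw hc hwidth).trans_lt hω
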